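/- **Conventions.** All posets, simplicial sets and strict 2-categories are small. $\mathrm{Ord}$ is the category of posets and monotone maps, $2\text{-}\mathrm{Cat}$ the category of strict 2-categories and strict 2-functors, $e$ the terminal 2-category and $\Delta_1=\{0\to1\}$. In $\mathrm{Ord}$ and in $2\text{-}\mathrm{Cat}$, a *sieve* is a morphism $X'\to X$ which is the pullback of $\{0\}\hookrightarrow\Delta_1$ along some morphism $X\to\Delta_1$. For a poset $E$, let $\mathcal O(E)$ be the 2-category whose objects are the elements of $E$, whose 1-cells $x\to y$ are the finite nonempty chains $S\subseteq E$ with $\min S=x$ and $\max S=y$, composed by union, and with exactly one 2-cell $S\Rightarrow S'$ between parallel 1-cells if $S\subseteq S'$, and none otherwise. The 2-category $\mathcal O(\Delta_m)$ is the 2-truncated Street oriental. Let $N_2:2\text{-}\mathrm{Cat}\to\mathrm{sSet}$, $N_2(C)_m=\mathrm{Hom}(\mathcal O(\Delta_m),C)$, be the 2-nerve, $c_2$ its left adjoint, and $N$ the usual nerve of posets. The morphism $N(E)\to N_2\mathcal O(E)$, $(\sigma:\Delta_m\to E)\mapsto\mathcal O(\sigma)$, corresponds by adjunction to a canonical 2-functor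 $c_2N(E)\to\mathcal O(E)$. A 2-functor $F$ is a *Thomason weak equivalence* if $N_2(F)$ is a weak equivalence of simplicial sets. A *normalised oplax 2-functor* $F:C\to D$ consists of maps on objects, 1-cells and 2-cells, compatible with sources and targets, and of 2-cells $F(g,f):F(gf)\Rightarrow F(g)F(f)$ for composable 1-cells $f,g$, such that $F(1_x)=1_{F(x)}$, the constraints $F(1,f)$ and $F(f,1)$ are identities, $(F(h)*F(g,f))F(h,gf)=(F(h,g)*F(f))F(hg,f)$, $F$ preserves vertical composition and identities of 1-cells, and $F(l,g)F(\beta*\alpha)=(F(\beta)*F(\alpha))F(k,f)$ for $\alpha:f\Rightarrow g$ and $\beta:k\Rightarrow l$ horizontally composable. An *oplax homotopy* from $F$ to $G$ (where $F,G:A\to B$) is a normalised oplax 2-functor $H:\Delta_1\times A\to B$ restricting to $F$ on $\{0\}\times A$ and to $G$ on $\{1\}\times A$. A *strong oplax deformation retract structure* on a sieve of 2-categories $j:A\to B$ consists of a strict 2-functor $\rho:B\to A$ with $\rho j=1_A$ and an oplax homotopy $H$ from $j\rho$ to $1_B$ such that 1. $H(1_{\Delta_1}\times j)=j\,p_A$,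 where $p_A:\Delta_1\times A\to A$ is the projection; 2. for all composable 1-cells $x\xrightarrow{f}y\xrightarrow{g}z$ of $B$ with $f$ in $A$, $H(0\to1,gf)=H(0\to1,g)H(0,f)$, and the corresponding constraint is the identity. A sieve admitting such a structure is called a *strong oplax deformation retract 2-sieve*. **Theorem.** Let $i:E'\to E$ be a sieve of posets (viewed as an inclusion) and let $r:E\to E'$ be a retraction of $i$ (so $ri=1_{E'}$) which is also a right adjoint of $i$. Then: * $c_2N(i)$ is a strong oplax deformation retract 2-sieve. More precisely, the canonical 2-functor $c_2N(E)\to\mathcal O(E)$ is an isomorphism, and, identifying $c_2N(E)$ with $\mathcal O(E)$ by means of it, there is a strong oplax deformation retract structure on $c_2N(i)$ with retraction $c_2N(r)$ and with oplax homotopy $H$ given, for $x\in E$ and for $S$ a finite nonempty chain of $E$, by $$H(0,x)=ir(x),\quad H(1,x)=x,\quad H(0,S)=ir(S),\quad H(1,S)=S,$$ $$H(0\to1,S)=\begin{cases}\{ir(\min S),\max S\}&\text{if }S\subseteq E\setminus E',\\(S\cap E')\cup\{\max S\}&\text{otherwise}\end{cases}$$ (the values of $H$ on 2-cells and its constraints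 are then determined, since there is at most one 2-cell between two parallel 1-cells of $\mathcal O(E)$). * $c_2N(i)$ is a Thomason weak equivalence, and so is every cobase change of it: for every cocartesian square of $2\text{-}\mathrm{Cat}$ with sides $c_2N(i):c_2N(E')\to c_2N(E)$, $c_2N(E')\to A'$, $c_2N(E)\to B'$ and $i':A'\to B'$, the 2-functor $i'$ is a Thomason weak equivalence. -/

import Mathlib

open CategoryTheory Opposite

universe u v w

/-! ## Strict 2-categories and strict 2-functors -/

/-- A (small) strict 2-category, presented by its sets of objects, of 1-cells and of 2-cells.
`comp₁ g f` is the composite `g f` of `f` followed by `g`, `vcomp β α` is the vertical composite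
`β α` of `α` followed by `β`, and `hcomp β α` is the horizontal composite `β * α`. -/
structure TwoCat : Type (u + 1) where
  Ob : Type u
  Ar : Type u
  Ce : Type u
  src : Ar → Ob
  tgt : Ar → Ob
  src₂ : Ce → Ar
  tgt₂ : Ce → Ar
  src_src₂ : ∀ α, src (src₂ α) = src (tgt₂ α)
  tgt_src₂ : ∀ α, tgt (src₂ α) = tgt (tgt₂ α)
  id₁ : Ob → Ar
  src_id₁ : ∀ x, src (id₁ x) = x
  tgt_id₁ : ∀ x, tgt (id₁ x) = x
  comp₁ : ∀ g f : Ar, src g = tgt f → Ar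
  src_comp₁ : ∀ g f h, src (comp₁ g f h) = src f
  tgt_comp₁ : ∀ g f h, tgt (comp₁ g f h) = tgt g
  id_comp₁ : ∀ f h, comp₁ (id₁ (tgt f)) f h = f
  comp_id₁ : ∀ f h, comp₁ f (id₁ (src f)) h = f
  assoc₁ : ∀ (h g f : Ar) (hg : src h = tgt g) (gf : src g = tgt f) h₁ h₂,
    comp₁ (comp₁ h g hg) f h₁ = comp₁ h (comp₁ g f gf) h₂
  id₂ : Ar → Ce
  src₂_id₂ : ∀ f, src₂ (id₂ f) = f
  tgt₂_id₂ : ∀ f, tgt₂ (id₂ f) = f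
  vcomp : ∀ β α : Ce, src₂ β = tgt₂ α → Ce
  src₂_vcomp : ∀ β α h, src₂ (vcomp β α h) = src₂ α
  tgt₂_vcomp : ∀ β α h, tgt₂ (vcomp β α h) = tgt₂ β
  id_vcomp : ∀ α h, vcomp (id₂ (tgt₂ α)) α h = α
  vcomp_id : ∀ α h, vcomp α (id₂ (src₂ α)) h = α
  vassoc : ∀ (γ β α : Ce) (hγβ : src₂ γ = tgt₂ β) (hβα : src₂ β = tgt₂ α) h₁ h₂,
    vcomp (vcomp γ β hγβ) α h₁ = vcomp γ (vcomp β α hβα) h₂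
  hcomp : ∀ β α : Ce, src (src₂ β) = tgt (src₂ α) → Ce
  src₂_hcomp : ∀ β α h, src₂ (hcomp β α h) = comp₁ (src₂ β) (src₂ α) h
  tgt₂_hcomp : ∀ β α h h', tgt₂ (hcomp β α h) = comp₁ (tgt₂ β) (tgt₂ α) h'
  id_hcomp : ∀ α h, hcomp (id₂ (id₁ (tgt (src₂ α)))) α h = α
  hcomp_id : ∀ α h, hcomp α (id₂ (id₁ (src (src₂ α)))) h = α
  hassoc : ∀ (γ β α : Ce) (hγβ : src (src₂ γ) = tgt (src₂ β)) (hβα : src (src₂ β) = tgt (src₂ α))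
    h₁ h₂, hcomp (hcomp γ β hγβ) α h₁ = hcomp γ (hcomp β α hβα) h₂
  hcomp_id₂ : ∀ g f (h : src g = tgt f) h', hcomp (id₂ g) (id₂ f) h' = id₂ (comp₁ g f h)
  interchange : ∀ (δ γ β α : Ce) (hδγ : src (src₂ δ) = tgt (src₂ γ))
    (hβα : src (src₂ β) = tgt (src₂ α)) (hδβ : src₂ δ = tgt₂ β) (hγα : src₂ γ = tgt₂ α) h₁ h₂,
    vcomp (hcomp δ γ hδγ) (hcomp β α hβα) h₁ = hcomp (vcomp δ β hδβ) (vcomp γ α hγα) h₂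

/-- A strict 2-functor. -/
@[ext]
structure TwoFunctor (C : TwoCat.{u}) (D : TwoCat.{v}) where
  ob : C.Ob → D.Ob
  ar : C.Ar → D.Ar
  ce : C.Ce → D.Ce
  src_ar : ∀ f, D.src (ar f) = ob (C.src f)
  tgt_ar : ∀ f, D.tgt (ar f) = ob (C.tgt f)
  src₂_ce : ∀ α, D.src₂ (ce α) = ar (C.src₂ α)
  tgt₂_ce : ∀ α, D.tgt₂ (ce α) = ar (C.tgt₂ α)
  ar_id₁ : ∀ x, ar (C.id₁ x) = D.id₁ (ob x)
  ar_comp₁ : ∀ g f h h', ar (C.comp₁ g f h) = D.comp₁ (ar g) (ar f) h'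
  ce_id₂ : ∀ f, ce (C.id₂ f) = D.id₂ (ar f)
  ce_vcomp : ∀ β α h h', ce (C.vcomp β α h) = D.vcomp (ce β) (ce α) h'
  ce_hcomp : ∀ β α h h', ce (C.hcomp β α h) = D.hcomp (ce β) (ce α) h'

namespace TwoFunctor

/-- The identity 2-functor. -/
@[simps]
def id (C : TwoCat.{u}) : TwoFunctor C C where
  ob x := x
  ar f := f
  ce α := α
  src_ar _ := rfl
  tgt_ar _ := rfl
  src₂_ce _ := rfl
  tgt₂_ce _ := rfl
  ar_id₁ _ := rfl
  ar_comp₁ _ _ _ _ := rfl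
  ce_id₂ _ := rfl
  ce_vcomp _ _ _ _ := rfl
  ce_hcomp _ _ _ _ := rfl

section

variable {C : TwoCat.{u}} {D : TwoCat.{v}} {E : TwoCat.{w}}

theorem composable₁ (F : TwoFunctor C D) {g f : C.Ar} (h : C.src g = C.tgt f) :
    D.src (F.ar g) = D.tgt (F.ar f) := by
  rw [F.src_ar, F.tgt_ar, h]

theorem composable₂ (F : TwoFunctor C D) {β α : C.Ce} (h : C.src₂ β = C.tgt₂ α) :
    D.src₂ (F.ce β) = D.tgt₂ (F.ce α) := by
  rw [F.src₂_ce, F.tgt₂_ce, h]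

theorem composableH (F : TwoFunctor C D) {β α : C.Ce}
    (h : C.src (C.src₂ β) = C.tgt (C.src₂ α)) :
    D.src (D.src₂ (F.ce β)) = D.tgt (D.src₂ (F.ce α)) := by
  rw [F.src₂_ce, F.src₂_ce, F.composable₁ h]

/-- The composite of two 2-functors (`F` first). -/
@[simps]
def comp (F : TwoFunctor C D) (G : TwoFunctor D E) : TwoFunctor C E where
  ob x := G.ob (F.ob x)
  ar f := G.ar (F.ar f)
  ce α := G.ce (F.ce α)
  src_ar f := by rw [G.src_ar, F.src_ar]
  tgt_ar f := by rw [G.tgt_ar, F.tgt_ar]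
  src₂_ce f := by rw [G.src₂_ce, F.src₂_ce]
  tgt₂_ce f := by rw [G.tgt₂_ce, F.tgt₂_ce]
  ar_id₁ x := by rw [F.ar_id₁, G.ar_id₁]
  ar_comp₁ g f h h' := by rw [F.ar_comp₁ g f h (F.composable₁ h), G.ar_comp₁]
  ce_id₂ x := by rw [F.ce_id₂, G.ce_id₂]
  ce_vcomp g f h h' := by rw [F.ce_vcomp g f h (F.composable₂ h), G.ce_vcomp]
  ce_hcomp g f h h' := by rw [F.ce_hcomp g f h (F.composableH h), G.ce_hcomp]

end

end TwoFunctor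

namespace TwoCat

/-- The category `2-Cat` of small strict 2-categories and strict 2-functors. -/
instance : Category.{u} TwoCat.{u} where
  Hom C D := TwoFunctor C D
  id C := TwoFunctor.id C
  comp F G := TwoFunctor.comp F G

@[simp] theorem id_ob (C : TwoCat.{u}) (x : C.Ob) : TwoFunctor.ob (𝟙 C) x = x := rfl
@[simp] theorem id_ar (C : TwoCat.{u}) (x : C.Ar) : TwoFunctor.ar (𝟙 C) x = x := rfl
@[simp] theorem id_ce (C : TwoCat.{u}) (x : C.Ce) : TwoFunctor.ce (𝟙 C) x = x := rfl

section

variable {C D E : TwoCat.{u}} (F : C ⟶ D) (G : D ⟶ E)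

@[simp] theorem comp_ob (x : C.Ob) : TwoFunctor.ob (F ≫ G) x = G.ob (F.ob x) := rfl
@[simp] theorem comp_ar (x : C.Ar) : TwoFunctor.ar (F ≫ G) x = G.ar (F.ar x) := rfl
@[simp] theorem comp_ce (x : C.Ce) : TwoFunctor.ce (F ≫ G) x = G.ce (F.ce x) := rfl

end

/-- A partially ordered set, seen as a 2-category all of whose 2-cells are identities. -/
def ofPoset (E : Type u) [PartialOrder E] : TwoCat.{u} where
  Ob := E
  Ar := {p : E × E // p.1 ≤ p.2}
  Ce := {p : E × E // p.1 ≤ p.2}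
  src p := p.1.1
  tgt p := p.1.2
  src₂ p := p
  tgt₂ p := p
  src_src₂ _ := rfl
  tgt_src₂ _ := rfl
  id₁ x := ⟨(x, x), le_rfl⟩
  src_id₁ _ := rfl
  tgt_id₁ _ := rfl
  comp₁ g f h := ⟨(f.1.1, g.1.2), f.2.trans (h.symm.le.trans g.2)⟩
  src_comp₁ _ _ _ := rfl
  tgt_comp₁ _ _ _ := rfl
  id_comp₁ _ _ := rfl
  comp_id₁ _ _ := rfl
  assoc₁ _ _ _ _ _ _ _ := rfl
  id₂ p := p
  src₂_id₂ _ := rfl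
  tgt₂_id₂ _ := rfl
  vcomp p _ _ := p
  src₂_vcomp _ _ h := h
  tgt₂_vcomp _ _ _ := rfl
  id_vcomp _ _ := rfl
  vcomp_id _ _ := rfl
  vassoc _ _ _ _ _ _ _ := rfl
  hcomp g f h := ⟨(f.1.1, g.1.2), f.2.trans (h.symm.le.trans g.2)⟩
  src₂_hcomp _ _ _ := rfl
  tgt₂_hcomp _ _ _ _ := rfl
  id_hcomp _ _ := rfl
  hcomp_id _ _ := rfl
  hassoc _ _ _ _ _ _ _ := rfl
  hcomp_id₂ _ _ _ _ := rfl
  interchange := by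
    rintro δ γ β α _ _ h rfl _ _
    rfl

/-- The 2-functor between posets induced by a monotone map. -/
def ofMonotone {E F : Type u} [PartialOrder E] [PartialOrder F] (φ : E →o F) :
    ofPoset E ⟶ ofPoset F where
  ob := φ
  ar p := ⟨(φ p.1.1, φ p.1.2), φ.monotone p.2⟩
  ce p := ⟨(φ p.1.1, φ p.1.2), φ.monotone p.2⟩
  src_ar _ := rfl
  tgt_ar _ := rfl
  src₂_ce _ := rfl
  tgt₂_ce _ := rfl
  ar_id₁ _ := rfl
  ar_comp₁ _ _ _ _ := rfl
  ce_id₂ _ := rfl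
  ce_vcomp _ _ _ _ := rfl
  ce_hcomp _ _ _ _ := rfl

/-- The product of two 2-categories. -/
def prod (A B : TwoCat.{u}) : TwoCat.{u} where
  Ob := A.Ob × B.Ob
  Ar := A.Ar × B.Ar
  Ce := A.Ce × B.Ce
  src p := (A.src p.1, B.src p.2)
  tgt p := (A.tgt p.1, B.tgt p.2)
  src₂ p := (A.src₂ p.1, B.src₂ p.2)
  tgt₂ p := (A.tgt₂ p.1, B.tgt₂ p.2)
  src_src₂ _ := Prod.ext (A.src_src₂ _) (B.src_src₂ _)
  tgt_src₂ _ := Prod.ext (A.tgt_src₂ _) (B.tgt_src₂ _)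
  id₁ x := (A.id₁ x.1, B.id₁ x.2)
  src_id₁ _ := Prod.ext (A.src_id₁ _) (B.src_id₁ _)
  tgt_id₁ _ := Prod.ext (A.tgt_id₁ _) (B.tgt_id₁ _)
  comp₁ g f h := (A.comp₁ g.1 f.1 (congrArg Prod.fst h), B.comp₁ g.2 f.2 (congrArg Prod.snd h))
  src_comp₁ _ _ _ := Prod.ext (A.src_comp₁ _ _ _) (B.src_comp₁ _ _ _)
  tgt_comp₁ _ _ _ := Prod.ext (A.tgt_comp₁ _ _ _) (B.tgt_comp₁ _ _ _)
  id_comp₁ _ _ := Prod.ext (A.id_comp₁ _ _) (B.id_comp₁ _ _)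
  comp_id₁ _ _ := Prod.ext (A.comp_id₁ _ _) (B.comp_id₁ _ _)
  assoc₁ _ _ _ _ _ _ _ := Prod.ext (A.assoc₁ _ _ _ _ _ _ _) (B.assoc₁ _ _ _ _ _ _ _)
  id₂ p := (A.id₂ p.1, B.id₂ p.2)
  src₂_id₂ _ := Prod.ext (A.src₂_id₂ _) (B.src₂_id₂ _)
  tgt₂_id₂ _ := Prod.ext (A.tgt₂_id₂ _) (B.tgt₂_id₂ _)
  vcomp g f h := (A.vcomp g.1 f.1 (congrArg Prod.fst h), B.vcomp g.2 f.2 (congrArg Prod.snd h))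
  src₂_vcomp _ _ _ := Prod.ext (A.src₂_vcomp _ _ _) (B.src₂_vcomp _ _ _)
  tgt₂_vcomp _ _ _ := Prod.ext (A.tgt₂_vcomp _ _ _) (B.tgt₂_vcomp _ _ _)
  id_vcomp _ _ := Prod.ext (A.id_vcomp _ _) (B.id_vcomp _ _)
  vcomp_id _ _ := Prod.ext (A.vcomp_id _ _) (B.vcomp_id _ _)
  vassoc _ _ _ _ _ _ _ := Prod.ext (A.vassoc _ _ _ _ _ _ _) (B.vassoc _ _ _ _ _ _ _)
  hcomp g f h := (A.hcomp g.1 f.1 (congrArg Prod.fst h), B.hcomp g.2 f.2 (congrArg Prod.snd h))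
  src₂_hcomp _ _ _ := Prod.ext (A.src₂_hcomp _ _ _) (B.src₂_hcomp _ _ _)
  tgt₂_hcomp _ _ _ _ := Prod.ext (A.tgt₂_hcomp _ _ _ _) (B.tgt₂_hcomp _ _ _ _)
  id_hcomp _ _ := Prod.ext (A.id_hcomp _ _) (B.id_hcomp _ _)
  hcomp_id _ _ := Prod.ext (A.hcomp_id _ _) (B.hcomp_id _ _)
  hassoc _ _ _ _ _ _ _ := Prod.ext (A.hassoc _ _ _ _ _ _ _) (B.hassoc _ _ _ _ _ _ _)
  hcomp_id₂ _ _ _ _ := Prod.ext (A.hcomp_id₂ _ _ _ _) (B.hcomp_id₂ _ _ _ _)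
  interchange _ _ _ _ _ _ h h' _ _ :=
    Prod.ext (A.interchange _ _ _ _ _ _ (congrArg Prod.fst h) (congrArg Prod.fst h') _ _)
      (B.interchange _ _ _ _ _ _ (congrArg Prod.snd h) (congrArg Prod.snd h') _ _)

/-- The second projection `p_B : A × B ⟶ B`. -/
def prodSnd (A B : TwoCat.{u}) : prod A B ⟶ B where
  ob x := x.2
  ar f := f.2
  ce α := α.2
  src_ar _ := rfl
  tgt_ar _ := rfl
  src₂_ce _ := rfl
  tgt₂_ce _ := rfl
  ar_id₁ _ := rfl
  ar_comp₁ _ _ _ _ := rfl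
  ce_id₂ _ := rfl
  ce_vcomp _ _ _ _ := rfl
  ce_hcomp _ _ _ _ := rfl

/-- The 2-functor `1_A × F : A × B ⟶ A × B'`. -/
def prodMapRight (A : TwoCat.{u}) {B B' : TwoCat.{u}} (F : B ⟶ B') : prod A B ⟶ prod A B' where
  ob x := (x.1, F.ob x.2)
  ar f := (f.1, F.ar f.2)
  ce α := (α.1, F.ce α.2)
  src_ar _ := Prod.ext rfl (F.src_ar _)
  tgt_ar _ := Prod.ext rfl (F.tgt_ar _)
  src₂_ce _ := Prod.ext rfl (F.src₂_ce _)
  tgt₂_ce _ := Prod.ext rfl (F.tgt₂_ce _)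
  ar_id₁ _ := Prod.ext rfl (F.ar_id₁ _)
  ar_comp₁ _ _ _ _ := Prod.ext rfl (F.ar_comp₁ _ _ _ _)
  ce_id₂ _ := Prod.ext rfl (F.ce_id₂ _)
  ce_vcomp _ _ _ _ := Prod.ext rfl (F.ce_vcomp _ _ _ _)
  ce_hcomp _ _ _ _ := Prod.ext rfl (F.ce_hcomp _ _ _ _)

end TwoCat

/-! ## Sieves -/

/-- The one-point poset `Δ₀`. -/
abbrev posetPt : PartOrd.{u} := PartOrd.of (ULift.{u} (Fin 1))

/-- The poset `Δ₁ = {0 < 1}`. -/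
abbrev posetI : PartOrd.{u} := PartOrd.of (ULift.{u} (Fin 2))

/-- The map `∂_ε : Δ₀ ⟶ Δ₁` with value `ε`. -/
def posetEnd (ε : Fin 2) : posetPt.{u} ⟶ posetI.{u} :=
  PartOrd.ofHom ⟨fun _ => ULift.up ε, fun _ _ _ => le_rfl⟩

/-- Relative to an interval with initial end `d₀ : e ⟶ I`, where `e` is a terminal object, a sieve
is a pullback of `d₀` along some morphism `χ : X ⟶ I`. -/
def IsSieveFor {𝒞 : Type u} [Category.{v} 𝒞] {e I X' X : 𝒞} (d₀ : e ⟶ I) (i : X' ⟶ X) : Prop :=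
  ∃ (t : X' ⟶ e) (χ : X ⟶ I), IsPullback i t χ d₀

/-- Sieves in the category of posets. -/
def IsPosetSieve {E' E : PartOrd.{u}} (i : E' ⟶ E) : Prop :=
  IsSieveFor (posetEnd.{u} 0) i

namespace TwoCat

/-- The 2-category `Δ₁`. -/
abbrev I : TwoCat.{u} := ofPoset posetI.{u}

/-- The object `ε` of `Δ₁`. -/
abbrev I.pt (ε : Fin 2) : I.{u}.Ob := (ULift.up ε : ULift.{u} (Fin 2))

/-- The 1-cell `0 → 1` of `Δ₁`. -/
def I.arrow : I.{u}.Ar := ⟨((ULift.up 0 : ULift.{u} (Fin 2)), (ULift.up 1 : ULift.{u} (Fin 2))),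
  ULift.up_le.2 (Fin.zero_le 1)⟩

/-- Sieves of 2-categories. -/
def IsSieve {A B : TwoCat.{u}} (i : A ⟶ B) : Prop :=
  IsSieveFor (ofMonotone (posetEnd.{u} 0).hom) i

/-- The 2-functor `∂_ε × 1_A : A ⟶ Δ₁ × A`. -/
def inclEnd (ε : Fin 2) (A : TwoCat.{u}) : A ⟶ prod I A where
  ob x := (I.pt ε, x)
  ar f := (I.id₁ (I.pt ε), f)
  ce α := (I.id₂ (I.id₁ (I.pt ε)), α)
  src_ar _ := rfl
  tgt_ar _ := rfl
  src₂_ce _ := rfl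
  tgt₂_ce _ := rfl
  ar_id₁ _ := rfl
  ar_comp₁ _ _ _ _ := rfl
  ce_id₂ _ := rfl
  ce_vcomp _ _ _ _ := rfl
  ce_hcomp _ _ _ _ := rfl

end TwoCat

/-! ## Normalised oplax 2-functors -/

/-- A normalised oplax 2-functor; `con g f h` is the constraint `F(g, f) : F(gf) ⇒ F(g)F(f)`. -/
@[ext]
structure OplaxTwoFunctor (C D : TwoCat.{u}) where
  ob : C.Ob → D.Ob
  ar : C.Ar → D.Ar
  ce : C.Ce → D.Ce
  con : ∀ g f : C.Ar, C.src g = C.tgt f → D.Ce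
  src_ar : ∀ f, D.src (ar f) = ob (C.src f)
  tgt_ar : ∀ f, D.tgt (ar f) = ob (C.tgt f)
  src₂_ce : ∀ α, D.src₂ (ce α) = ar (C.src₂ α)
  tgt₂_ce : ∀ α, D.tgt₂ (ce α) = ar (C.tgt₂ α)
  src₂_con : ∀ g f h, D.src₂ (con g f h) = ar (C.comp₁ g f h)
  tgt₂_con : ∀ g f h h', D.tgt₂ (con g f h) = D.comp₁ (ar g) (ar f) h'
  ar_id₁ : ∀ x, ar (C.id₁ x) = D.id₁ (ob x)
  con_id_left : ∀ f h, con (C.id₁ (C.tgt f)) f h = D.id₂ (ar f)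
  con_id_right : ∀ f h, con f (C.id₁ (C.src f)) h = D.id₂ (ar f)
  cocycle : ∀ (h g f : C.Ar) (hg : C.src h = C.tgt g) (gf : C.src g = C.tgt f) h₁ h₂ h₃ h₄ h₅ h₆,
    D.vcomp (D.hcomp (D.id₂ (ar h)) (con g f gf) h₁) (con h (C.comp₁ g f gf) h₂) h₃ =
      D.vcomp (D.hcomp (con h g hg) (D.id₂ (ar f)) h₄) (con (C.comp₁ h g hg) f h₅) h₆
  ce_vcomp : ∀ β α h h', ce (C.vcomp β α h) = D.vcomp (ce β) (ce α) h'
  ce_id₂ : ∀ f, ce (C.id₂ f) = D.id₂ (ar f)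
  ce_hcomp : ∀ (β α : C.Ce) (h : C.src (C.src₂ β) = C.tgt (C.src₂ α)) h₁ h₂ h₃ h₄,
    D.vcomp (con (C.tgt₂ β) (C.tgt₂ α) h₁) (ce (C.hcomp β α h)) h₂ =
      D.vcomp (D.hcomp (ce β) (ce α) h₃) (con (C.src₂ β) (C.src₂ α) h) h₄

namespace TwoFunctor

/-- A strict 2-functor, seen as an oplax one. -/
def toOplax {C D : TwoCat.{u}} (F : C ⟶ D) : OplaxTwoFunctor C D where
  ob := F.ob
  ar := F.ar
  ce := F.ce
  con g f h := D.id₂ (F.ar (C.comp₁ g f h))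
  src_ar := F.src_ar
  tgt_ar := F.tgt_ar
  src₂_ce := F.src₂_ce
  tgt₂_ce := F.tgt₂_ce
  src₂_con _ _ _ := D.src₂_id₂ _
  tgt₂_con g f h h' := by rw [D.tgt₂_id₂, F.ar_comp₁]
  ar_id₁ := F.ar_id₁
  con_id_left f h := by rw [C.id_comp₁]
  con_id_right f h := by rw [C.comp_id₁]
  cocycle h g f hg gf h₁ h₂ h₃ h₄ h₅ h₆ := by
    have e₁ : C.src h = C.tgt (C.comp₁ g f gf) := by rw [C.tgt_comp₁, hg]
    have e₂ : C.src (C.comp₁ h g hg) = C.tgt f := by rw [C.src_comp₁, gf]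
    have k₁ : D.hcomp (D.id₂ (F.ar h)) (D.id₂ (F.ar (C.comp₁ g f gf))) h₁ =
        D.id₂ (F.ar (C.comp₁ h (C.comp₁ g f gf) e₁)) := by
      rw [D.hcomp_id₂ _ _ (F.composable₁ e₁), ← F.ar_comp₁ _ _ e₁]
    have k₂ : D.hcomp (D.id₂ (F.ar (C.comp₁ h g hg))) (D.id₂ (F.ar f)) h₄ =
        D.id₂ (F.ar (C.comp₁ (C.comp₁ h g hg) f e₂)) := by
      rw [D.hcomp_id₂ _ _ (F.composable₁ e₂), ← F.ar_comp₁ _ _ e₂]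
    have key : ∀ (a b : D.Ar) (c d : D.Ce) (h h'), a = b → c = D.id₂ a → d = D.id₂ b →
        D.vcomp c (D.id₂ a) h = D.vcomp d (D.id₂ b) h' := by
      rintro a _ _ _ h h' rfl rfl rfl
      rfl
    exact key _ _ _ _ _ _ (by rw [C.assoc₁ h g f hg gf]) k₁ k₂
  ce_vcomp := F.ce_vcomp
  ce_id₂ := F.ce_id₂
  ce_hcomp β α h h₁ h₂ h₃ h₄ := by
    have k : ∀ (a b : D.Ar) (c d : D.Ce) (h h'), c = d → a = D.tgt₂ c → b = D.src₂ d →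
        D.vcomp (D.id₂ a) c h = D.vcomp d (D.id₂ b) h' := by
      rintro _ _ c _ h h' rfl rfl rfl
      rw [D.id_vcomp, D.vcomp_id]
    exact k _ _ _ _ _ _ (F.ce_hcomp _ _ _ _) (by rw [F.tgt₂_ce, C.tgt₂_hcomp])
      (by rw [← F.ce_hcomp _ _ h, F.src₂_ce, C.src₂_hcomp])

end TwoFunctor

namespace OplaxTwoFunctor

/-- The composite of a strict 2-functor `K` followed by an oplax 2-functor `F`. -/
def precomp {B C D : TwoCat.{u}} (K : B ⟶ C) (F : OplaxTwoFunctor C D) : OplaxTwoFunctor B D where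
  ob x := F.ob (K.ob x)
  ar f := F.ar (K.ar f)
  ce α := F.ce (K.ce α)
  con g f h := F.con (K.ar g) (K.ar f) (K.composable₁ h)
  src_ar f := by rw [F.src_ar, K.src_ar]
  tgt_ar f := by rw [F.tgt_ar, K.tgt_ar]
  src₂_ce f := by rw [F.src₂_ce, K.src₂_ce]
  tgt₂_ce f := by rw [F.tgt₂_ce, K.tgt₂_ce]
  src₂_con g f h := by rw [F.src₂_con, K.ar_comp₁]
  tgt₂_con g f h h' := by rw [F.tgt₂_con]
  ar_id₁ x := by rw [K.ar_id₁, F.ar_id₁]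
  con_id_left f h := by
    simp only [K.ar_id₁, ← K.tgt_ar, F.con_id_left]
  con_id_right f h := by
    simp only [K.ar_id₁, ← K.src_ar, F.con_id_right]
  cocycle h g f hg gf h₁ h₂ h₃ h₄ h₅ h₆ := by
    simp only [K.ar_comp₁ _ _ gf (K.composable₁ gf), K.ar_comp₁ _ _ hg (K.composable₁ hg)]
    apply F.cocycle
  ce_vcomp β α h h' := by rw [K.ce_vcomp _ _ h (K.composable₂ h), F.ce_vcomp]
  ce_id₂ f := by rw [K.ce_id₂, F.ce_id₂]
  ce_hcomp β α h h₁ h₂ h₃ h₄ := by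
    simp only [K.ce_hcomp _ _ h (K.composableH h), ← K.src₂_ce, ← K.tgt₂_ce]
    apply F.ce_hcomp

end OplaxTwoFunctor

/-! ## Strong oplax deformation retracts -/

/-- An oplax homotopy from `F` to `G`: a normalised oplax 2-functor `H : Δ₁ × A ⟶ B` restricting
to `F` and `G` on the two ends. -/
structure OplaxHomotopy {A B : TwoCat.{u}} (F G : OplaxTwoFunctor A B) where
  H : OplaxTwoFunctor (TwoCat.prod TwoCat.I A) B
  zero : H.precomp (TwoCat.inclEnd 0 A) = F
  one : H.precomp (TwoCat.inclEnd 1 A) = G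

open TwoCat in
/-- A strong oplax deformation retract structure on a sieve `i : A ⟶ B`. -/
structure StrongOplaxRetractStructure {A B : TwoCat.{u}} (i : A ⟶ B) where
  r : B ⟶ A
  retraction : i ≫ r = 𝟙 A
  homotopy : OplaxHomotopy (TwoFunctor.toOplax (r ≫ i)) (TwoFunctor.toOplax (𝟙 B))
  relative : homotopy.H.precomp (prodMapRight I i) = TwoFunctor.toOplax (prodSnd I A ≫ i)
  strict_ar : ∀ (g f : B.Ar) (h : B.src g = B.tgt f) h', f ∈ Set.range i.ar →
    homotopy.H.ar (I.arrow, B.comp₁ g f h) =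
      B.comp₁ (homotopy.H.ar (I.arrow, g)) (homotopy.H.ar (I.id₁ (I.pt 0), f)) h'
  strict_con : ∀ (g f : B.Ar) (h : B.src g = B.tgt f) h', f ∈ Set.range i.ar →
    homotopy.H.con (I.arrow, g) (I.id₁ (I.pt 0), f) h' =
      B.id₂ (homotopy.H.ar (I.arrow, B.comp₁ g f h))

/-- Strong oplax deformation retract 2-sieves. -/
def IsStrongOplaxRetractSieve {A B : TwoCat.{u}} (i : A ⟶ B) : Prop :=
  TwoCat.IsSieve i ∧ Nonempty (StrongOplaxRetractStructure i)

/-! ## The 2-category `O(E)` of a poset -/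

/-- A 1-cell of `O(E)`: a finite nonempty chain `S` of `E`, with source its minimum and target
its maximum. -/
structure OrientalArrow (E : Type u) [PartialOrder E] where
  S : Set E
  finite : S.Finite
  chain : IsChain (· ≤ ·) S
  min : E
  max : E
  isLeast : IsLeast S min
  isGreatest : IsGreatest S max

namespace OrientalArrow

variable {E : Type u} [PartialOrder E]

@[ext]
theorem ext {a b : OrientalArrow E} (h : a.S = b.S) : a = b := by
  obtain ⟨S, hf, hc, m, M, hm, hM⟩ := a
  obtain ⟨S', hf', hc', m', M', hm', hM'⟩ := b
  obtain rfl : S = S' := h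
  obtain rfl := hm.unique hm'
  obtain rfl := hM.unique hM'
  rfl

/-- The chain `{x}`. -/
@[simps]
def single (x : E) : OrientalArrow E where
  S := {x}
  finite := Set.finite_singleton x
  chain := Set.subsingleton_singleton.isChain
  min := x
  max := x
  isLeast := isLeast_singleton
  isGreatest := isGreatest_singleton

/-- The union of two chains such that the minimum of the first is the maximum of the second. -/
@[simps]
def union (b a : OrientalArrow E) (h : b.min = a.max) : OrientalArrow E where
  S := b.S ∪ a.S
  finite := b.finite.union a.finite
  chain := by
    rintro x (hx | hx) y (hy | hy) hxy
    · exact b.chain hx hy hxy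
    · exact Or.inr ((a.isGreatest.2 hy).trans (h.symm.le.trans (b.isLeast.2 hx)))
    · exact Or.inl ((a.isGreatest.2 hx).trans (h.symm.le.trans (b.isLeast.2 hy)))
    · exact a.chain hx hy hxy
  min := a.min
  max := b.max
  isLeast := ⟨Or.inr a.isLeast.1, by
    rintro x (hx | hx)
    · exact (a.isLeast.2 a.isGreatest.1).trans (h.symm.le.trans (b.isLeast.2 hx))
    · exact a.isLeast.2 hx⟩
  isGreatest := ⟨Or.inl b.isGreatest.1, by
    rintro x (hx | hx)
    · exact b.isGreatest.2 hx
    · exact (a.isGreatest.2 hx).trans (h.symm.le.trans (b.isLeast.2 b.isGreatest.1))⟩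

/-- The image of a chain by a monotone map. -/
@[simps]
def map {F : Type v} [PartialOrder F] (φ : E →o F) (a : OrientalArrow E) : OrientalArrow F where
  S := φ '' a.S
  finite := a.finite.image φ
  chain := by
    rintro _ ⟨x, hx, rfl⟩ _ ⟨y, hy, rfl⟩ hxy
    exact (a.chain hx hy fun h => hxy (congrArg φ h)).imp (fun h => φ.monotone h)
      fun h => φ.monotone h
  min := φ a.min
  max := φ a.max
  isLeast := φ.monotone.map_isLeast a.isLeast
  isGreatest := φ.monotone.map_isGreatest a.isGreatest

end OrientalArrow

/-- A 2-cell of `O(E)`: an inclusion between parallel 1-cells. -/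
@[ext]
structure OrientalCell (E : Type u) [PartialOrder E] where
  dom : OrientalArrow E
  cod : OrientalArrow E
  le : dom.S ⊆ cod.S
  min_eq : dom.min = cod.min
  max_eq : dom.max = cod.max

namespace TwoCat

/-- The 2-category `O(E)`: its objects are the elements of `E`, its 1-cells `x ⟶ y` are the finite
chains with minimum `x` and maximum `y`, composed by union, and its 2-cells are the inclusions
between parallel 1-cells. -/
def oriental (E : Type u) [PartialOrder E] : TwoCat.{u} where
  Ob := E
  Ar := OrientalArrow E
  Ce := OrientalCell E
  src a := a.min
  tgt a := a.max
  src₂ c := c.dom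
  tgt₂ c := c.cod
  src_src₂ c := c.min_eq
  tgt_src₂ c := c.max_eq
  id₁ x := .single x
  src_id₁ _ := rfl
  tgt_id₁ _ := rfl
  comp₁ b a h := b.union a h
  src_comp₁ _ _ _ := rfl
  tgt_comp₁ _ _ _ := rfl
  id_comp₁ a h := OrientalArrow.ext
    (Set.union_eq_self_of_subset_left (Set.singleton_subset_iff.2 a.isGreatest.1))
  comp_id₁ a h := OrientalArrow.ext
    (Set.union_eq_self_of_subset_right (Set.singleton_subset_iff.2 a.isLeast.1))
  assoc₁ _ _ _ _ _ _ _ := OrientalArrow.ext (Set.union_assoc _ _ _)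
  id₂ a := ⟨a, a, subset_rfl, rfl, rfl⟩
  src₂_id₂ _ := rfl
  tgt₂_id₂ _ := rfl
  vcomp d c h := ⟨c.dom, d.cod, c.le.trans (by rw [← h]; exact d.le),
    c.min_eq.trans (by rw [← h]; exact d.min_eq), c.max_eq.trans (by rw [← h]; exact d.max_eq)⟩
  src₂_vcomp _ _ _ := rfl
  tgt₂_vcomp _ _ _ := rfl
  id_vcomp _ _ := rfl
  vcomp_id _ _ := rfl
  vassoc _ _ _ _ _ _ _ := rfl
  hcomp d c h := ⟨d.dom.union c.dom h,
    d.cod.union c.cod (by rw [← d.min_eq, ← c.max_eq]; exact h),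
    Set.union_subset_union d.le c.le, c.min_eq, d.max_eq⟩
  src₂_hcomp _ _ _ := rfl
  tgt₂_hcomp _ _ _ _ := rfl
  id_hcomp c h := OrientalCell.ext
    (OrientalArrow.ext
      (Set.union_eq_self_of_subset_left (Set.singleton_subset_iff.2 c.dom.isGreatest.1)))
    (OrientalArrow.ext (Set.union_eq_self_of_subset_left (Set.singleton_subset_iff.2
      (show c.dom.max ∈ c.cod.S from c.max_eq ▸ c.cod.isGreatest.1))))
  hcomp_id c h := OrientalCell.ext
    (OrientalArrow.ext
      (Set.union_eq_self_of_subset_right (Set.singleton_subset_iff.2 c.dom.isLeast.1)))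
    (OrientalArrow.ext (Set.union_eq_self_of_subset_right (Set.singleton_subset_iff.2
      (show c.dom.min ∈ c.cod.S from c.min_eq ▸ c.cod.isLeast.1))))
  hassoc _ _ _ _ _ _ _ := OrientalCell.ext (OrientalArrow.ext (Set.union_assoc _ _ _))
    (OrientalArrow.ext (Set.union_assoc _ _ _))
  hcomp_id₂ _ _ _ _ := rfl
  interchange _ _ _ _ _ _ _ _ _ _ := rfl

/-- The 2-functor `O(φ)` induced by a monotone map. -/
def orientalMap {E F : Type u} [PartialOrder E] [PartialOrder F] (φ : E →o F) :
    oriental E ⟶ oriental F where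
  ob := φ
  ar a := a.map φ
  ce c := ⟨c.dom.map φ, c.cod.map φ, Set.image_mono c.le, congrArg φ c.min_eq,
    congrArg φ c.max_eq⟩
  src_ar _ := rfl
  tgt_ar _ := rfl
  src₂_ce _ := rfl
  tgt₂_ce _ := rfl
  ar_id₁ _ := OrientalArrow.ext Set.image_singleton
  ar_comp₁ _ _ _ _ := OrientalArrow.ext (Set.image_union _ _ _)
  ce_id₂ _ := rfl
  ce_vcomp _ _ _ _ := rfl
  ce_hcomp _ _ _ _ := OrientalCell.ext (OrientalArrow.ext (Set.image_union _ _ _))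
    (OrientalArrow.ext (Set.image_union _ _ _))

end TwoCat

/-- The functor `O` from posets to 2-categories. -/
def orientalFunctor : PartOrd.{u} ⥤ TwoCat.{u} where
  obj E := TwoCat.oriental E
  map φ := TwoCat.orientalMap φ.hom
  map_id E := by
    refine TwoFunctor.ext rfl ?_ ?_
    · exact funext fun a => OrientalArrow.ext (Set.image_id _)
    · exact funext fun a => OrientalCell.ext (OrientalArrow.ext (Set.image_id _))
        (OrientalArrow.ext (Set.image_id _))
  map_comp φ ψ := by
    refine TwoFunctor.ext rfl ?_ ?_
    · exact funext fun a => OrientalArrow.ext (Set.image_comp ψ φ _)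
    · exact funext fun a => OrientalCell.ext (OrientalArrow.ext (Set.image_comp ψ φ _))
        (OrientalArrow.ext (Set.image_comp ψ φ _))

/-! ## The 2-nerve and its left adjoint -/

/-- The cosimplicial 2-category `i₂ = O(Δ_•)` of 2-truncated orientals. -/
def cosimplicialOriental : SimplexCategory ⥤ TwoCat.{u} :=
  SimplexCategory.toPartOrd.{u} ⋙ orientalFunctor.{u}

/-- The 2-nerve `N₂ : 2-Cat ⥤ SSet`, with `N₂(C)_m = Hom(O(Δ_m), C)`. -/
def nerve₂ : TwoCat.{u} ⥤ SSet.{u} :=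
  yoneda ⋙ (Functor.whiskeringLeft _ _ _).obj cosimplicialOriental.{u}.op

/-- The nerve of posets. -/
def posetNerve : PartOrd.{u} ⥤ SSet.{u} :=
  forget₂ PartOrd.{u} Preord.{u} ⋙ preordToCat.{u} ⋙ nerveFunctor.{u, u}

namespace TwoCat

/-- The product of a family of 2-categories. -/
def pi {ι : Type v} (C : ι → TwoCat.{u}) : TwoCat.{max u v} where
  Ob := ∀ i, (C i).Ob
  Ar := ∀ i, (C i).Ar
  Ce := ∀ i, (C i).Ce
  src f i := (C i).src (f i)
  tgt f i := (C i).tgt (f i)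
  src₂ f i := (C i).src₂ (f i)
  tgt₂ f i := (C i).tgt₂ (f i)
  src_src₂ _ := funext fun _ => (C _).src_src₂ _
  tgt_src₂ _ := funext fun _ => (C _).tgt_src₂ _
  id₁ x i := (C i).id₁ (x i)
  src_id₁ _ := funext fun _ => (C _).src_id₁ _
  tgt_id₁ _ := funext fun _ => (C _).tgt_id₁ _
  comp₁ g f h i := (C i).comp₁ (g i) (f i) (congrFun h i)
  src_comp₁ _ _ _ := funext fun _ => (C _).src_comp₁ _ _ _
  tgt_comp₁ _ _ _ := funext fun _ => (C _).tgt_comp₁ _ _ _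
  id_comp₁ _ _ := funext fun _ => (C _).id_comp₁ _ _
  comp_id₁ _ _ := funext fun _ => (C _).comp_id₁ _ _
  assoc₁ _ _ _ _ _ _ _ := funext fun _ => (C _).assoc₁ _ _ _ _ _ _ _
  id₂ x i := (C i).id₂ (x i)
  src₂_id₂ _ := funext fun _ => (C _).src₂_id₂ _
  tgt₂_id₂ _ := funext fun _ => (C _).tgt₂_id₂ _
  vcomp g f h i := (C i).vcomp (g i) (f i) (congrFun h i)
  src₂_vcomp _ _ _ := funext fun _ => (C _).src₂_vcomp _ _ _
  tgt₂_vcomp _ _ _ := funext fun _ => (C _).tgt₂_vcomp _ _ _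
  id_vcomp _ _ := funext fun _ => (C _).id_vcomp _ _
  vcomp_id _ _ := funext fun _ => (C _).vcomp_id _ _
  vassoc _ _ _ _ _ _ _ := funext fun _ => (C _).vassoc _ _ _ _ _ _ _
  hcomp g f h i := (C i).hcomp (g i) (f i) (congrFun h i)
  src₂_hcomp _ _ _ := funext fun _ => (C _).src₂_hcomp _ _ _
  tgt₂_hcomp _ _ _ h := funext fun i => (C _).tgt₂_hcomp _ _ _ (congrFun h i)
  id_hcomp _ _ := funext fun _ => (C _).id_hcomp _ _
  hcomp_id _ _ := funext fun _ => (C _).hcomp_id _ _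
  hassoc _ _ _ _ _ _ _ := funext fun _ => (C _).hassoc _ _ _ _ _ _ _
  hcomp_id₂ _ _ h _ := funext fun i => (C _).hcomp_id₂ _ _ (congrFun h i) _
  interchange _ _ _ _ _ _ h h' _ _ := funext fun i =>
    (C _).interchange _ _ _ _ _ _ (congrFun h i) (congrFun h' i) _ _

/-- A sub-2-category. -/
structure Sub (P : TwoCat.{v}) where
  ob : Set P.Ob
  ar : Set P.Ar
  ce : Set P.Ce
  src_mem : ∀ {f}, f ∈ ar → P.src f ∈ ob
  tgt_mem : ∀ {f}, f ∈ ar → P.tgt f ∈ ob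
  src₂_mem : ∀ {α}, α ∈ ce → P.src₂ α ∈ ar
  tgt₂_mem : ∀ {α}, α ∈ ce → P.tgt₂ α ∈ ar
  id₁_mem : ∀ {x}, x ∈ ob → P.id₁ x ∈ ar
  comp₁_mem : ∀ {g f} h, g ∈ ar → f ∈ ar → P.comp₁ g f h ∈ ar
  id₂_mem : ∀ {f}, f ∈ ar → P.id₂ f ∈ ce
  vcomp_mem : ∀ {β α} h, β ∈ ce → α ∈ ce → P.vcomp β α h ∈ ce
  hcomp_mem : ∀ {β α} h, β ∈ ce → α ∈ ce → P.hcomp β α h ∈ ce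

/-- A sub-2-category, seen as a 2-category. -/
def Sub.toTwoCat {P : TwoCat.{v}} (S : Sub P) : TwoCat.{v} where
  Ob := S.ob
  Ar := S.ar
  Ce := S.ce
  src f := ⟨P.src f, S.src_mem f.2⟩
  tgt f := ⟨P.tgt f, S.tgt_mem f.2⟩
  src₂ f := ⟨P.src₂ f, S.src₂_mem f.2⟩
  tgt₂ f := ⟨P.tgt₂ f, S.tgt₂_mem f.2⟩
  src_src₂ _ := Subtype.ext (P.src_src₂ _)
  tgt_src₂ _ := Subtype.ext (P.tgt_src₂ _)
  id₁ x := ⟨P.id₁ x, S.id₁_mem x.2⟩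
  src_id₁ _ := Subtype.ext (P.src_id₁ _)
  tgt_id₁ _ := Subtype.ext (P.tgt_id₁ _)
  comp₁ g f h := ⟨P.comp₁ g f (congrArg Subtype.val h), S.comp₁_mem _ g.2 f.2⟩
  src_comp₁ _ _ _ := Subtype.ext (P.src_comp₁ _ _ _)
  tgt_comp₁ _ _ _ := Subtype.ext (P.tgt_comp₁ _ _ _)
  id_comp₁ _ _ := Subtype.ext (P.id_comp₁ _ _)
  comp_id₁ _ _ := Subtype.ext (P.comp_id₁ _ _)
  assoc₁ _ _ _ _ _ _ _ := Subtype.ext (P.assoc₁ _ _ _ _ _ _ _)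
  id₂ x := ⟨P.id₂ x, S.id₂_mem x.2⟩
  src₂_id₂ _ := Subtype.ext (P.src₂_id₂ _)
  tgt₂_id₂ _ := Subtype.ext (P.tgt₂_id₂ _)
  vcomp g f h := ⟨P.vcomp g f (congrArg Subtype.val h), S.vcomp_mem _ g.2 f.2⟩
  src₂_vcomp _ _ _ := Subtype.ext (P.src₂_vcomp _ _ _)
  tgt₂_vcomp _ _ _ := Subtype.ext (P.tgt₂_vcomp _ _ _)
  id_vcomp _ _ := Subtype.ext (P.id_vcomp _ _)
  vcomp_id _ _ := Subtype.ext (P.vcomp_id _ _)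
  vassoc _ _ _ _ _ _ _ := Subtype.ext (P.vassoc _ _ _ _ _ _ _)
  hcomp g f h := ⟨P.hcomp g f (congrArg Subtype.val h), S.hcomp_mem _ g.2 f.2⟩
  src₂_hcomp _ _ _ := Subtype.ext (P.src₂_hcomp _ _ _)
  tgt₂_hcomp _ _ _ h := Subtype.ext (P.tgt₂_hcomp _ _ _ (congrArg Subtype.val h))
  id_hcomp _ _ := Subtype.ext (P.id_hcomp _ _)
  hcomp_id _ _ := Subtype.ext (P.hcomp_id _ _)
  hassoc _ _ _ _ _ _ _ := Subtype.ext (P.hassoc _ _ _ _ _ _ _)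
  hcomp_id₂ _ _ h _ := Subtype.ext (P.hcomp_id₂ _ _ (congrArg Subtype.val h) _)
  interchange _ _ _ _ _ _ h h' _ _ := Subtype.ext
    (P.interchange _ _ _ _ _ _ (congrArg Subtype.val h) (congrArg Subtype.val h') _ _)

section Transport

variable (P : TwoCat.{v}) {O A K : Type u} (eo : P.Ob ≃ O) (ea : P.Ar ≃ A) (ec : P.Ce ≃ K)

/-- Transport of a structure of 2-category along bijections. -/
def transport : TwoCat.{u} where
  Ob := O
  Ar := A
  Ce := K
  src f := eo (P.src (ea.symm f))
  tgt f := eo (P.tgt (ea.symm f))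
  src₂ f := ea (P.src₂ (ec.symm f))
  tgt₂ f := ea (P.tgt₂ (ec.symm f))
  src_src₂ α := by simp [P.src_src₂]
  tgt_src₂ α := by simp [P.tgt_src₂]
  id₁ x := ea (P.id₁ (eo.symm x))
  src_id₁ x := by simp [P.src_id₁]
  tgt_id₁ x := by simp [P.tgt_id₁]
  comp₁ g f h := ea (P.comp₁ (ea.symm g) (ea.symm f) (eo.injective h))
  src_comp₁ g f h := by simp [P.src_comp₁]
  tgt_comp₁ g f h := by simp [P.tgt_comp₁]
  id_comp₁ f h := by simp [P.id_comp₁]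
  comp_id₁ f h := by simp [P.comp_id₁]
  assoc₁ h g f hg gf h₁ h₂ := by
    simp only [Equiv.symm_apply_apply]
    exact congrArg ea (P.assoc₁ _ _ _ _ _ _ _)
  id₂ x := ec (P.id₂ (ea.symm x))
  src₂_id₂ x := by simp [P.src₂_id₂]
  tgt₂_id₂ x := by simp [P.tgt₂_id₂]
  vcomp g f h := ec (P.vcomp (ec.symm g) (ec.symm f) (ea.injective h))
  src₂_vcomp g f h := by simp [P.src₂_vcomp]
  tgt₂_vcomp g f h := by simp [P.tgt₂_vcomp]
  id_vcomp f h := by simp [P.id_vcomp]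
  vcomp_id f h := by simp [P.vcomp_id]
  vassoc h g f hg gf h₁ h₂ := by
    simp only [Equiv.symm_apply_apply]
    exact congrArg ec (P.vassoc _ _ _ _ _ _ _)
  hcomp g f h := ec (P.hcomp (ec.symm g) (ec.symm f) (by simpa using h))
  src₂_hcomp g f h := by simp [P.src₂_hcomp]
  tgt₂_hcomp g f h h' := by
    simp only [Equiv.symm_apply_apply] at h' ⊢
    exact congrArg ea (P.tgt₂_hcomp _ _ _ (eo.injective h'))
  id_hcomp f h := by simp [P.id_hcomp]
  hcomp_id f h := by simp [P.hcomp_id]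
  hassoc h g f hg gf h₁ h₂ := by
    simp only [Equiv.symm_apply_apply]
    exact congrArg ec (P.hassoc _ _ _ _ _ _ _)
  hcomp_id₂ g f h h' := by
    simp only [Equiv.symm_apply_apply]
    exact congrArg ec (P.hcomp_id₂ _ _ (eo.injective h) _)
  interchange δ γ β α h₁ h₂ h₃ h₄ h₅ h₆ := by
    simp only [Equiv.symm_apply_apply]
    exact congrArg ec (P.interchange _ _ _ _ _ _ (ea.injective h₃) (ea.injective h₄) _ _)

/-- The canonical isomorphism onto a transported 2-category. -/
def toTransport : TwoFunctor P (P.transport eo ea ec) where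
  ob := eo
  ar := ea
  ce := ec
  src_ar _ := by simp [transport]
  tgt_ar _ := by simp [transport]
  src₂_ce _ := by simp [transport]
  tgt₂_ce _ := by simp [transport]
  ar_id₁ _ := by simp [transport]
  ar_comp₁ _ _ _ _ := by simp [transport]
  ce_id₂ _ := by simp [transport]
  ce_vcomp _ _ _ _ := by simp [transport]
  ce_hcomp _ _ _ _ := by simp [transport]

/-- The canonical isomorphism from a transported 2-category. -/
def ofTransport : TwoFunctor (P.transport eo ea ec) P where
  ob := eo.symm
  ar := ea.symm
  ce := ec.symm
  src_ar _ := by simp [transport]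
  tgt_ar _ := by simp [transport]
  src₂_ce _ := by simp [transport]
  tgt₂_ce _ := by simp [transport]
  ar_id₁ _ := by simp [transport]
  ar_comp₁ _ _ _ _ := by simp [transport]
  ce_id₂ _ := by simp [transport]
  ce_vcomp _ _ _ _ := by simp [transport]
  ce_hcomp _ _ _ _ := by simp [transport]

end Transport

end TwoCat

/-! The left adjoint of `N₂` sends `X` to the sub-2-category, generated by the simplices of `X`,
of the product of all `C` indexed by the morphisms `X ⟶ N₂(C)`. -/

namespace TwoRealization

open TwoCat

variable (X : SSet.{u})

/-- Pairs of a 2-category `C` and a morphism `X ⟶ N₂(C)`. -/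
abbrev Idx : Type (u + 1) := Σ C : TwoCat.{u}, X ⟶ nerve₂.obj C

/-- The product of all `C` indexed by the morphisms `X ⟶ N₂(C)`. -/
abbrev big : TwoCat.{u + 1} := TwoCat.pi.{u, u + 1} fun m : Idx X => m.1

variable {X}

/-- The 2-functor `O(Δ_m) ⟶ C` that a morphism `X ⟶ N₂(C)` attaches to an `m`-simplex of `X`. -/
def cell {C : TwoCat.{u}} (f : X ⟶ nerve₂.obj C) {Δ : SimplexCategoryᵒᵖ} (x : X.obj Δ) :
    cosimplicialOriental.{u}.obj Δ.unop ⟶ C :=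
  f.app Δ x

theorem cell_map {C : TwoCat.{u}} (f : X ⟶ nerve₂.obj C) {Δ Δ' : SimplexCategoryᵒᵖ} (φ : Δ ⟶ Δ')
    (x : X.obj Δ) : cell f (X.map φ x) = cosimplicialOriental.map φ.unop ≫ cell f x :=
  ConcreteCategory.congr_hom (f.naturality φ) x

theorem cell_comp {C D : TwoCat.{u}} (f : X ⟶ nerve₂.obj C) (k : C ⟶ D) {Δ : SimplexCategoryᵒᵖ}
    (x : X.obj Δ) : cell (f ≫ nerve₂.map k) x = cell f x ≫ k :=
  rfl

variable (X)

inductive GenOb : (big X).Ob → Prop where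
  | of (Δ : SimplexCategoryᵒᵖ) (x : X.obj Δ) (a : (cosimplicialOriental.{u}.obj Δ.unop).Ob) :
      GenOb fun m => (cell m.2 x).ob a

inductive GenAr : (big X).Ar → Prop where
  | of (Δ : SimplexCategoryᵒᵖ) (x : X.obj Δ) (a : (cosimplicialOriental.{u}.obj Δ.unop).Ar) :
      GenAr fun m => (cell m.2 x).ar a
  | id₁ {x} : GenOb X x → GenAr ((big X).id₁ x)
  | comp₁ {g f} (h) : GenAr g → GenAr f → GenAr ((big X).comp₁ g f h)

inductive GenCe : (big X).Ce → Prop where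
  | of (Δ : SimplexCategoryᵒᵖ) (x : X.obj Δ) (a : (cosimplicialOriental.{u}.obj Δ.unop).Ce) :
      GenCe fun m => (cell m.2 x).ce a
  | id₂ {f} : GenAr X f → GenCe ((big X).id₂ f)
  | vcomp {β α} (h) : GenCe β → GenCe α → GenCe ((big X).vcomp β α h)
  | hcomp {β α} (h) : GenCe β → GenCe α → GenCe ((big X).hcomp β α h)

/-- The sub-2-category generated by the simplices of `X`. -/
def sub : Sub (big X) where
  ob := {x | GenOb X x}
  ar := {x | GenAr X x}
  ce := {x | GenCe X x}
  src_mem {f} hf := by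
    induction hf with
    | of Δ x a =>
      have : (big X).src (fun m => (cell m.2 x).ar a) = fun m => (cell m.2 x).ob
          ((cosimplicialOriental.{u}.obj Δ.unop).src a) := funext fun m => (cell m.2 x).src_ar a
      rw [this]
      exact .of _ _ _
    | id₁ hx => rw [(big X).src_id₁]; exact hx
    | comp₁ h _ _ _ ih => rw [(big X).src_comp₁]; exact ih
  tgt_mem {f} hf := by
    induction hf with
    | of Δ x a =>
      have : (big X).tgt (fun m => (cell m.2 x).ar a) = fun m => (cell m.2 x).ob
          ((cosimplicialOriental.{u}.obj Δ.unop).tgt a) := funext fun m => (cell m.2 x).tgt_ar a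
      rw [this]
      exact .of _ _ _
    | id₁ hx => rw [(big X).tgt_id₁]; exact hx
    | comp₁ h _ _ ih _ => rw [(big X).tgt_comp₁]; exact ih
  src₂_mem {f} hf := by
    induction hf with
    | of Δ x a =>
      have : (big X).src₂ (fun m => (cell m.2 x).ce a) = fun m => (cell m.2 x).ar
          ((cosimplicialOriental.{u}.obj Δ.unop).src₂ a) := funext fun m => (cell m.2 x).src₂_ce a
      rw [this]
      exact .of _ _ _
    | id₂ hx => rw [(big X).src₂_id₂]; exact hx
    | vcomp h _ _ _ ih => rw [(big X).src₂_vcomp]; exact ih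
    | hcomp h _ _ ih ih' => rw [(big X).src₂_hcomp]; exact .comp₁ _ ih ih'
  tgt₂_mem {f} hf := by
    induction hf with
    | of Δ x a =>
      have : (big X).tgt₂ (fun m => (cell m.2 x).ce a) = fun m => (cell m.2 x).ar
          ((cosimplicialOriental.{u}.obj Δ.unop).tgt₂ a) := funext fun m => (cell m.2 x).tgt₂_ce a
      rw [this]
      exact .of _ _ _
    | id₂ hx => rw [(big X).tgt₂_id₂]; exact hx
    | vcomp h _ _ ih _ => rw [(big X).tgt₂_vcomp]; exact ih
    | hcomp h _ _ ih ih' =>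
      rw [(big X).tgt₂_hcomp _ _ _
        (by rw [← (big X).src_src₂, ← (big X).tgt_src₂]; exact h)]
      exact .comp₁ _ ih ih'
  id₁_mem h := .id₁ h
  comp₁_mem h hg hf := .comp₁ h hg hf
  id₂_mem h := .id₂ h
  vcomp_mem h hg hf := .vcomp h hg hf
  hcomp_mem h hg hf := .hcomp h hg hf

/-- Terms for 1-cells, used to bound the size of the generated sub-2-category. -/
inductive TermAr : Type u where
  | of (Δ : SimplexCategoryᵒᵖ) (x : X.obj Δ) (a : (cosimplicialOriental.{u}.obj Δ.unop).Ar)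
  | id₁ (Δ : SimplexCategoryᵒᵖ) (x : X.obj Δ) (a : (cosimplicialOriental.{u}.obj Δ.unop).Ob)
  | comp₁ (s t : TermAr)

/-- Terms for 2-cells. -/
inductive TermCe : Type u where
  | of (Δ : SimplexCategoryᵒᵖ) (x : X.obj Δ) (a : (cosimplicialOriental.{u}.obj Δ.unop).Ce)
  | id₂ (t : TermAr X)
  | vcomp (s t : TermCe)
  | hcomp (s t : TermCe)

open Classical in
/-- Evaluation of terms for 1-cells (with an arbitrary value on ill-formed terms). -/
noncomputable def TermAr.eval : TermAr X → (big X).Ar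
  | .of _ x a => fun m => (cell m.2 x).ar a
  | .id₁ _ x a => (big X).id₁ fun m => (cell m.2 x).ob a
  | .comp₁ s t => if h : (big X).src s.eval = (big X).tgt t.eval then
      (big X).comp₁ s.eval t.eval h else s.eval

open Classical in
/-- Evaluation of terms for 2-cells (with an arbitrary value on ill-formed terms). -/
noncomputable def TermCe.eval : TermCe X → (big X).Ce
  | .of _ x a => fun m => (cell m.2 x).ce a
  | .id₂ t => (big X).id₂ (TermAr.eval X t)
  | .vcomp s t => if h : (big X).src₂ s.eval = (big X).tgt₂ t.eval then
      (big X).vcomp s.eval t.eval h else s.eval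
  | .hcomp s t => if h : (big X).src ((big X).src₂ s.eval) = (big X).tgt ((big X).src₂ t.eval) then
      (big X).hcomp s.eval t.eval h else s.eval

theorem exists_termAr {f : (big X).Ar} (hf : GenAr X f) : ∃ t, TermAr.eval X t = f := by
  induction hf with
  | of Δ x a => exact ⟨.of Δ x a, rfl⟩
  | id₁ hx =>
    obtain ⟨Δ, x, a⟩ := hx
    exact ⟨.id₁ Δ x a, rfl⟩
  | comp₁ h _ _ ih ih' =>
    obtain ⟨s, rfl⟩ := ih
    obtain ⟨t, rfl⟩ := ih'
    exact ⟨.comp₁ s t, by rw [TermAr.eval, dif_pos h]⟩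

theorem exists_termCe {f : (big X).Ce} (hf : GenCe X f) : ∃ t, TermCe.eval X t = f := by
  induction hf with
  | of Δ x a => exact ⟨.of Δ x a, rfl⟩
  | id₂ hx =>
    obtain ⟨t, rfl⟩ := exists_termAr X hx
    exact ⟨.id₂ t, rfl⟩
  | vcomp h _ _ ih ih' =>
    obtain ⟨s, rfl⟩ := ih
    obtain ⟨t, rfl⟩ := ih'
    exact ⟨.vcomp s t, by rw [TermCe.eval, dif_pos h]⟩
  | hcomp h _ _ ih ih' =>
    obtain ⟨s, rfl⟩ := ih
    obtain ⟨t, rfl⟩ := ih'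
    exact ⟨.hcomp s t, by rw [TermCe.eval, dif_pos h]⟩

/-- Terms for objects. -/
inductive TermOb : Type u
  | of (Δ : SimplexCategoryᵒᵖ) (x : X.obj Δ) (a : (cosimplicialOriental.{u}.obj Δ.unop).Ob)

/-- Evaluation of terms for objects. -/
def TermOb.eval : TermOb X → (big X).Ob
  | .of _ x a => fun m => (cell m.2 x).ob a

instance : Small.{u} (sub X).ob := by
  have : (sub X).ob ⊆ Set.range (TermOb.eval X) := by
    rintro _ ⟨Δ, x, a⟩
    exact ⟨.of Δ x a, rfl⟩
  exact small_subset this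

instance : Small.{u} (sub X).ar := by
  have : (sub X).ar ⊆ Set.range (TermAr.eval X) := fun f hf => exists_termAr X hf
  exact small_subset this

instance : Small.{u} (sub X).ce := by
  have : (sub X).ce ⊆ Set.range (TermCe.eval X) := fun f hf => exists_termCe X hf
  exact small_subset this

/-- The generated sub-2-category, before replacing it by a small one. -/
def gen : TwoCat.{u + 1} := (sub X).toTwoCat

/-- The 2-category `c₂(X)`. -/
noncomputable def obj : TwoCat.{u} :=
  (gen X).transport (equivShrink.{u} (sub X).ob) (equivShrink.{u} (sub X).ar)
    (equivShrink.{u} (sub X).ce)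

/-- The isomorphism from the generated sub-2-category to `c₂(X)`. -/
noncomputable def toObj : TwoFunctor (gen X) (obj X) := toTransport _ _ _ _

/-- The isomorphism from `c₂(X)` to the generated sub-2-category. -/
noncomputable def ofObj : TwoFunctor (obj X) (gen X) := ofTransport _ _ _ _

theorem toObj_ofObj : (toObj X).comp (ofObj X) = TwoFunctor.id _ :=
  TwoFunctor.ext (funext fun _ => Equiv.symm_apply_apply _ _)
    (funext fun _ => Equiv.symm_apply_apply _ _) (funext fun _ => Equiv.symm_apply_apply _ _)

theorem ofObj_toObj : (ofObj X).comp (toObj X) = TwoFunctor.id _ :=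
  TwoFunctor.ext (funext fun _ => Equiv.apply_symm_apply _ _)
    (funext fun _ => Equiv.apply_symm_apply _ _) (funext fun _ => Equiv.apply_symm_apply _ _)

variable {X}

/-- The projection of the generated sub-2-category to `C` attached to a morphism `X ⟶ N₂(C)`. -/
def descGen {C : TwoCat.{u}} (f : X ⟶ nerve₂.obj C) : TwoFunctor (gen X) C where
  ob z := z.1 ⟨C, f⟩
  ar z := z.1 ⟨C, f⟩
  ce z := z.1 ⟨C, f⟩
  src_ar _ := rfl
  tgt_ar _ := rfl
  src₂_ce _ := rfl
  tgt₂_ce _ := rfl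
  ar_id₁ _ := rfl
  ar_comp₁ _ _ _ _ := rfl
  ce_id₂ _ := rfl
  ce_vcomp _ _ _ _ := rfl
  ce_hcomp _ _ _ _ := rfl

/-- The 2-functor from `O(Δ_m)` to the generated sub-2-category attached to an `m`-simplex. -/
def ofSimplexGen {Δ : SimplexCategoryᵒᵖ} (x : X.obj Δ) :
    TwoFunctor (cosimplicialOriental.{u}.obj Δ.unop) (gen X) where
  ob a := ⟨fun m => (cell m.2 x).ob a, .of Δ x a⟩
  ar a := ⟨fun m => (cell m.2 x).ar a, .of Δ x a⟩
  ce a := ⟨fun m => (cell m.2 x).ce a, .of Δ x a⟩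
  src_ar a := Subtype.ext (funext fun m => (cell m.2 x).src_ar a)
  tgt_ar a := Subtype.ext (funext fun m => (cell m.2 x).tgt_ar a)
  src₂_ce a := Subtype.ext (funext fun m => (cell m.2 x).src₂_ce a)
  tgt₂_ce a := Subtype.ext (funext fun m => (cell m.2 x).tgt₂_ce a)
  ar_id₁ a := Subtype.ext (funext fun m => (cell m.2 x).ar_id₁ a)
  ar_comp₁ g f h _ := Subtype.ext (funext fun m => (cell m.2 x).ar_comp₁ g f h _)
  ce_id₂ a := Subtype.ext (funext fun m => (cell m.2 x).ce_id₂ a)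
  ce_vcomp g f h _ := Subtype.ext (funext fun m => (cell m.2 x).ce_vcomp g f h _)
  ce_hcomp g f h _ := Subtype.ext (funext fun m => (cell m.2 x).ce_hcomp g f h _)

theorem ofSimplexGen_map {Δ Δ' : SimplexCategoryᵒᵖ} (φ : Δ ⟶ Δ') (x : X.obj Δ) :
    ofSimplexGen (X.map φ x) =
      TwoFunctor.comp (cosimplicialOriental.{u}.map φ.unop) (ofSimplexGen x) := by
  refine TwoFunctor.ext ?_ ?_ ?_
  · exact funext fun a => Subtype.ext (funext fun m =>
      congrFun (congrArg TwoFunctor.ob (cell_map m.2 φ x)) a)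
  · exact funext fun a => Subtype.ext (funext fun m =>
      congrFun (congrArg TwoFunctor.ar (cell_map m.2 φ x)) a)
  · exact funext fun a => Subtype.ext (funext fun m =>
      congrFun (congrArg TwoFunctor.ce (cell_map m.2 φ x)) a)

/-- The 2-functor `c₂(X) ⟶ C` attached to a morphism `X ⟶ N₂(C)`. -/
noncomputable def desc {C : TwoCat.{u}} (f : X ⟶ nerve₂.obj C) : obj X ⟶ C :=
  (ofObj X).comp (descGen f)

/-- The 2-functor `O(Δ_m) ⟶ c₂(X)` attached to an `m`-simplex of `X`. -/
noncomputable def ofSimplex {Δ : SimplexCategoryᵒᵖ} (x : X.obj Δ) :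
    cosimplicialOriental.{u}.obj Δ.unop ⟶ obj X :=
  (ofSimplexGen x).comp (toObj X)

variable (X)

/-- The unit `X ⟶ N₂(c₂(X))`. -/
noncomputable def unit : X ⟶ nerve₂.obj (obj X) where
  app Δ := ↾fun x => ofSimplex x
  naturality Δ Δ' φ := by
    ext x
    exact congrArg (fun F => TwoFunctor.comp F (toObj X)) (ofSimplexGen_map φ x)

variable {X}

theorem unit_desc {C : TwoCat.{u}} (f : X ⟶ nerve₂.obj C) : unit X ≫ nerve₂.map (desc f) = f := by
  ext Δ x
  change (ofSimplexGen x).comp (((toObj X).comp (ofObj X)).comp (descGen f)) = cell f x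
  rw [toObj_ofObj]
  rfl

theorem genHom_ext {C : TwoCat.{u}} {k l : TwoFunctor (gen X) C}
    (key : ∀ {Δ : SimplexCategoryᵒᵖ} (x : X.obj Δ),
      (ofSimplexGen x).comp k = (ofSimplexGen x).comp l) : k = l := by
  have hob : ∀ z (hz : GenOb X z), k.ob ⟨z, hz⟩ = l.ob ⟨z, hz⟩ := by
    rintro _ ⟨Δ, x, a⟩
    exact congrFun (congrArg TwoFunctor.ob (key x)) a
  have har : ∀ z (hz : GenAr X z), k.ar ⟨z, hz⟩ = l.ar ⟨z, hz⟩ := by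
    intro z hz
    induction hz with
    | of Δ x a => exact congrFun (congrArg TwoFunctor.ar (key x)) a
    | @id₁ x hx =>
      exact (k.ar_id₁ ⟨x, hx⟩).trans ((congrArg C.id₁ (hob x hx)).trans (l.ar_id₁ ⟨x, hx⟩).symm)
    | @comp₁ g f h hg hf ih ih' =>
      have h' : (gen X).src ⟨g, hg⟩ = (gen X).tgt ⟨f, hf⟩ := Subtype.ext h
      refine (k.ar_comp₁ ⟨g, hg⟩ ⟨f, hf⟩ h' (k.composable₁ h')).trans
        (Eq.trans ?_ (l.ar_comp₁ ⟨g, hg⟩ ⟨f, hf⟩ h' (l.composable₁ h')).symm)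
      congr 1
  have hce : ∀ z (hz : GenCe X z), k.ce ⟨z, hz⟩ = l.ce ⟨z, hz⟩ := by
    intro z hz
    induction hz with
    | of Δ x a => exact congrFun (congrArg TwoFunctor.ce (key x)) a
    | @id₂ x hx =>
      exact (k.ce_id₂ ⟨x, hx⟩).trans ((congrArg C.id₂ (har x hx)).trans (l.ce_id₂ ⟨x, hx⟩).symm)
    | @vcomp g f h hg hf ih ih' =>
      have h' : (gen X).src₂ ⟨g, hg⟩ = (gen X).tgt₂ ⟨f, hf⟩ := Subtype.ext h
      refine (k.ce_vcomp ⟨g, hg⟩ ⟨f, hf⟩ h' (k.composable₂ h')).trans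
        (Eq.trans ?_ (l.ce_vcomp ⟨g, hg⟩ ⟨f, hf⟩ h' (l.composable₂ h')).symm)
      congr 1
    | @hcomp g f h hg hf ih ih' =>
      have h' : (gen X).src ((gen X).src₂ ⟨g, hg⟩) = (gen X).tgt ((gen X).src₂ ⟨f, hf⟩) :=
        Subtype.ext h
      refine (k.ce_hcomp ⟨g, hg⟩ ⟨f, hf⟩ h' (k.composableH h')).trans
        (Eq.trans ?_ (l.ce_hcomp ⟨g, hg⟩ ⟨f, hf⟩ h' (l.composableH h')).symm)
      congr 1
  exact TwoFunctor.ext (funext fun z => hob z.1 z.2) (funext fun z => har z.1 z.2)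
    (funext fun z => hce z.1 z.2)

theorem hom_ext {C : TwoCat.{u}} {k l : obj X ⟶ C}
    (h : unit X ≫ nerve₂.map k = unit X ≫ nerve₂.map l) : k = l := by
  have e : (toObj X).comp k = (toObj X).comp l :=
    genHom_ext fun {Δ} x => ConcreteCategory.congr_hom (NatTrans.congr_app h Δ) x
  have e' := congrArg (fun F => (ofObj X).comp F) e
  change ((ofObj X).comp (toObj X)).comp k = ((ofObj X).comp (toObj X)).comp l at e'
  rw [ofObj_toObj] at e'
  exact e'

/-- The universal property of `c₂(X)`. -/
noncomputable def homEquiv (X : SSet.{u}) (C : TwoCat.{u}) :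
    (obj X ⟶ C) ≃ (X ⟶ nerve₂.obj C) where
  toFun k := unit X ≫ nerve₂.map k
  invFun f := desc f
  left_inv _ := hom_ext (unit_desc _)
  right_inv := unit_desc

theorem homEquiv_naturality (X : SSet.{u}) (C D : TwoCat.{u}) (g : C ⟶ D) (h : obj X ⟶ C) :
    homEquiv X D (h ≫ g) = homEquiv X C h ≫ nerve₂.map g := by
  simp [homEquiv]

end TwoRealization

/-- The functor `c₂ : SSet ⥤ 2-Cat`. -/
noncomputable def c₂ : SSet.{u} ⥤ TwoCat.{u} :=
  Adjunction.leftAdjointOfEquiv TwoRealization.homEquiv TwoRealization.homEquiv_naturality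

/-- `c₂` is left adjoint to `N₂`. -/
noncomputable def c₂Adj : c₂.{u} ⊣ nerve₂.{u} :=
  Adjunction.adjunctionOfEquivLeft TwoRealization.homEquiv TwoRealization.homEquiv_naturality

/-- The functor `c₂N` from posets to 2-categories. -/
noncomputable def c₂N : PartOrd.{u} ⥤ TwoCat.{u} := posetNerve ⋙ c₂

/-- A simplex of the nerve of a poset, seen as a morphism of posets. -/
def simplexToHom {E : PartOrd.{u}} {Δ : SimplexCategory} (σ : ComposableArrows E Δ.len) :
    SimplexCategory.toPartOrd.{u}.obj Δ ⟶ E :=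
  PartOrd.ofHom (X := ULift.{u} (Fin (Δ.len + 1))) (Y := E)
    ⟨fun k => σ.obj k.down, fun _ _ h => leOfHom (σ.map (homOfLE h))⟩

/-- The morphism `N(E) ⟶ N₂(O(E))` sending a simplex `σ : Δ_m ⟶ E` to `O(σ)`. -/
def posetNerveToNerve₂ (E : PartOrd.{u}) :
    posetNerve.obj E ⟶ nerve₂.obj (orientalFunctor.obj E) where
  app Δ := ↾fun (σ : ComposableArrows E Δ.unop.len) =>
    (orientalFunctor.map (simplexToHom σ) : cosimplicialOriental.{u}.obj Δ.unop ⟶ _)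
  naturality Δ Δ' φ := by
    ext σ
    exact (orientalFunctor.map_comp (SimplexCategory.toPartOrd.map φ.unop)
      (simplexToHom (E := E) σ))

/-- The canonical comparison 2-functor `c₂N(E) ⟶ O(E)`, corresponding by adjunction to
`N(E) ⟶ N₂(O(E))`. -/
noncomputable def comparison (E : PartOrd.{u}) : c₂N.obj E ⟶ orientalFunctor.obj E :=
  (c₂Adj.homEquiv _ _).symm (posetNerveToNerve₂ E)

/-! ## Weak equivalences -/

/-- The set `[X, K]` of simplicial homotopy classes of morphisms `X ⟶ K`. -/
def HomotopyClasses (X K : SSet.{u}) : Type u :=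
  Quot fun f g : X ⟶ K => Nonempty (SSet.Homotopy f g)

/-- The map `[Y, K] → [X, K]` induced by `p : X ⟶ Y`. -/
def HomotopyClasses.precomp {X Y : SSet.{u}} (p : X ⟶ Y) (K : SSet.{u}) :
    HomotopyClasses Y K → HomotopyClasses X K :=
  Quot.map (fun f => p ≫ f) (by
    rintro f g ⟨h⟩
    exact ⟨SSet.RelativeMorphism.Homotopy.precomp h (SSet.RelativeMorphism.botEquiv.symm p)
      (Subsingleton.elim _ _)⟩)

/-- A weak equivalence of simplicial sets: a morphism `p : X ⟶ Y` inducing a bijection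
`[Y, K] → [X, K]` for every Kan complex `K`. -/
def IsSimplicialWeakEquivalence {X Y : SSet.{u}} (p : X ⟶ Y) : Prop :=
  ∀ (K : SSet.{u}) [SSet.KanComplex K], Function.Bijective (HomotopyClasses.precomp p K)

/-- A Thomason weak equivalence: a 2-functor whose 2-nerve is a weak equivalence. -/
def IsThomasonWeakEquivalence {C D : TwoCat.{u}} (F : C ⟶ D) : Prop :=
  IsSimplicialWeakEquivalence (nerve₂.map F)

/-! ## The explicit homotopy -/

open Classical in
/-- For a chain `S` of `E`, the subset `H(0 → 1, S)` of `E`: it is `{ir(min S), max S}` if `S` does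
not meet `E'`, and `(S ∩ E') ∪ {max S}` otherwise. -/
noncomputable def homotopyChain {E' E : PartOrd.{u}} (i : E' ⟶ E) (r : E ⟶ E')
    (S : OrientalArrow E) : Set E :=
  if S.S ∩ Set.range i = ∅ then {i (r S.min), S.max} else (S.S ∩ Set.range i) ∪ {S.max}

/-! A strict 2-functor out of `O(E)` is the same thing as a normalised oplax 2-functor out of the
poset `E`, called here an `OplaxDiagram`. The chains `{x, y}` give its 1-cells and the inclusions
`{x, z} ⊆ {x, y, z}` give its constraints. Conversely, an inclusion of chains is obtained by
inserting points one at a time, and the cocycle condition says exactly that the order of insertion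
does not matter (`listCe_trans`, `toFunctor`, `oriental_ext`). A morphism `N(E) ⟶ N₂(D)` is again
the same data, read on simplices of dimension at most 3 (`PosetNerve.diagram`). So `O(E)` has the
universal property of `c₂N(E)`, and the comparison 2-functor is an isomorphism.

For the first part, `O(E)` has at most one 2-cell between parallel 1-cells. An oplax 2-functor into
it therefore amounts to its values on objects and 1-cells, provided that certain inclusions of
chains hold (`ofThin`). Both cases of the formula for `H(0 → 1, S)` give the chain `{ir(min S), max
S} ∪ (S ∩ E')`. The required inclusions follow from `ir ≤ 1` and from `E'` being a lower set fixed
by `ir`.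

For the second part, let `B` be the pushout of `F : O(E') ⟶ A` along `O(i)`, with `j : A ⟶ B` and `b
: O(E) ⟶ B`. The map `r` induces a retraction `ρ` of `j`, and it remains to find a simplicial
homotopy from `N₂(jρ)` to the identity. The 1-cells of an abstract pushout are not explicit, so the
homotopy is not built on `B`. It is built on a 2-category `glue i X`, where `X` is the diagram on
`E'` given by `F`. The objects of `glue i X` are those of `A` and those of `E`, and its 1-cells from
`A` to `E` are formal composites of a 1-cell of `A` and a chain of `E`. Evaluation is a 2-functor `q
: glue i X ⟶ B` (`GlueCompat.desc`). The universal property of `B` gives `s` in the other direction,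
with `q` after `s` equal to the identity: an element of `E` goes to the `A` side if it lies in `E'`
and to the `E` side otherwise (`sectionDiagram`, `section_desc`).

On the gluing there is an oplax cylinder from `jρq` to `q`, which replaces a chain by its end
points, the first one being moved to `E'` by `ir`. Its constraints are inclusions of chains
(`GlueCompat.cylinder`). A cylinder acts on an `m`-simplex together with a map `Δ_m → Δ₁`, because
the pair yields an `OplaxDiagram` on `Δ_m`, and so it gives a simplicial homotopy
(`OplaxCylinder.homotopy`). Restricting this homotopy along `N₂(s)` shows that `N₂(ρ)` is a homotopy
inverse of `N₂(j)`. Finally, `c₂N(i)` is its own pushout along an identity. -/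

namespace TwoCat
-- Compositions made total, so that pastings can be rewritten freely
section Total
variable (D : TwoCat.{u})

open Classical in
/-- Total version of the composition of 1-cells. -/
noncomputable def cmp (g f : D.Ar) : D.Ar := if h : D.src g = D.tgt f then D.comp₁ g f h else g

open Classical in
/-- Total version of the vertical composition. -/
noncomputable def vc (β α : D.Ce) : D.Ce := if h : D.src₂ β = D.tgt₂ α then D.vcomp β α h else β

open Classical in
/-- Total version of the horizontal composition. -/
noncomputable def hc (β α : D.Ce) : D.Ce :=
  if h : D.src (D.src₂ β) = D.tgt (D.src₂ α) then D.hcomp β α h else β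

variable {D}

theorem cmp_eq {g f : D.Ar} (h : D.src g = D.tgt f) : D.cmp g f = D.comp₁ g f h := dif_pos h
theorem vc_eq {β α : D.Ce} (h : D.src₂ β = D.tgt₂ α) : D.vc β α = D.vcomp β α h := dif_pos h
theorem hc_eq {β α : D.Ce} (h : D.src (D.src₂ β) = D.tgt (D.src₂ α)) :
    D.hc β α = D.hcomp β α h := dif_pos h

theorem src_cmp {g f : D.Ar} (h : D.src g = D.tgt f) : D.src (D.cmp g f) = D.src f := by
  rw [cmp_eq h, D.src_comp₁]
theorem tgt_cmp {g f : D.Ar} (h : D.src g = D.tgt f) : D.tgt (D.cmp g f) = D.tgt g := by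
  rw [cmp_eq h, D.tgt_comp₁]
theorem id_cmp {f : D.Ar} {x : D.Ob} (h : D.tgt f = x) : D.cmp (D.id₁ x) f = f := by
  subst h; rw [cmp_eq (D.src_id₁ _), D.id_comp₁]
theorem cmp_id {f : D.Ar} {x : D.Ob} (h : D.src f = x) : D.cmp f (D.id₁ x) = f := by
  subst h; rw [cmp_eq (D.tgt_id₁ _).symm, D.comp_id₁]
theorem cmp_assoc {h g f : D.Ar} (hg : D.src h = D.tgt g) (gf : D.src g = D.tgt f) :
    D.cmp (D.cmp h g) f = D.cmp h (D.cmp g f) := by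
  rw [cmp_eq (g := D.cmp h g) (by rw [src_cmp hg, gf]), cmp_eq (g := h) (f := D.cmp g f)
    (by rw [tgt_cmp gf, hg])]
  simp only [cmp_eq hg, cmp_eq gf]
  exact D.assoc₁ _ _ _ _ _ _ _
theorem src₂_vc {β α : D.Ce} (h : D.src₂ β = D.tgt₂ α) : D.src₂ (D.vc β α) = D.src₂ α := by
  rw [vc_eq h, D.src₂_vcomp]
theorem tgt₂_vc {β α : D.Ce} (h : D.src₂ β = D.tgt₂ α) : D.tgt₂ (D.vc β α) = D.tgt₂ β := by
  rw [vc_eq h, D.tgt₂_vcomp]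
theorem id_vc {α : D.Ce} {f : D.Ar} (h : D.tgt₂ α = f) : D.vc (D.id₂ f) α = α := by
  subst h; rw [vc_eq (D.src₂_id₂ _), D.id_vcomp]
theorem vc_id {α : D.Ce} {f : D.Ar} (h : D.src₂ α = f) : D.vc α (D.id₂ f) = α := by
  subst h; rw [vc_eq (D.tgt₂_id₂ _).symm, D.vcomp_id]
theorem vc_assoc {γ β α : D.Ce} (h : D.src₂ γ = D.tgt₂ β) (h' : D.src₂ β = D.tgt₂ α) :
    D.vc (D.vc γ β) α = D.vc γ (D.vc β α) := by
  rw [vc_eq (β := D.vc γ β) (by rw [src₂_vc h, h']), vc_eq (β := γ) (α := D.vc β α)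
    (by rw [tgt₂_vc h', h])]
  simp only [vc_eq h, vc_eq h']
  exact D.vassoc _ _ _ _ _ _ _
theorem src₂_hc {β α : D.Ce} (h : D.src (D.src₂ β) = D.tgt (D.src₂ α)) :
    D.src₂ (D.hc β α) = D.cmp (D.src₂ β) (D.src₂ α) := by
  rw [hc_eq h, D.src₂_hcomp, cmp_eq h]
theorem tgt₂_hc {β α : D.Ce} (h : D.src (D.src₂ β) = D.tgt (D.src₂ α)) :
    D.tgt₂ (D.hc β α) = D.cmp (D.tgt₂ β) (D.tgt₂ α) := by
  have h' : D.src (D.tgt₂ β) = D.tgt (D.tgt₂ α) := by rw [← D.src_src₂, h, D.tgt_src₂]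
  rw [hc_eq h, D.tgt₂_hcomp _ _ _ h', cmp_eq h']
theorem id_hc {α : D.Ce} {x : D.Ob} (h : D.tgt (D.src₂ α) = x) :
    D.hc (D.id₂ (D.id₁ x)) α = α := by
  subst h; rw [hc_eq (by rw [D.src₂_id₂, D.src_id₁]), D.id_hcomp]
theorem hc_id {α : D.Ce} {x : D.Ob} (h : D.src (D.src₂ α) = x) :
    D.hc α (D.id₂ (D.id₁ x)) = α := by
  subst h; rw [hc_eq (by rw [D.src₂_id₂, D.tgt_id₁]), D.hcomp_id]
theorem hc_id₂ {g f : D.Ar} (h : D.src g = D.tgt f) :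
    D.hc (D.id₂ g) (D.id₂ f) = D.id₂ (D.cmp g f) := by
  rw [hc_eq (by simpa only [D.src₂_id₂] using h), D.hcomp_id₂ _ _ h, cmp_eq h]
theorem hc_assoc {γ β α : D.Ce} (h : D.src (D.src₂ γ) = D.tgt (D.src₂ β))
    (h' : D.src (D.src₂ β) = D.tgt (D.src₂ α)) :
    D.hc (D.hc γ β) α = D.hc γ (D.hc β α) := by
  rw [hc_eq (β := D.hc γ β) (by rw [src₂_hc h, src_cmp h, h']), hc_eq (β := γ) (α := D.hc β α)
    (by rw [src₂_hc h', tgt_cmp h', h])]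
  simp only [hc_eq h, hc_eq h']
  exact D.hassoc _ _ _ _ _ _ _
theorem vc_hc {δ γ β α : D.Ce} (h : D.src (D.src₂ δ) = D.tgt (D.src₂ γ))
    (hδβ : D.src₂ δ = D.tgt₂ β) (hγα : D.src₂ γ = D.tgt₂ α) :
    D.vc (D.hc δ γ) (D.hc β α) = D.hc (D.vc δ β) (D.vc γ α) := by
  have h' : D.src (D.src₂ β) = D.tgt (D.src₂ α) := by
    rw [D.src_src₂, ← hδβ, h, hγα, D.tgt_src₂]
  have h₁ : D.src₂ (D.hcomp δ γ h) = D.tgt₂ (D.hcomp β α h') := by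
    rw [D.src₂_hcomp, D.tgt₂_hcomp _ _ _ (by rw [← hδβ, ← hγα, h])]
    simp only [hδβ, hγα]
  have h₂ : D.src (D.src₂ (D.vcomp δ β hδβ)) = D.tgt (D.src₂ (D.vcomp γ α hγα)) := by
    rw [D.src₂_vcomp, D.src₂_vcomp, h']
  rw [hc_eq h, hc_eq h', vc_eq hδβ, vc_eq hγα, vc_eq h₁, hc_eq h₂, D.interchange]

theorem hc_vc_id₂ {β α : D.Ce} {f : D.Ar} (h : D.src₂ β = D.tgt₂ α)
    (h' : D.src (D.src₂ α) = D.tgt f) :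
    D.hc (D.vc β α) (D.id₂ f) = D.vc (D.hc β (D.id₂ f)) (D.hc α (D.id₂ f)) := by
  rw [vc_hc (by rw [h, ← D.src_src₂, h', D.src₂_id₂]) h (by rw [D.src₂_id₂, D.tgt₂_id₂]),
    vc_id (D.src₂_id₂ f)]

theorem hc_id₂_vc {β α : D.Ce} {g : D.Ar} (h : D.src₂ β = D.tgt₂ α)
    (h' : D.src g = D.tgt (D.src₂ α)) :
    D.hc (D.id₂ g) (D.vc β α) = D.vc (D.hc (D.id₂ g) β) (D.hc (D.id₂ g) α) := by
  rw [vc_hc (by rw [h, ← D.tgt_src₂, ← h', D.src₂_id₂]) (by rw [D.src₂_id₂, D.tgt₂_id₂]) h,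
    vc_id (D.src₂_id₂ g)]

/-- Interchange, with `γ` written as `γ` after the identity of its source: all of `γ` goes with `β`,
and `α` is only whiskered. -/
theorem hc_vc_right {γ β α : D.Ce} {f : D.Ar} (hf : D.src₂ γ = f) (h : D.src₂ β = D.tgt₂ α)
    (h' : D.src f = D.tgt (D.src₂ α)) :
    D.hc γ (D.vc β α) = D.vc (D.hc γ β) (D.hc (D.id₂ f) α) := by
  rw [vc_hc (by rw [hf, h, ← D.tgt_src₂, ← h']) (by rw [hf, D.tgt₂_id₂]) h, vc_id hf]

theorem hc_vc_left {γ β α : D.Ce} {f : D.Ar} (hf : D.src₂ γ = f) (h : D.src₂ β = D.tgt₂ α)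
    (h' : D.src (D.src₂ α) = D.tgt f) :
    D.hc (D.vc β α) γ = D.vc (D.hc β γ) (D.hc α (D.id₂ f)) := by
  rw [vc_hc (by rw [hf, h, ← D.src_src₂, ← h']) h (by rw [hf, D.tgt₂_id₂]), vc_id hf]

end Total

attribute [grind =] src_id₁ tgt_id₁ src₂_id₂ tgt₂_id₂ src_cmp tgt_cmp src₂_vc tgt₂_vc src₂_hc
  tgt₂_hc id_cmp cmp_id cmp_assoc id_vc vc_id vc_assoc id_hc hc_id hc_id₂ hc_assoc vc_hc
attribute [grind _=_] src_src₂ tgt_src₂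

end TwoCat

namespace TwoFunctor

variable {C : TwoCat.{u}} {D : TwoCat.{v}} (F : TwoFunctor C D)

theorem ar_cmp {g f : C.Ar} (h : C.src g = C.tgt f) :
    F.ar (C.cmp g f) = D.cmp (F.ar g) (F.ar f) := by
  rw [TwoCat.cmp_eq h, TwoCat.cmp_eq (F.composable₁ h), F.ar_comp₁]

theorem ce_vc {β α : C.Ce} (h : C.src₂ β = C.tgt₂ α) :
    F.ce (C.vc β α) = D.vc (F.ce β) (F.ce α) := by
  rw [TwoCat.vc_eq h, TwoCat.vc_eq (F.composable₂ h), F.ce_vcomp]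

theorem ce_hc {β α : C.Ce} (h : C.src (C.src₂ β) = C.tgt (C.src₂ α)) :
    F.ce (C.hc β α) = D.hc (F.ce β) (F.ce α) := by
  rw [TwoCat.hc_eq h, TwoCat.hc_eq (F.composableH h), F.ce_hcomp]

attribute [grind =] src_ar tgt_ar src₂_ce tgt₂_ce ar_id₁ ce_id₂ ar_cmp ce_vc ce_hc

/-- Construction of a strict 2-functor from laws stated with the total compositions. -/
def ofTotal (ob : C.Ob → D.Ob) (ar : C.Ar → D.Ar) (ce : C.Ce → D.Ce)
    (src_ar : ∀ f, D.src (ar f) = ob (C.src f)) (tgt_ar : ∀ f, D.tgt (ar f) = ob (C.tgt f))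
    (src₂_ce : ∀ α, D.src₂ (ce α) = ar (C.src₂ α)) (tgt₂_ce : ∀ α, D.tgt₂ (ce α) = ar (C.tgt₂ α))
    (ar_id₁ : ∀ x, ar (C.id₁ x) = D.id₁ (ob x))
    (ar_cmp : ∀ g f, C.src g = C.tgt f → ar (C.cmp g f) = D.cmp (ar g) (ar f))
    (ce_id₂ : ∀ f, ce (C.id₂ f) = D.id₂ (ar f))
    (ce_vc : ∀ β α, C.src₂ β = C.tgt₂ α → ce (C.vc β α) = D.vc (ce β) (ce α))
    (ce_hc : ∀ β α, C.src (C.src₂ β) = C.tgt (C.src₂ α) →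
      ce (C.hc β α) = D.hc (ce β) (ce α)) : TwoFunctor C D where
  ob := ob
  ar := ar
  ce := ce
  src_ar := src_ar
  tgt_ar := tgt_ar
  src₂_ce := src₂_ce
  tgt₂_ce := tgt₂_ce
  ar_id₁ := ar_id₁
  ar_comp₁ g f h h' := by rw [← TwoCat.cmp_eq h, ← TwoCat.cmp_eq h', ar_cmp g f h]
  ce_id₂ := ce_id₂
  ce_vcomp β α h h' := by rw [← TwoCat.vc_eq h, ← TwoCat.vc_eq h', ce_vc β α h]
  ce_hcomp β α h h' := by rw [← TwoCat.hc_eq h, ← TwoCat.hc_eq h', ce_hc β α h]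

end TwoFunctor

/-! ## Generators of the 2-category `O(E)` -/

namespace OrientalArrow

variable {E : Type u} [PartialOrder E]

/-- The chain `{x, y}`, for `x ≤ y`. -/
@[simps]
def pair (x y : E) (h : x ≤ y) : OrientalArrow E where
  S := {x, y}
  finite := by simp
  chain := by
    rintro a (rfl | rfl) b (rfl | rfl) hab
    · exact absurd rfl hab
    · exact Or.inl h
    · exact Or.inr h
    · exact absurd rfl hab
  min := x
  max := y
  isLeast := ⟨Or.inl rfl, by rintro a (rfl | rfl); exacts [le_rfl, h]⟩
  isGreatest := ⟨Or.inr rfl, by rintro a (rfl | rfl); exacts [h, le_rfl]⟩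

theorem pair_self (x : E) : pair x x le_rfl = single x :=
  ext (Set.pair_eq_singleton x)

theorem min_le_max (a : OrientalArrow E) : a.min ≤ a.max := a.isLeast.2 a.isGreatest.1

theorem map_pair {F : Type v} [PartialOrder F] (φ : E →o F) (x y : E) (h : x ≤ y) :
    (pair x y h).map φ = pair (φ x) (φ y) (φ.monotone h) :=
  ext (Set.image_pair _ _ _)

theorem le_getLastD {x : E} {l : List E} (h : (x :: l).IsChain (· < ·)) :
    ∀ a ∈ x :: l, a ≤ l.getLastD x := by
  induction l generalizing x with
  | nil => simp
  | cons y l ih =>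
    rw [List.isChain_cons_cons] at h
    intro a ha
    rw [List.getLastD_cons]
    rcases List.mem_cons.1 ha with rfl | ha
    · exact h.1.le.trans (ih h.2 y List.mem_cons_self)
    · exact ih h.2 a ha

theorem head_le {x : E} {l : List E} (h : (x :: l).IsChain (· < ·)) : ∀ a ∈ x :: l, x ≤ a := by
  intro a ha
  rcases List.mem_cons.1 ha with rfl | ha
  · exact le_rfl
  · exact ((List.pairwise_cons.1 (List.isChain_iff_pairwise.1 h)).1 a ha).le

/-- The chain formed by a strictly increasing nonempty list. -/
@[simps]
def ofList (x : E) (l : List E) (h : (x :: l).IsChain (· < ·)) : OrientalArrow E where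
  S := {y | y ∈ x :: l}
  finite := List.finite_toSet _
  chain := by
    induction l generalizing x with
    | nil => rintro a ha b hb hab; simp_all
    | cons y l ih =>
      rintro a ha b hb hab
      rcases List.mem_cons.1 ha with rfl | ha'
      · exact Or.inl (head_le h b hb)
      · rcases List.mem_cons.1 hb with rfl | hb'
        · exact Or.inr (head_le h a ha)
        · exact ih y (List.isChain_cons_cons.1 h).2 ha' hb' hab
  min := x
  max := l.getLastD x
  isLeast := ⟨List.mem_cons_self, head_le h⟩
  isGreatest := ⟨List.getLastD_mem_cons, le_getLastD h⟩

theorem ofList_cons {x y : E} {l : List E} (h : (x :: y :: l).IsChain (· < ·)) :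
    ofList x (y :: l) h = (ofList y l (List.isChain_cons_cons.1 h).2).union
      (pair x y (List.isChain_cons_cons.1 h).1.le) (by rw [ofList_min, pair_max]) := by
  ext a; simp

theorem ofList_nil {x : E} (h : [x].IsChain (· < ·)) : ofList x [] h = single x := by
  ext a; simp

/-- Induction on the cardinality. If the chain has a point other than its minimum, removing the
minimum leaves a chain with a least element and the same greatest element, and the induction
hypothesis lists it. -/
theorem exists_list (a : OrientalArrow E) :
    ∃ (l : List E) (h : (a.min :: l).IsChain (· < ·)), ofList a.min l h = a := by
  classical
  suffices H : ∀ (n : ℕ) (a : OrientalArrow E), a.S.ncard = n →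
      ∃ (l : List E) (h : (a.min :: l).IsChain (· < ·)), ofList a.min l h = a from H _ a rfl
  intro n
  induction n with
  | zero =>
    intro a ha
    rw [Set.ncard_eq_zero a.finite] at ha
    exact absurd a.isLeast.1 (by simp [ha])
  | succ n ih =>
    intro a ha
    by_cases hs : a.S \ {a.min} = ∅
    · refine ⟨[], by simp, ext ?_⟩
      have := a.isLeast.1
      ext y
      simp only [ofList_S, List.mem_singleton, Set.mem_ofPred_eq]
      constructor
      · rintro rfl; exact this
      · intro hy
        by_contra h
        exact (Set.eq_empty_iff_forall_notMem.1 hs) y ⟨hy, h⟩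
    · obtain ⟨m, hm⟩ := (a.finite.subset Set.sdiff_subset).exists_minimal
        (Set.nonempty_iff_ne_empty.2 hs)
      have hleast : IsLeast (a.S \ {a.min}) m := ⟨hm.1, fun y hy => by
        by_cases h : m = y
        · exact h.le
        · rcases a.chain hm.1.1 hy.1 h with h' | h'
          · exact h'
          · exact hm.2 hy h'⟩
      -- The maximum survives: if it were the minimum, `m` would lie between the two and equal the
      -- minimum.
      have hgr : IsGreatest (a.S \ {a.min}) a.max := ⟨⟨a.isGreatest.1, fun h => hm.1.2 (by
        have h₁ := a.isGreatest.2 hm.1.1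
        have h₂ := a.isLeast.2 hm.1.1
        rw [Set.mem_singleton_iff.1 h] at h₁
        exact le_antisymm h₁ h₂)⟩, fun y hy => a.isGreatest.2 hy.1⟩
      obtain ⟨l, hl, e⟩ := ih ⟨a.S \ {a.min}, a.finite.subset Set.sdiff_subset,
        a.chain.mono Set.sdiff_subset, m, a.max, hleast, hgr⟩
        (by rw [Set.ncard_sdiff_singleton_of_mem a.isLeast.1, ha]; rfl)
      have hlt : a.min < m := lt_of_le_of_ne (a.isLeast.2 hm.1.1) fun h => hm.1.2 h.symm
      refine ⟨m :: l, List.isChain_cons_cons.2 ⟨hlt, hl⟩, ext ?_⟩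
      have e' := congrArg OrientalArrow.S e
      have hmin := a.isLeast.1
      ext y
      have e'' := Set.ext_iff.1 e' y
      simp only [ofList_S, Set.mem_ofPred_eq, Set.mem_sdiff, Set.mem_singleton_iff] at e'' ⊢
      rw [List.mem_cons, e'']
      by_cases hy : y = a.min
      · simp [hy, hmin]
      · simp [hy]

/-- The list of the elements of a chain other than its minimum. -/
noncomputable def tail (a : OrientalArrow E) : List E := a.exists_list.choose

theorem tail_isChain (a : OrientalArrow E) : (a.min :: a.tail).IsChain (· < ·) :=
  a.exists_list.choose_spec.choose

theorem ofList_tail (a : OrientalArrow E) : ofList a.min a.tail a.tail_isChain = a :=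
  a.exists_list.choose_spec.choose_spec

theorem mem_tail (a : OrientalArrow E) (y : E) : y ∈ a.min :: a.tail ↔ y ∈ a.S := by
  conv_rhs => rw [← a.ofList_tail]
  rfl

theorem getLastD_tail (a : OrientalArrow E) : a.tail.getLastD a.min = a.max :=
  congrArg OrientalArrow.max a.ofList_tail

/-- A strictly increasing list is determined by its set of elements. -/
theorem tail_unique (a : OrientalArrow E) {l : List E} (hl : (a.min :: l).IsChain (· < ·))
    (h : ∀ y, y ∈ a.min :: l ↔ y ∈ a.S) : a.tail = l := by
  have := List.Pairwise.eq_of_mem_iff (List.isChain_iff_pairwise.1 a.tail_isChain)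
    (List.isChain_iff_pairwise.1 hl) fun y => (a.mem_tail y).trans (h y).symm
  exact (List.cons.inj this).2

theorem tail_single (x : E) : (single x).tail = [] :=
  tail_unique _ (by simp) (by simp)

theorem tail_pair {x y : E} (h : x < y) : (pair x y h.le).tail = [y] :=
  tail_unique _ (by simpa using h) (by simp)

theorem isChain_append {x : E} {l m : List E} (h : (x :: l).IsChain (· < ·))
    (h' : (l.getLastD x :: m).IsChain (· < ·)) : (x :: (l ++ m)).IsChain (· < ·) := by
  induction l generalizing x with
  | nil => simpa using h'
  | cons y l ih =>
    rw [List.isChain_cons_cons] at h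
    rw [List.getLastD_cons] at h'
    exact List.isChain_cons_cons.2 ⟨h.1, ih h.2 h'⟩

/-- The common point `b.min = a.max` is the last entry of the list of `a` and the omitted head of
the list of `b`, so the two tails concatenate without repetition. -/
theorem tail_union (b a : OrientalArrow E) (h : b.min = a.max) :
    (b.union a h).tail = a.tail ++ b.tail := by
  have hb := b.tail_isChain
  have hb' := b.mem_tail
  have ha' := a.mem_tail
  have hm : b.min ∈ a.S := h ▸ a.isGreatest.1
  refine tail_unique _ (isChain_append a.tail_isChain (by
    rw [union_min, a.getLastD_tail, ← h]; exact hb)) ?_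
  intro y
  rw [union_S, Set.mem_union, ← hb', ← ha']
  simp only [List.mem_cons, List.mem_append, union_min] at *
  constructor
  · tauto
  · rintro ((rfl | hy) | hy)
    · have := (ha' b.min).2 hm
      tauto
    · tauto
    · tauto

end OrientalArrow

/-- The inclusion `{x, z} ⊆ {x, y, z}`, for `x ≤ y ≤ z`. -/
@[simps]
def OrientalCell.triple {E : Type u} [PartialOrder E] (x y z : E) (h : x ≤ y) (h' : y ≤ z) :
    OrientalCell E where
  dom := .pair x z (h.trans h')
  cod := (OrientalArrow.pair y z h').union (.pair x y h) (by simp)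
  le := by rintro a (rfl | rfl); exacts [Or.inr (Or.inl rfl), Or.inl (Or.inr rfl)]
  min_eq := rfl
  max_eq := rfl

/-! ## Strict 2-functors from `O(E)` -/

/-- `Refines x l l'` means that the strictly increasing lists `x :: l` and `x :: l'` have the same
last element, and that the first one is contained in the second one. -/
inductive Refines {E : Type u} [PartialOrder E] : E → List E → List E → Prop
  | nil (x) : Refines x [] []
  | keep {x y l l'} : x < y → Refines y l l' → Refines x (y :: l) (y :: l')
  | skip {x y z l l'} : x < y → y < z → Refines y (z :: l) l' → Refines x (z :: l) (y :: l')

namespace Refines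

variable {E : Type u} [PartialOrder E] {x : E} {l l' l'' : List E}

theorem isChain_right (h : Refines x l l') : (x :: l').IsChain (· < ·) := by
  induction h with
  | nil => simp
  | keep h _ ih => exact List.isChain_cons_cons.2 ⟨h, ih⟩
  | skip h _ _ ih => exact List.isChain_cons_cons.2 ⟨h, ih⟩

theorem isChain_left (h : Refines x l l') : (x :: l).IsChain (· < ·) := by
  induction h with
  | nil => simp
  | keep h _ ih => exact List.isChain_cons_cons.2 ⟨h, ih⟩
  | skip h h' _ ih =>
    exact List.isChain_cons_cons.2 ⟨h.trans h', (List.isChain_cons_cons.1 ih).2⟩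

theorem getLastD_eq (h : Refines x l l') : l.getLastD x = l'.getLastD x := by
  induction h with
  | nil => rfl
  | keep h _ ih => rwa [List.getLastD_cons, List.getLastD_cons]
  | skip h _ _ ih => rw [List.getLastD_cons] at ih ⊢; rwa [List.getLastD_cons]

theorem subset (h : Refines x l l') : l ⊆ l' := by
  induction h with
  | nil => simp
  | keep h _ ih => exact List.cons_subset_cons _ ih
  | skip h h' _ ih => exact fun a ha => List.mem_cons_of_mem _ (ih ha)

/-- Compare the first entries `z` of `l` and `y` of `l'`. If they are equal the point is kept;
otherwise `y < z` and `y` is a point to be inserted. The common last element prevents `l` from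
ending before `l'`. -/
theorem of_subset (h : (x :: l).IsChain (· < ·)) (h' : (x :: l').IsChain (· < ·))
    (hl : l.getLastD x = l'.getLastD x) (hs : l ⊆ l') : Refines x l l' := by
  induction l' generalizing x l with
  | nil =>
    obtain rfl : l = [] := List.subset_nil.1 hs
    exact .nil x
  | cons y l' ih =>
    rw [List.isChain_cons_cons] at h'
    rw [List.getLastD_cons] at hl
    have hx : ∀ a ∈ y :: l', x < a := fun a ha =>
      h'.1.trans_le (OrientalArrow.head_le h'.2 a ha)
    cases l with
    | nil =>
      exact absurd hl (hx _ List.getLastD_mem_cons).ne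
    | cons z l =>
      rw [List.isChain_cons_cons] at h
      rw [List.getLastD_cons] at hl
      have hz : ∀ a ∈ l, z < a := (List.pairwise_cons.1 (List.isChain_iff_pairwise.1 h.2)).1
      by_cases hzy : z = y
      · subst hzy
        refine .keep h.1 (ih h.2 h'.2 hl fun a ha => ?_)
        exact (List.mem_cons.1 (hs (List.mem_cons_of_mem _ ha))).resolve_left (hz a ha).ne'
      · have hyz : y < z := lt_of_le_of_ne
          (OrientalArrow.head_le h'.2 z (hs List.mem_cons_self)) (Ne.symm hzy)
        refine .skip h'.1 hyz (ih (List.isChain_cons_cons.2 ⟨hyz, h.2⟩) h'.2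
          (by rwa [List.getLastD_cons]) fun a ha => ?_)
        refine (List.mem_cons.1 (hs ha)).resolve_left ?_
        rintro rfl
        exact (hyz.trans_le (OrientalArrow.head_le h.2 _ ha)).false

theorem of_cell (c : OrientalCell E) : Refines c.dom.min c.dom.tail c.cod.tail := by
  have h := c.dom.tail_isChain
  refine of_subset h (by rw [c.min_eq]; exact c.cod.tail_isChain) ?_ ?_
  · rw [c.dom.getLastD_tail, c.min_eq, c.cod.getLastD_tail, c.max_eq]
  · intro a ha
    have hne : c.dom.min < a := (List.pairwise_cons.1 (List.isChain_iff_pairwise.1 h)).1 a ha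
    have := (c.cod.mem_tail a).2 (c.le ((c.dom.mem_tail a).1 (List.mem_cons_of_mem _ ha)))
    exact (List.mem_cons.1 this).resolve_left (by rw [← c.min_eq]; exact hne.ne')

end Refines

/-- A normalised oplax 2-functor from a poset `E` to a 2-category, in elementary terms: `con x y z`
is the constraint from `ar x z` to the composite of `ar x y` and `ar y z`. Values at
non-comparable elements are irrelevant. -/
structure OplaxDiagram (E : Type u) [PartialOrder E] (D : TwoCat.{v}) where
  ob : E → D.Ob
  ar : E → E → D.Ar
  con : E → E → E → D.Ce
  src_ar : ∀ {x y}, x ≤ y → D.src (ar x y) = ob x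
  tgt_ar : ∀ {x y}, x ≤ y → D.tgt (ar x y) = ob y
  src₂_con : ∀ {x y z}, x ≤ y → y ≤ z → D.src₂ (con x y z) = ar x z
  tgt₂_con : ∀ {x y z}, x ≤ y → y ≤ z → D.tgt₂ (con x y z) = D.cmp (ar y z) (ar x y)
  ar_self : ∀ x, ar x x = D.id₁ (ob x)
  con_left : ∀ {x y}, x ≤ y → con x x y = D.id₂ (ar x y)
  con_right : ∀ {x y}, x ≤ y → con x y y = D.id₂ (ar x y)
  cocycle : ∀ {x y z w}, x ≤ y → y ≤ z → z ≤ w →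
    D.vc (D.hc (D.id₂ (ar z w)) (con x y z)) (con x z w) =
      D.vc (D.hc (con y z w) (D.id₂ (ar x y))) (con x y w)

/-- Construction of a strict 2-functor with source `O(E)`. -/
def TwoFunctor.ofOriental {E : Type u} [PartialOrder E] {D : TwoCat.{v}} (ob : E → D.Ob)
    (ar : OrientalArrow E → D.Ar) (ce : OrientalCell E → D.Ce)
    (src_ar : ∀ f, D.src (ar f) = ob f.min) (tgt_ar : ∀ f, D.tgt (ar f) = ob f.max)
    (src₂_ce : ∀ α, D.src₂ (ce α) = ar α.dom) (tgt₂_ce : ∀ α, D.tgt₂ (ce α) = ar α.cod)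
    (ar_single : ∀ x, ar (.single x) = D.id₁ (ob x))
    (ar_union : ∀ b a h, ar (b.union a h) = D.cmp (ar b) (ar a))
    (ce_refl : ∀ c : OrientalCell E, c.dom = c.cod → ce c = D.id₂ (ar c.dom))
    (ce_trans : ∀ d c e : OrientalCell E, d.dom = c.cod → e.dom = c.dom → e.cod = d.cod →
      ce e = D.vc (ce d) (ce c))
    (ce_union : ∀ (d c e : OrientalCell E) h h', e.dom = d.dom.union c.dom h →
      e.cod = d.cod.union c.cod h' → ce e = D.hc (ce d) (ce c)) :
    TwoFunctor (TwoCat.oriental E) D :=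
  TwoFunctor.ofTotal ob ar ce src_ar tgt_ar src₂_ce tgt₂_ce ar_single
    (fun g f h => by rw [TwoCat.cmp_eq h]; exact ar_union g f h)
    (fun f => ce_refl ⟨f, f, subset_rfl, rfl, rfl⟩ rfl)
    (fun β α h => by rw [TwoCat.vc_eq h]; exact ce_trans β α _ h rfl rfl)
    (fun β α h => by
      rw [TwoCat.hc_eq h]
      exact ce_union β α _ h (β.min_eq.symm.trans (Eq.trans h α.max_eq)) rfl rfl)

namespace TwoFunctor

variable {E : Type u} [PartialOrder E] {D : TwoCat.{v}} (G : TwoFunctor (TwoCat.oriental E) D)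

/-- The value of a 2-functor from `O(E)` at an element of `E`. -/
def atOb (x : E) : D.Ob := G.ob x

/-- The value of a 2-functor from `O(E)` at a chain. -/
def atAr (a : OrientalArrow E) : D.Ar := G.ar a

/-- The value of a 2-functor from `O(E)` at an inclusion of chains. -/
def atCe (c : OrientalCell E) : D.Ce := G.ce c

end TwoFunctor

namespace OplaxDiagram

variable {E : Type u} [PartialOrder E] {D : TwoCat.{v}} (F : OplaxDiagram E D)

attribute [grind =] src_ar tgt_ar src₂_con tgt₂_con ar_self con_left con_right

/-- The composite of the 1-cells attached to the successive elements of `x :: l`. -/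
noncomputable def listAr : E → List E → D.Ar
  | x, [] => D.id₁ (F.ob x)
  | x, y :: l => D.cmp (listAr y l) (F.ar x y)

open Classical in
/-- The 2-cell from `listAr x l` to `listAr x l'` when `x :: l'` refines `x :: l`. -/
noncomputable def listCe : E → List E → List E → D.Ce
  -- Only the case of two empty lists is meaningful in these two lines: `Refines` never relates an
  -- empty list and a nonempty one.
  | x, _, [] => D.id₂ (D.id₁ (F.ob x))
  | x, [], _ :: _ => D.id₂ (D.id₁ (F.ob x))
  | x, z :: l, y :: l' =>
    if z = y then D.hc (listCe y l l') (D.id₂ (F.ar x y))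
    -- Here `y` is a new point between `x` and `z`: the constraint inserts it first, then the part
    -- after `y` is refined.
    else D.vc (D.hc (listCe y (z :: l) l') (D.id₂ (F.ar x y)))
      (D.hc (D.id₂ (F.listAr z l)) (F.con x y z))

theorem listCe_keep (x y : E) (l l' : List E) :
    F.listCe x (y :: l) (y :: l') = D.hc (F.listCe y l l') (D.id₂ (F.ar x y)) := by
  rw [listCe, if_pos rfl]

theorem listCe_skip (x : E) {y z : E} (h : z ≠ y) (l l' : List E) :
    F.listCe x (z :: l) (y :: l') = D.vc (D.hc (F.listCe y (z :: l) l') (D.id₂ (F.ar x y)))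
      (D.hc (D.id₂ (F.listAr z l)) (F.con x y z)) := by
  rw [listCe, if_neg h]

theorem listAr_cons (x y : E) (l : List E) :
    F.listAr x (y :: l) = D.cmp (F.listAr y l) (F.ar x y) := rfl

theorem src_tgt_listAr {x : E} {l : List E} (h : (x :: l).IsChain (· < ·)) :
    D.src (F.listAr x l) = F.ob x ∧ D.tgt (F.listAr x l) = F.ob (l.getLastD x) := by
  induction l generalizing x with
  | nil => exact ⟨D.src_id₁ _, D.tgt_id₁ _⟩
  | cons y l ih =>
    rw [List.isChain_cons_cons] at h
    obtain ⟨h₁, h₂⟩ := ih h.2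
    have := h.1.le
    rw [List.getLastD_cons, listAr_cons]
    grind

theorem src₂_tgt₂_listCe {x : E} {l l' : List E} (h : Refines x l l') :
    D.src₂ (F.listCe x l l') = F.listAr x l ∧ D.tgt₂ (F.listCe x l l') = F.listAr x l' := by
  induction h with
  | nil x => exact ⟨D.src₂_id₂ _, D.tgt₂_id₂ _⟩
  | @keep x y l l' h h' ih =>
    have := h.le
    have h₁ := F.src_tgt_listAr h'.isChain_left
    have h₂ := F.src_tgt_listAr h'.isChain_right
    rw [listCe_keep, listAr_cons, listAr_cons]
    grind
  | @skip x y z l l' h h' h'' ih =>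
    have := h.le
    have := h'.le
    have h₁ := F.src_tgt_listAr h''.isChain_left
    have h₂ := F.src_tgt_listAr h''.isChain_right
    have h₃ := F.src_tgt_listAr (List.isChain_cons_cons.1 h''.isChain_left).2
    rw [listCe_skip _ _ h'.ne', listAr_cons, listAr_cons]
    rw [listAr_cons] at ih h₁
    grind

theorem listCe_refl {x : E} {l : List E} (h : (x :: l).IsChain (· < ·)) :
    F.listCe x l l = D.id₂ (F.listAr x l) := by
  induction l generalizing x with
  | nil => rfl
  | cons y l ih =>
    rw [List.isChain_cons_cons] at h
    have := F.src_tgt_listAr h.2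
    have := h.1.le
    rw [listCe_keep, listAr_cons, ih h.2]
    grind

/-- Induction on the finer inclusion. Interchange settles every case but the one with two successive
insertions in the same first step. There the left side inserts `y` and then `w` between `x` and `z`,
while the right side inserts `w` and then `y`; the cocycle condition at `x < w < y < z` identifies
the two. -/
theorem listCe_trans {x : E} {l l' l'' : List E} (h : Refines x l l') (h' : Refines x l' l'') :
    D.vc (F.listCe x l' l'') (F.listCe x l l') = F.listCe x l l'' := by
  induction h' generalizing l with
  | nil x =>
    cases h
    grind [listCe]
  | @keep x y l' l'' hxy h' ih =>
    cases h with
    | keep _ h =>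
      have := hxy.le
      have h₁ := F.src_tgt_listAr h'.isChain_left
      have h₂ := F.src_tgt_listAr h'.isChain_right
      have h₃ := F.src_tgt_listAr h.isChain_left
      have h₄ := F.src₂_tgt₂_listCe h
      have h₅ := F.src₂_tgt₂_listCe h'
      rw [listCe_keep, listCe_keep, listCe_keep, ← ih h]
      grind
    | @skip _ _ z l _ _ hyz h =>
      have := hxy.le
      have := hyz.le
      have h₁ := F.src_tgt_listAr h'.isChain_left
      have h₂ := F.src_tgt_listAr h'.isChain_right
      have h₃ := F.src_tgt_listAr h.isChain_left
      have h₄ := F.src₂_tgt₂_listCe h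
      have h₅ := F.src₂_tgt₂_listCe h'
      have h₆ := F.src_tgt_listAr (List.isChain_cons_cons.1 h.isChain_left).2
      rw [listCe_keep, listCe_skip _ _ hyz.ne', listCe_skip _ _ hyz.ne', ← ih h]
      rw [listAr_cons] at h₃ h₄
      rw [← D.vc_assoc]
      grind
      all_goals grind
  | @skip x w y l' l'' hxw hwy h' ih =>
    have := hxw.le
    have := hwy.le
    have h₁ := F.src_tgt_listAr h'.isChain_left
    have h₂ := F.src_tgt_listAr h'.isChain_right
    have h₅ := F.src₂_tgt₂_listCe h'
    have h₇ := F.src_tgt_listAr (List.isChain_cons_cons.1 h'.isChain_left).2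
    rw [listAr_cons] at h₁ h₅
    cases h with
    | @keep _ _ l _ hxy h =>
      have h₃ := F.src_tgt_listAr h.isChain_left
      have h₄ := F.src₂_tgt₂_listCe h
      rw [listCe_keep, listCe_skip _ _ hwy.ne', listCe_skip _ _ hwy.ne', ← ih (.keep hwy h),
        listCe_keep]
      -- Interchange: inserting `w` between `x` and `y` commutes with a refinement that takes place
      -- after `y`.
      have e₁ : D.vc (D.hc (D.id₂ (F.listAr y l')) (F.con x w y))
          (D.hc (F.listCe y l l') (D.id₂ (F.ar x y))) =
        D.vc (D.hc (F.listCe y l l') (D.id₂ (D.cmp (F.ar w y) (F.ar x w))))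
          (D.hc (D.id₂ (F.listAr y l)) (F.con x w y)) := by
        grind
      rw [D.vc_assoc, e₁]
      · grind [D.hc_vc_id₂]
      · grind
      · grind
    | @skip _ _ z l _ hxy hyz h =>
      have := hxy.le
      have := hyz.le
      have hwz := (hwy.trans hyz)
      have := hwz.le
      have h₃ := F.src_tgt_listAr h.isChain_left
      have h₄ := F.src₂_tgt₂_listCe h
      have h₆ := F.src_tgt_listAr (List.isChain_cons_cons.1 h.isChain_left).2
      rw [listCe_skip _ _ hwy.ne', listCe_skip _ _ hyz.ne', listCe_skip _ _ hwz.ne',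
        ← ih (.skip hwy hyz h), listCe_skip _ _ hyz.ne']
      rw [listAr_cons] at h₃ h₄
      have hc := F.cocycle hxw.le hwy.le hyz.le
      have e₁ : D.vc (D.hc (D.id₂ (F.listAr y l')) (F.con x w y))
          (D.hc (F.listCe y (z :: l) l') (D.id₂ (F.ar x y))) =
        D.vc (D.hc (F.listCe y (z :: l) l') (D.id₂ (D.cmp (F.ar w y) (F.ar x w))))
          (D.hc (D.id₂ (D.cmp (F.listAr z l) (F.ar y z))) (F.con x w y)) := by
        grind
      have e₂ : D.vc (D.hc (D.id₂ (D.cmp (F.listAr z l) (F.ar y z))) (F.con x w y))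
          (D.hc (D.id₂ (F.listAr z l)) (F.con x y z)) =
        D.vc (D.hc (D.hc (D.id₂ (F.listAr z l)) (F.con w y z)) (D.id₂ (F.ar x w)))
          (D.hc (D.id₂ (F.listAr z l)) (F.con x w z)) := by
        -- The cocycle condition, whiskered by the rest of the chain after `z`.
        have e₃ := congrArg (D.hc (D.id₂ (F.listAr z l))) hc
        rw [D.hc_id₂_vc, D.hc_id₂_vc] at e₃
        · rw [← D.hc_id₂, D.hc_assoc, D.hc_assoc, e₃]
          all_goals grind
        all_goals grind
      have e₅ : D.vc (D.hc (D.id₂ (F.listAr y l')) (F.con x w y))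
          (D.vc (D.hc (F.listCe y (z :: l) l') (D.id₂ (F.ar x y)))
            (D.hc (D.id₂ (F.listAr z l)) (F.con x y z))) = 
        D.vc (D.hc (F.listCe y (z :: l) l') (D.id₂ (D.cmp (F.ar w y) (F.ar x w))))
          (D.vc (D.hc (D.hc (D.id₂ (F.listAr z l)) (F.con w y z)) (D.id₂ (F.ar x w)))
          (D.hc (D.id₂ (F.listAr z l)) (F.con x w z))) := by
        rw [← D.vc_assoc, e₁, D.vc_assoc, e₂]
        all_goals grind
      rw [D.vc_assoc, e₅]
      · grind [D.hc_vc_id₂]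
      · grind
      · grind

theorem listAr_append {x : E} {l m : List E} (h : (x :: l).IsChain (· < ·))
    (h' : (l.getLastD x :: m).IsChain (· < ·)) :
    F.listAr x (l ++ m) = D.cmp (F.listAr (l.getLastD x) m) (F.listAr x l) := by
  induction l generalizing x with
  | nil =>
    have := F.src_tgt_listAr h'
    rw [List.getLastD_nil] at *
    exact (D.cmp_id this.1).symm
  | cons y l ih =>
    rw [List.isChain_cons_cons] at h
    rw [List.getLastD_cons] at h' ⊢
    have h₁ := F.src_tgt_listAr h.2
    have h₂ := F.src_tgt_listAr h'
    have := h.1.le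
    rw [List.cons_append, listAr_cons, ih h.2 h', listAr_cons]
    grind

/-- The two refinements take place on consecutive intervals, so they compose horizontally. When a
point is inserted in the first interval, interchange carries the second refinement past the
constraint. -/
theorem listCe_append {x : E} {l l' m m' : List E} (h : Refines x l l')
    (h' : Refines (l.getLastD x) m m') :
    F.listCe x (l ++ m) (l' ++ m') =
      D.hc (F.listCe (l.getLastD x) m m') (F.listCe x l l') := by
  induction h with
  | nil =>
    have := F.src_tgt_listAr h'.isChain_left
    have h₂ := F.src₂_tgt₂_listCe h'
    rw [List.getLastD_nil] at *
    refine (D.hc_id ?_).symm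
    grind
  | @keep x y l l' h h₁ ih =>
    rw [List.getLastD_cons] at h' ⊢
    have h₂ := F.src_tgt_listAr h₁.isChain_left
    have h₃ := F.src_tgt_listAr h'.isChain_left
    have h₄ := F.src₂_tgt₂_listCe h₁
    have h₅ := F.src₂_tgt₂_listCe h'
    have := h.le
    rw [List.cons_append, List.cons_append, listCe_keep, listCe_keep, ih h']
    grind
  | @skip x y z l l' h hyz h₁ ih =>
    have ih := ih (by rwa [List.getLastD_cons] at h' ⊢)
    rw [List.getLastD_cons] at h' ⊢
    rw [List.getLastD_cons, List.cons_append] at ih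
    have h₀ := (List.isChain_cons_cons.1 h₁.isChain_left).2
    have h₂ := F.src_tgt_listAr h₁.isChain_left
    have h₃ := F.src_tgt_listAr h'.isChain_left
    have h₄ := F.src₂_tgt₂_listCe h₁
    have h₅ := F.src₂_tgt₂_listCe h'
    have h₆ := F.src_tgt_listAr h₀
    have := h.le
    have := hyz.le
    rw [List.cons_append, List.cons_append, listCe_skip _ _ hyz.ne', listCe_skip _ _ hyz.ne', ih,
      F.listAr_append h₀ h'.isChain_left]
    rw [listAr_cons] at h₂ h₄
    rw [D.hc_vc_right (f := F.listAr (l.getLastD z) m), ← D.hc_id₂, D.hc_assoc, D.hc_assoc]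
    all_goals grind

/-- The strict 2-functor `O(E) ⟶ D` attached to a normalised oplax 2-functor from `E` to `D`. -/
noncomputable def toFunctor : TwoFunctor (TwoCat.oriental E) D :=
  TwoFunctor.ofOriental F.ob (fun a => F.listAr a.min a.tail)
    (fun c => F.listCe c.dom.min c.dom.tail c.cod.tail)
    (fun a => (F.src_tgt_listAr a.tail_isChain).1)
    (fun a => (F.src_tgt_listAr a.tail_isChain).2.trans (congrArg F.ob a.getLastD_tail))
    (fun c => (F.src₂_tgt₂_listCe (.of_cell c)).1)
    (fun c => ((F.src₂_tgt₂_listCe (.of_cell c)).2.trans (by rw [c.min_eq])))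
    (fun x => congrArg (F.listAr x) (OrientalArrow.tail_single x))
    (fun g f h => by
      rw [OrientalArrow.tail_union, OrientalArrow.union_min, F.listAr_append f.tail_isChain
        (by rw [f.getLastD_tail, ← h]; exact g.tail_isChain), f.getLastD_tail, ← h])
    (fun c h => by
      rw [← h]
      exact F.listCe_refl c.dom.tail_isChain)
    (fun β α γ h hd hc => by
      have h₁ := Refines.of_cell α
      have h₂ := Refines.of_cell β
      rw [h, ← α.min_eq] at h₂
      rw [h, hd, hc, ← α.min_eq, F.listCe_trans h₁ h₂])
    (fun β α γ h h' hd hc => by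
      have h₁ := Refines.of_cell α
      have h₂ := Refines.of_cell β
      rw [hd, hc, OrientalArrow.tail_union, OrientalArrow.tail_union, OrientalArrow.union_min,
        F.listCe_append h₁ (by rw [α.dom.getLastD_tail, ← h]; exact h₂), α.dom.getLastD_tail, ← h])

theorem toFunctor_ar (a : OrientalArrow E) : F.toFunctor.atAr a = F.listAr a.min a.tail := rfl

theorem toFunctor_ce (c : OrientalCell E) :
    F.toFunctor.atCe c = F.listCe c.dom.min c.dom.tail c.cod.tail := rfl

theorem toFunctor_pair (x y : E) (h : x ≤ y) : F.toFunctor.atAr (.pair x y h) = F.ar x y := by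
  rcases h.eq_or_lt with rfl | h'
  · rw [OrientalArrow.pair_self]
    exact (F.toFunctor.ar_id₁ x).trans (F.ar_self x).symm
  · rw [toFunctor_ar, OrientalArrow.tail_pair h']
    exact D.id_cmp (F.tgt_ar h)

/-- If two of the points coincide, the inclusion is an identity and normalisation applies. Otherwise
the recursion runs from the tail `[z]` to the tail `[y, z]` and meets a single insertion. -/
theorem toFunctor_triple (x y z : E) (h : x ≤ y) (h' : y ≤ z) :
    F.toFunctor.atCe (.triple x y z h h') = F.con x y z := by
  have key : ∀ c : OrientalCell E, c.cod = c.dom → F.toFunctor.atCe c =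
      D.id₂ (F.toFunctor.atAr c.dom) := by
    rintro ⟨a, b, _, _, _⟩ (rfl : b = a)
    exact F.toFunctor.ce_id₂ b
  rcases h.eq_or_lt with rfl | hxy
  · rw [key _ (OrientalArrow.ext (by ext; simp)), F.con_left h']
    exact congrArg _ (F.toFunctor_pair _ _ h')
  · rcases h'.eq_or_lt with rfl | hyz
    · rw [key _ (OrientalArrow.ext (by ext; simp)), F.con_right h]
      exact congrArg _ (F.toFunctor_pair _ _ h)
    · have e : (OrientalCell.triple x y z h h').cod.tail = [y, z] := by
        refine OrientalArrow.tail_unique _ (by simp [hxy, hyz]) fun a => ?_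
        simp
      rw [toFunctor_ce, e]
      change F.listCe x (OrientalArrow.pair x z (h.trans h')).tail _ = _
      rw [OrientalArrow.tail_pair (hxy.trans hyz), listCe_skip _ _ hyz.ne', listCe_keep]
      simp only [listCe, listAr]
      grind

end OplaxDiagram

/-! ### Restriction of a strict 2-functor from `O(E)` to its generators -/

namespace OrientalCell

variable {E : Type u} [PartialOrder E]

/-- The identity 2-cell of a chain. -/
@[simps]
def refl (a : OrientalArrow E) : OrientalCell E := ⟨a, a, subset_rfl, rfl, rfl⟩

/-- The vertical composite of two inclusions. -/
@[simps]
def trans (d c : OrientalCell E) (h : d.dom = c.cod) : OrientalCell E where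
  dom := c.dom
  cod := d.cod
  le := ((TwoCat.oriental E).vcomp d c h).le
  min_eq := ((TwoCat.oriental E).vcomp d c h).min_eq
  max_eq := ((TwoCat.oriental E).vcomp d c h).max_eq

/-- The horizontal composite of two inclusions. -/
@[simps]
def union (d c : OrientalCell E) (h : d.dom.min = c.dom.max) : OrientalCell E where
  dom := d.dom.union c.dom h
  cod := d.cod.union c.cod (by rw [← d.min_eq, ← c.max_eq, h])
  le := Set.union_subset_union d.le c.le
  min_eq := c.min_eq
  max_eq := d.max_eq

end OrientalCell

namespace TwoFunctor

variable {E : Type u} [PartialOrder E] {D : TwoCat.{v}} (G : TwoFunctor (TwoCat.oriental E) D)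

@[grind =] theorem src_atAr (a : OrientalArrow E) : D.src (G.atAr a) = G.atOb a.min := G.src_ar a
@[grind =] theorem tgt_atAr (a : OrientalArrow E) : D.tgt (G.atAr a) = G.atOb a.max := G.tgt_ar a
@[grind =] theorem src₂_atCe (c : OrientalCell E) : D.src₂ (G.atCe c) = G.atAr c.dom := G.src₂_ce c
@[grind =] theorem tgt₂_atCe (c : OrientalCell E) : D.tgt₂ (G.atCe c) = G.atAr c.cod := G.tgt₂_ce c

theorem atAr_single (x : E) : G.atAr (.single x) = D.id₁ (G.atOb x) := G.ar_id₁ x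

theorem atAr_union (b a : OrientalArrow E) (h : b.min = a.max) :
    G.atAr (b.union a h) = D.cmp (G.atAr b) (G.atAr a) :=
  (G.ar_comp₁ b a h (G.composable₁ h)).trans (TwoCat.cmp_eq _).symm

theorem id₂_atAr (a : OrientalArrow E) : D.id₂ (G.atAr a) = G.atCe (.refl a) :=
  (G.ce_id₂ a).symm

theorem vc_atCe (d c : OrientalCell E) (h : d.dom = c.cod) :
    D.vc (G.atCe d) (G.atCe c) = G.atCe (d.trans c h) :=
  (TwoCat.vc_eq (G.composable₂ h)).trans (G.ce_vcomp d c h _).symm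

theorem hc_atCe (d c : OrientalCell E) (h : d.dom.min = c.dom.max) :
    D.hc (G.atCe d) (G.atCe c) = G.atCe (d.union c h) :=
  (TwoCat.hc_eq (G.composableH h)).trans (G.ce_hcomp d c h _).symm

theorem atCe_refl (c : OrientalCell E) (h : c.dom = c.cod) : G.atCe c = D.id₂ (G.atAr c.dom) := by
  rw [id₂_atAr]
  exact congrArg G.atCe (OrientalCell.ext rfl h.symm)

end TwoFunctor

namespace OplaxDiagram

variable {E : Type u} [PartialOrder E] {D : TwoCat.{v}}

open OrientalArrow Classical in
/-- The restriction to `E` of a strict 2-functor from `O(E)`. -/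
noncomputable def ofFunctor (G : TwoFunctor (TwoCat.oriental E) D) : OplaxDiagram E D where
  ob := G.atOb
  -- The default values involve `G` only through its value at the object `x`. Hence two 2-functors
  -- that agree on the generators have equal restrictions, default values included.
  ar x y := if h : x ≤ y then G.atAr (pair x y h) else G.atAr (single x)
  con x y z := if h : x ≤ y ∧ y ≤ z then G.atCe (.triple x y z h.1 h.2)
    else D.id₂ (G.atAr (single x))
  src_ar h := by rw [dif_pos h]; exact G.src_ar _
  tgt_ar h := by rw [dif_pos h]; exact G.tgt_ar _
  src₂_con h h' := by rw [dif_pos ⟨h, h'⟩, dif_pos (h.trans h')]; exact G.src₂_ce _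
  tgt₂_con h h' := by
    rw [dif_pos ⟨h, h'⟩, dif_pos h, dif_pos h', ← G.atAr_union _ _ (by simp)]; exact G.tgt₂_ce _
  ar_self x := by rw [dif_pos le_rfl, pair_self, G.atAr_single]
  con_left h := by
    rw [dif_pos ⟨le_rfl, h⟩, dif_pos h, G.atCe_refl]
    · rfl
    · exact OrientalArrow.ext (by ext; simp)
  con_right h := by
    rw [dif_pos ⟨h, le_rfl⟩, dif_pos h, G.atCe_refl]
    · rfl
    · exact OrientalArrow.ext (by ext; simp)
  cocycle {x y z w} h h' h'' := by
    have k : x ≤ y ∧ y ≤ z := ⟨h, h'⟩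
    have k₂ : x ≤ z ∧ z ≤ w := ⟨h.trans h', h''⟩
    have k₃ : y ≤ z ∧ z ≤ w := ⟨h', h''⟩
    have k₄ : x ≤ y ∧ y ≤ w := ⟨h, h'.trans h''⟩
    rw [dif_pos k, dif_pos k₂, dif_pos k₃, dif_pos k₄, dif_pos h, dif_pos h'',
      G.id₂_atAr, G.id₂_atAr, G.hc_atCe _ _ (by simp), G.hc_atCe _ _ (by simp),
      G.vc_atCe _ _ rfl, G.vc_atCe _ _ rfl]
    -- Both sides are the value of `G` at the one inclusion `{x, w} ⊆ {x, y, z, w}`.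
    exact congrArg G.atCe (OrientalCell.ext rfl (OrientalArrow.ext (Set.union_assoc _ _ _).symm))

variable (G : TwoFunctor (TwoCat.oriental E) D)

theorem ofFunctor_ar {x y : E} (h : x ≤ y) : (ofFunctor G).ar x y = G.atAr (.pair x y h) :=
  dif_pos h

theorem ofFunctor_con {x y z : E} (h : x ≤ y) (h' : y ≤ z) :
    (ofFunctor G).con x y z = G.atCe (.triple x y z h h') :=
  dif_pos ⟨h, h'⟩

/-- A chain is the union of the pairs of its consecutive elements. -/
theorem ar_ofList {x : E} {l : List E} (h : (x :: l).IsChain (· < ·)) :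
    G.atAr (OrientalArrow.ofList x l h) = (ofFunctor G).listAr x l := by
  induction l generalizing x with
  | nil => rw [OrientalArrow.ofList_nil, G.atAr_single]; rfl
  | cons y l ih =>
    rw [OrientalArrow.ofList_cons, G.atAr_union, ih, listAr_cons, ofFunctor_ar]

/-- Along `Refines`, an inclusion of chains is pasted from inclusions `{x, z} ⊆ {x, y, z}`. Any
2-cell with the right ends may be taken for `c`, since 2-cells of `O(E)` are determined by their
ends. -/
theorem ce_ofList {x : E} {l l' : List E} (h : Refines x l l') :
    ∀ c : OrientalCell E, c.dom = .ofList x l h.isChain_left →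
      c.cod = .ofList x l' h.isChain_right → G.atCe c = (ofFunctor G).listCe x l l' := by
  induction h with
  | nil x =>
    intro c h h'
    rw [G.atCe_refl c (h.trans h'.symm), h, OrientalArrow.ofList_nil, G.atAr_single]
    simp only [listCe]
    rfl
  | @keep x y l l' hxy h ih =>
    intro c hd hc
    let c' : OrientalCell E := ⟨.ofList y l h.isChain_left, .ofList y l' h.isChain_right,
      List.cons_subset_cons _ h.subset, rfl, h.getLastD_eq⟩
    rw [listCe_keep, ← ih c' rfl rfl, ofFunctor_ar G hxy.le, G.id₂_atAr,
      G.hc_atCe _ _ rfl]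
    refine congrArg G.atCe (OrientalCell.ext ?_ ?_)
    · rw [hd, OrientalArrow.ofList_cons]; rfl
    · rw [hc, OrientalArrow.ofList_cons]; rfl
  | @skip x y z l l' hxy hyz h ih =>
    intro c hd hc
    have hl := (List.isChain_cons_cons.1 h.isChain_left).2
    let c' : OrientalCell E := ⟨.ofList y (z :: l) h.isChain_left, .ofList y l' h.isChain_right,
      List.cons_subset_cons _ h.subset, rfl, h.getLastD_eq⟩
    rw [listCe_skip _ _ hyz.ne', ← ih c' rfl rfl, ofFunctor_ar G hxy.le, G.id₂_atAr,
      ofFunctor_con G hxy.le hyz.le, ← ar_ofList G hl, G.id₂_atAr,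
      G.hc_atCe _ _ rfl, G.hc_atCe _ _ rfl, G.vc_atCe]
    · refine congrArg G.atCe (OrientalCell.ext ?_ ?_)
      · rw [hd, OrientalArrow.ofList_cons]; rfl
      · rw [hc, OrientalArrow.ofList_cons]; rfl
    · refine OrientalArrow.ext (Eq.trans ?_ (Set.union_assoc _ _ _))
      exact congrArg (fun a => OrientalArrow.S a ∪ _) (OrientalArrow.ofList_cons h.isChain_left)

end OplaxDiagram

/-- Strict 2-functors with source `O(E)` are determined by their values on the chains with at most
two elements and on the inclusions `{x, z} ⊆ {x, y, z}`. -/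
theorem TwoFunctor.oriental_ext {E : Type u} [PartialOrder E] {D : TwoCat.{v}}
    {G G' : TwoFunctor (TwoCat.oriental E) D} (hob : ∀ x, G.atOb x = G'.atOb x)
    (har : ∀ x y h, G.atAr (.pair x y h) = G'.atAr (.pair x y h))
    (hce : ∀ x y z h h', G.atCe (.triple x y z h h') = G'.atCe (.triple x y z h h')) : G = G' := by
  have e : OplaxDiagram.ofFunctor G = OplaxDiagram.ofFunctor G' := by
    have h₁ : G.atOb = G'.atOb := funext hob
    simp only [OplaxDiagram.ofFunctor, OplaxDiagram.mk.injEq, h₁, true_and]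
    constructor
    · ext x y
      split_ifs with h
      · exact har x y h
      · rw [atAr_single, atAr_single, hob]
    · ext x y z
      split_ifs with h
      · exact hce x y z h.1 h.2
      · rw [atAr_single, atAr_single, hob]
  have h₁ (a : OrientalArrow E) : G.atAr a = G'.atAr a := by
    rw [← OrientalArrow.ofList_tail a, OplaxDiagram.ar_ofList, OplaxDiagram.ar_ofList, e]
  have h₂ (c : OrientalCell E) : G.atCe c = G'.atCe c := by
    have h : OrientalArrow.ofList c.dom.min c.cod.tail (Refines.of_cell c).isChain_right =
        c.cod := by
      conv_rhs => rw [← c.cod.ofList_tail]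
      simp only [c.min_eq]
    rw [OplaxDiagram.ce_ofList G (.of_cell c) c c.dom.ofList_tail.symm h.symm,
      OplaxDiagram.ce_ofList G' (.of_cell c) c c.dom.ofList_tail.symm h.symm, e]
  exact TwoFunctor.ext (funext hob) (funext h₁) (funext h₂)

/-! ### Morphisms `N(E) ⟶ N₂(D)` and the universal property of `O(E)` -/

namespace PosetNerve

open TwoRealization

variable {E : PartOrd.{u}}

/-- The simplex of the nerve of a poset attached to a monotone map. -/
def simplex {Δ : SimplexCategory} (φ : Fin (Δ.len + 1) →o E) : (posetNerve.obj E).obj (op Δ) :=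
  (φ.monotone.functor : ComposableArrows E Δ.len)

theorem exists_simplex {Δ : SimplexCategory} (σ : (posetNerve.obj E).obj (op Δ)) :
    ∃ φ, σ = simplex φ := by
  let σ' : ComposableArrows E Δ.len := σ
  exact ⟨⟨σ'.obj, fun _ _ h => leOfHom (σ'.map (homOfLE h))⟩, rfl⟩

variable {D : TwoCat.{u}} (f : posetNerve.obj E ⟶ nerve₂.obj D)

/-- The 2-functor `O(Δ_m) ⟶ D` attached to an `m`-simplex. -/
def onSimplex {Δ : SimplexCategory} (φ : Fin (Δ.len + 1) →o E) :
    TwoFunctor (TwoCat.oriental (ULift.{u} (Fin (Δ.len + 1)))) D :=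
  cell f (simplex φ)

theorem onSimplex_comp {Δ Δ' : SimplexCategory} (θ : Δ' ⟶ Δ) (φ : Fin (Δ.len + 1) →o E) :
    onSimplex f (φ.comp θ.toOrderHom) =
      (TwoCat.orientalMap (SimplexCategory.toPartOrd.{u}.map θ).hom).comp (onSimplex f φ) :=
  cell_map f θ.op (simplex φ)

theorem onSimplex_comp_ob {Δ Δ' : SimplexCategory} (θ : Δ' ⟶ Δ) (φ : Fin (Δ.len + 1) →o E) (i) :
    (onSimplex f (φ.comp θ.toOrderHom)).atOb ⟨i⟩ = (onSimplex f φ).atOb ⟨θ.toOrderHom i⟩ :=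
  congrArg (fun G => TwoFunctor.atOb G ⟨i⟩) (onSimplex_comp f θ φ)

theorem onSimplex_comp_ar {Δ Δ' : SimplexCategory} (θ : Δ' ⟶ Δ) (φ : Fin (Δ.len + 1) →o E)
    (i j) (h : i ≤ j) (h') :
    (onSimplex f (φ.comp θ.toOrderHom)).atAr (.pair ⟨i⟩ ⟨j⟩ h) =
      (onSimplex f φ).atAr (.pair ⟨θ.toOrderHom i⟩ ⟨θ.toOrderHom j⟩ h') := by
  rw [onSimplex_comp]
  exact congrArg (onSimplex f φ).atAr
    (OrientalArrow.map_pair (SimplexCategory.toPartOrd.{u}.map θ).hom _ _ h)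

theorem _root_.OrientalCell.map_triple {E F : Type u} [PartialOrder E] [PartialOrder F]
    (φ : E →o F) (x y z : E) (h h') :
    (TwoCat.orientalMap φ).atCe (.triple x y z h h') =
      OrientalCell.triple (φ x) (φ y) (φ z) (φ.monotone h) (φ.monotone h') :=
  OrientalCell.ext (OrientalArrow.map_pair _ _ _ (h.trans h'))
    (OrientalArrow.ext ((Set.image_union _ _ _).trans (by
      rw [OrientalArrow.pair_S, OrientalArrow.pair_S, Set.image_pair, Set.image_pair]; rfl)))

theorem onSimplex_comp_ce {Δ Δ' : SimplexCategory} (θ : Δ' ⟶ Δ) (φ : Fin (Δ.len + 1) →o E)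
    (i j k) (h : i ≤ j) (h₁ : j ≤ k) (h' h₁') :
    (onSimplex f (φ.comp θ.toOrderHom)).atCe (.triple ⟨i⟩ ⟨j⟩ ⟨k⟩ h h₁) =
      (onSimplex f φ).atCe
        (.triple ⟨θ.toOrderHom i⟩ ⟨θ.toOrderHom j⟩ ⟨θ.toOrderHom k⟩ h' h₁') := by
  rw [onSimplex_comp]
  exact congrArg (onSimplex f φ).atCe
    (OrientalCell.map_triple (SimplexCategory.toPartOrd.{u}.map θ).hom _ _ _ h h₁)

/-- The `0`-simplex attached to a point. -/
def point {X : Type*} [Preorder X] (x : X) : Fin 1 →o X := ⟨fun _ => x, fun _ _ _ => le_rfl⟩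

/-- The `1`-simplex attached to `x ≤ y`. -/
def edge {X : Type*} [Preorder X] (x y : X) (h : x ≤ y) : Fin 2 →o X :=
  ⟨![x, y], Fin.monotone_iff_le_succ.2 fun i => by fin_cases i; exact h⟩

/-- The `2`-simplex attached to `x ≤ y ≤ z`. -/
def triangle {X : Type*} [Preorder X] (x y z : X) (h : x ≤ y) (h' : y ≤ z) : Fin 3 →o X :=
  ⟨![x, y, z], Fin.monotone_iff_le_succ.2 fun i => by fin_cases i; exacts [h, h']⟩

/-- The `3`-simplex attached to `x ≤ y ≤ z ≤ w`. -/
def tetrahedron {X : Type*} [Preorder X] (x y z w : X) (h : x ≤ y) (h' : y ≤ z) (h'' : z ≤ w) :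
    Fin 4 →o X :=
  ⟨![x, y, z, w], Fin.monotone_iff_le_succ.2 fun i => by fin_cases i; exacts [h, h', h'']⟩

/-- A monotone map from `Fin n`, seen on the universe lift. -/
def ulift {n : ℕ} {X : Type u} [Preorder X] (φ : Fin n →o X) : ULift.{u} (Fin n) →o X :=
  ⟨fun k => φ k.down, fun _ _ h => φ.monotone h⟩

/-- The value of `f` at a vertex. -/
def vert (x : E) : D.Ob := (onSimplex f (Δ := .mk 0) (point x)).atOb ⟨0⟩

open Classical in
/-- The value of `f` at an edge. -/
noncomputable def arr (x y : E) : D.Ar :=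
  if h : x ≤ y then (onSimplex f (Δ := .mk 1) (edge x y h)).atAr
    (.pair ⟨(0 : Fin 2)⟩ ⟨(1 : Fin 2)⟩ (Fin.zero_le 1)) else D.id₁ (vert f x)

open Classical in
/-- The value of `f` at a triangle. -/
noncomputable def tri (x y z : E) : D.Ce :=
  if h : x ≤ y ∧ y ≤ z then (onSimplex f (Δ := .mk 2) (triangle x y z h.1 h.2)).atCe
    (.triple ⟨(0 : Fin 3)⟩ ⟨(1 : Fin 3)⟩ ⟨(2 : Fin 3)⟩ (Fin.zero_le 1) (Fin.le_last _))
  else D.id₂ (D.id₁ (vert f x))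

/-- Naturality of `f` along the inclusion of a vertex of `Δ_m`. With the next two statements, it
shows that the values of `f` on vertices, edges and triangles govern its value on every simplex. -/
theorem vert_eq {Δ : SimplexCategory} (φ : Fin (Δ.len + 1) →o E) (i) :
    vert f (φ i) = (onSimplex f φ).atOb ⟨i⟩ :=
  onSimplex_comp_ob f (Δ' := .mk 0) (SimplexCategory.Hom.mk (point i)) φ 0

theorem arr_eq {Δ : SimplexCategory} (φ : Fin (Δ.len + 1) →o E) (i j) (h : i ≤ j) :
    arr f (φ i) (φ j) = (onSimplex f φ).atAr (.pair ⟨i⟩ ⟨j⟩ h) := by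
  rw [arr, dif_pos (φ.monotone h)]
  have : edge (φ i) (φ j) (φ.monotone h) = φ.comp (edge i j h) := by
    ext k; fin_cases k <;> rfl
  rw [this]
  exact onSimplex_comp_ar f (Δ' := .mk 1) (SimplexCategory.Hom.mk (edge i j h)) φ 0 1 _ _

theorem tri_eq {Δ : SimplexCategory} (φ : Fin (Δ.len + 1) →o E) (i j k) (h : i ≤ j) (h' : j ≤ k) :
    tri f (φ i) (φ j) (φ k) = (onSimplex f φ).atCe (.triple ⟨i⟩ ⟨j⟩ ⟨k⟩ h h') := by
  rw [tri, dif_pos ⟨φ.monotone h, φ.monotone h'⟩]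
  have : triangle (φ i) (φ j) (φ k) (φ.monotone h) (φ.monotone h') =
      φ.comp (triangle i j k h h') := by
    ext k; fin_cases k <;> rfl
  rw [this]
  exact onSimplex_comp_ce f (Δ' := .mk 2) (SimplexCategory.Hom.mk (triangle i j k h h')) φ
    0 1 2 _ _ _ _

/-- The normalised oplax 2-functor `E ⟶ D` attached to a morphism `N(E) ⟶ N₂(D)`. -/
noncomputable def diagram : OplaxDiagram E D where
  ob := vert f
  ar := arr f
  con := tri f
  src_ar {x y} h := by
    have h₀ := vert_eq f (Δ := .mk 1) (edge x y h) 0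
    have h₁ := arr_eq f (Δ := .mk 1) (edge x y h) 0 1 (Fin.zero_le 1)
    exact (congrArg D.src h₁).trans ((TwoFunctor.src_atAr _ _).trans h₀.symm)
  tgt_ar {x y} h := by
    have h₀ := vert_eq f (Δ := .mk 1) (edge x y h) 1
    have h₁ := arr_eq f (Δ := .mk 1) (edge x y h) 0 1 (Fin.zero_le 1)
    exact (congrArg D.tgt h₁).trans ((TwoFunctor.tgt_atAr _ _).trans h₀.symm)
  src₂_con {x y z} h h' := by
    have h₀ := arr_eq f (Δ := .mk 2) (triangle x y z h h') 0 2 (Fin.zero_le _)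
    have h₁ := tri_eq f (Δ := .mk 2) (triangle x y z h h') 0 1 2 (Fin.zero_le _) (Fin.le_last _)
    exact (congrArg D.src₂ h₁).trans ((TwoFunctor.src₂_atCe _ _).trans h₀.symm)
  tgt₂_con {x y z} h h' := by
    have h₀ := arr_eq f (Δ := .mk 2) (triangle x y z h h') 0 1 (Fin.zero_le _)
    have h₂ := arr_eq f (Δ := .mk 2) (triangle x y z h h') 1 2 (Fin.le_last _)
    have h₁ := tri_eq f (Δ := .mk 2) (triangle x y z h h') 0 1 2 (Fin.zero_le _) (Fin.le_last _)
    refine (congrArg D.tgt₂ h₁).trans ((TwoFunctor.tgt₂_atCe _ _).trans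
      ((TwoFunctor.atAr_union _ _ _ rfl).trans ?_))
    exact congrArg₂ D.cmp h₂.symm h₀.symm
  ar_self x := by
    have h₀ := vert_eq f (Δ := .mk 0) (point x) 0
    have h₁ := arr_eq f (Δ := .mk 0) (point x) 0 0 le_rfl
    refine h₁.trans (Eq.trans ?_ (congrArg D.id₁ h₀.symm))
    rw [OrientalArrow.pair_self, TwoFunctor.atAr_single]
  con_left {x y} h := by
    have h₀ := arr_eq f (Δ := .mk 1) (edge x y h) 0 1 (Fin.zero_le _)
    have h₁ := tri_eq f (Δ := .mk 1) (edge x y h) 0 0 1 le_rfl (Fin.zero_le _)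
    refine h₁.trans (Eq.trans ?_ (congrArg D.id₂ h₀.symm))
    exact TwoFunctor.atCe_refl _ _ (OrientalArrow.ext (by ext; simp))
  con_right {x y} h := by
    have h₀ := arr_eq f (Δ := .mk 1) (edge x y h) 0 1 (Fin.zero_le _)
    have h₁ := tri_eq f (Δ := .mk 1) (edge x y h) 0 1 1 (Fin.zero_le _) le_rfl
    refine h₁.trans (Eq.trans ?_ (congrArg D.id₂ h₀.symm))
    exact TwoFunctor.atCe_refl _ _ (OrientalArrow.ext (by ext; simp))
  cocycle {x y z w} h h' h'' := by
    -- The value of `f` on the tetrahedron is a strict 2-functor from `O(Δ_3)`, whose restriction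
    -- satisfies the cocycle condition; its vertices, edges and faces are the values already
    -- defined.
    let φ := tetrahedron x y z w h h' h''
    let G := OplaxDiagram.ofFunctor (onSimplex f (Δ := .mk 3) φ)
    have ha (i j : Fin 4) (h : i ≤ j) : arr f (φ i) (φ j) = G.ar ⟨i⟩ ⟨j⟩ :=
      (arr_eq f (Δ := .mk 3) φ i j h).trans (OplaxDiagram.ofFunctor_ar
        (onSimplex f (Δ := .mk 3) φ) (x := ⟨i⟩) (y := ⟨j⟩) h).symm
    have hc (i j k : Fin 4) (h : i ≤ j) (h' : j ≤ k) :
        tri f (φ i) (φ j) (φ k) = G.con ⟨i⟩ ⟨j⟩ ⟨k⟩ :=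
      (tri_eq f (Δ := .mk 3) φ i j k h h').trans (OplaxDiagram.ofFunctor_con (onSimplex f (Δ := .mk 3) φ)
        (x := ⟨i⟩) (y := ⟨j⟩) (z := ⟨k⟩) h h').symm
    have h01 : (0 : Fin 4) ≤ 1 := by decide
    have h12 : (1 : Fin 4) ≤ 2 := by decide
    have h23 : (2 : Fin 4) ≤ 3 := by decide
    have key := G.cocycle (x := ⟨0⟩) (y := ⟨1⟩) (z := ⟨2⟩) (w := ⟨3⟩) h01 h12 h23
    rw [← ha _ _ h23, ← ha _ _ h01, ← hc _ _ _ h01 h12, ← hc _ _ _ h12 h23,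
      ← hc _ _ _ (h01.trans h12) h23, ← hc _ _ _ h01 (h12.trans h23)] at key
    exact key

/-- Existence in the universal property of `O(E)`. On each simplex, two strict 2-functors from an
oriental are compared, and their generators are enough. -/
theorem posetNerveToNerve₂_toFunctor :
    posetNerveToNerve₂ E ≫ nerve₂.map (diagram f).toFunctor = f := by
  ext ⟨Δ⟩ σ
  obtain ⟨φ, rfl⟩ := exists_simplex σ
  change (TwoCat.orientalMap (ulift φ)).comp (diagram f).toFunctor = onSimplex f φ
  refine TwoFunctor.oriental_ext ?_ ?_ ?_
  · rintro ⟨i⟩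
    exact vert_eq f φ i
  · rintro ⟨i⟩ ⟨j⟩ h
    refine Eq.trans ?_ (arr_eq f φ i j h)
    refine Eq.trans ?_ ((diagram f).toFunctor_pair (φ i) (φ j) (φ.monotone h))
    exact congrArg (diagram f).toFunctor.atAr (OrientalArrow.map_pair _ _ _ h)
  · rintro ⟨i⟩ ⟨j⟩ ⟨k⟩ h h'
    refine Eq.trans ?_ (tri_eq f φ i j k h h')
    refine Eq.trans ?_ ((diagram f).toFunctor_triple (φ i) (φ j) (φ k) (φ.monotone h)
      (φ.monotone h'))
    exact congrArg (diagram f).toFunctor.atCe (OrientalCell.map_triple _ _ _ _ h h')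

/-- Uniqueness in the universal property: every generator of `O(E)` comes from a point, an edge or a
triangle of `N(E)`. -/
theorem hom_ext_of_posetNerveToNerve₂ {G G' : orientalFunctor.obj E ⟶ D}
    (h : posetNerveToNerve₂ E ≫ nerve₂.map G = posetNerveToNerve₂ E ≫ nerve₂.map G') : G = G' := by
  have key {Δ : SimplexCategory} (φ : Fin (Δ.len + 1) →o E) :
      TwoFunctor.comp (TwoCat.orientalMap (ulift φ)) G =
        TwoFunctor.comp (TwoCat.orientalMap (ulift φ)) G' :=
    ConcreteCategory.congr_hom (NatTrans.congr_app h (op Δ)) (simplex φ)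
  refine TwoFunctor.oriental_ext ?_ ?_ ?_
  · intro x
    exact congrArg (fun G => TwoFunctor.atOb G ⟨0⟩) (key (Δ := .mk 0) (point x))
  · intro x y h
    have := congrArg (fun G => TwoFunctor.atAr G (.pair ⟨0⟩ ⟨1⟩ (Fin.zero_le 1)))
      (key (Δ := .mk 1) (edge x y h))
    have e := OrientalArrow.map_pair (ulift.{u} (edge x y h)) ⟨0⟩ ⟨1⟩ (Fin.zero_le 1)
    exact (congrArg G.atAr e).symm.trans (this.trans (congrArg G'.atAr e))
  · intro x y z h h'
    have := congrArg (fun G => TwoFunctor.atCe G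
        (.triple ⟨0⟩ ⟨1⟩ ⟨2⟩ (Fin.zero_le 1) (Fin.le_last 1)))
      (key (Δ := .mk 2) (triangle x y z h h'))
    have e := OrientalCell.map_triple (ulift.{u} (triangle x y z h h')) ⟨0⟩ ⟨1⟩ ⟨2⟩
      (Fin.zero_le 1) (Fin.le_last 1)
    exact (congrArg G.atCe e).symm.trans (this.trans (congrArg G'.atCe e))

end PosetNerve

/-! ### The isomorphism between `c₂N(E)` and `O(E)` -/

theorem posetNerveToNerve₂_naturality {E E' : PartOrd.{u}} (φ : E' ⟶ E) :
    posetNerve.map φ ≫ posetNerveToNerve₂ E =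
      posetNerveToNerve₂ E' ≫ nerve₂.map (orientalFunctor.map φ) := by
  ext ⟨Δ⟩ σ
  exact orientalFunctor.map_comp (simplexToHom (E := E') σ) φ

theorem homEquiv_comparison (E : PartOrd.{u}) :
    c₂Adj.homEquiv _ _ (comparison E) = posetNerveToNerve₂ E :=
  Equiv.apply_symm_apply _ _

/-- The inverse of the comparison 2-functor. -/
noncomputable def comparisonInv (E : PartOrd.{u}) : orientalFunctor.obj E ⟶ c₂N.obj E :=
  (PosetNerve.diagram (c₂Adj.unit.app (posetNerve.obj E))).toFunctor

theorem posetNerveToNerve₂_comparisonInv (E : PartOrd.{u}) :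
    posetNerveToNerve₂ E ≫ nerve₂.map (comparisonInv E) = c₂Adj.unit.app (posetNerve.obj E) :=
  PosetNerve.posetNerveToNerve₂_toFunctor _

/-- Both 2-categories represent `D ↦ Hom(N(E), N₂(D))`. After transposition the composite becomes
the unit of the adjunction, like the identity. -/
theorem comparison_comparisonInv (E : PartOrd.{u}) : comparison E ≫ comparisonInv E = 𝟙 _ := by
  apply (c₂Adj.homEquiv (posetNerve.obj E) _).injective
  refine (c₂Adj.homEquiv_naturality_right (comparison E) (comparisonInv E)).trans ?_
  refine (congrArg (· ≫ nerve₂.map (comparisonInv E)) (homEquiv_comparison E)).trans ?_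
  exact (posetNerveToNerve₂_comparisonInv E).trans (c₂Adj.homEquiv_id _).symm

theorem comparisonInv_comparison (E : PartOrd.{u}) : comparisonInv E ≫ comparison E = 𝟙 _ := by
  apply PosetNerve.hom_ext_of_posetNerveToNerve₂
  rw [Functor.map_comp, ← Category.assoc, posetNerveToNerve₂_comparisonInv, nerve₂.map_id,
    Category.comp_id]
  exact (c₂Adj.homEquiv_unit (f := comparison E)).symm.trans (homEquiv_comparison E)

instance (E : PartOrd.{u}) : IsIso (comparison E) :=
  ⟨comparisonInv E, comparison_comparisonInv E, comparisonInv_comparison E⟩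

theorem comparison_naturality {E E' : PartOrd.{u}} (φ : E' ⟶ E) :
    c₂N.map φ ≫ comparison E = comparison E' ≫ orientalFunctor.map φ := by
  apply (c₂Adj.homEquiv (posetNerve.obj E') _).injective
  refine (c₂Adj.homEquiv_naturality_left (posetNerve.map φ) (comparison E)).trans ?_
  refine (congrArg (posetNerve.map φ ≫ ·) (homEquiv_comparison E)).trans ?_
  refine (posetNerveToNerve₂_naturality φ).trans ?_
  refine (congrArg (· ≫ nerve₂.map (orientalFunctor.map φ)) (homEquiv_comparison E')).symm.trans ?_
  exact (c₂Adj.homEquiv_naturality_right (comparison E') (orientalFunctor.map φ)).symm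

/-! ## Locally posetal targets -/

/-- A 2-category is thin if parallel 2-cells are equal. -/
def TwoCat.IsThin (D : TwoCat.{u}) : Prop :=
  ∀ α β : D.Ce, D.src₂ α = D.src₂ β → D.tgt₂ α = D.tgt₂ β → α = β

namespace OplaxTwoFunctor

variable {C D : TwoCat.{u}}

/-- A normalised oplax 2-functor to a thin 2-category is given by its values on objects and
1-cells, as soon as the required 2-cells exist. -/
noncomputable def ofThin (hD : D.IsThin) (ob : C.Ob → D.Ob) (ar : C.Ar → D.Ar)
    (src_ar : ∀ f, D.src (ar f) = ob (C.src f)) (tgt_ar : ∀ f, D.tgt (ar f) = ob (C.tgt f))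
    (ar_id₁ : ∀ x, ar (C.id₁ x) = D.id₁ (ob x))
    (ce : ∀ α, ∃ c, D.src₂ c = ar (C.src₂ α) ∧ D.tgt₂ c = ar (C.tgt₂ α))
    (con : ∀ g f h, ∃ c, D.src₂ c = ar (C.comp₁ g f h) ∧ D.tgt₂ c = D.cmp (ar g) (ar f)) :
    OplaxTwoFunctor C D where
  ob := ob
  ar := ar
  ce α := (ce α).choose
  con g f h := (con g f h).choose
  src_ar := src_ar
  tgt_ar := tgt_ar
  src₂_ce α := (ce α).choose_spec.1
  tgt₂_ce α := (ce α).choose_spec.2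
  src₂_con g f h := (con g f h).choose_spec.1
  tgt₂_con g f h h' := by rw [(con g f h).choose_spec.2, TwoCat.cmp_eq h']
  ar_id₁ := ar_id₁
  con_id_left f h := hD _ _
    (by rw [(con _ _ h).choose_spec.1, D.src₂_id₂, C.id_comp₁])
    (by rw [(con _ _ h).choose_spec.2, D.tgt₂_id₂, ar_id₁, TwoCat.id_cmp (tgt_ar f)])
  con_id_right f h := hD _ _
    (by rw [(con _ _ h).choose_spec.1, D.src₂_id₂, C.comp_id₁])
    (by rw [(con _ _ h).choose_spec.2, D.tgt₂_id₂, ar_id₁, TwoCat.cmp_id (src_ar f)])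
  cocycle h g f hg gf h₁ h₂ h₃ h₄ h₅ h₆ := by
    have e₁ : D.src (ar h) = D.tgt (ar g) := by rw [src_ar, tgt_ar, hg]
    have e₂ : D.src (ar g) = D.tgt (ar f) := by rw [src_ar, tgt_ar, gf]
    refine hD _ _ ?_ ?_
    · rw [D.src₂_vcomp, D.src₂_vcomp, (con _ _ _).choose_spec.1, (con _ _ _).choose_spec.1,
        C.assoc₁ h g f hg gf]
    · rw [D.tgt₂_vcomp, D.tgt₂_vcomp, ← TwoCat.hc_eq h₁, ← TwoCat.hc_eq h₄, TwoCat.tgt₂_hc h₁,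
        TwoCat.tgt₂_hc h₄, (con _ _ _).choose_spec.2, (con _ _ _).choose_spec.2, D.tgt₂_id₂,
        D.tgt₂_id₂, TwoCat.cmp_assoc e₁ e₂]
  ce_vcomp β α h h' := hD _ _
    (by rw [D.src₂_vcomp, (ce _).choose_spec.1, (ce _).choose_spec.1, C.src₂_vcomp])
    (by rw [D.tgt₂_vcomp, (ce _).choose_spec.2, (ce _).choose_spec.2, C.tgt₂_vcomp])
  ce_id₂ f := hD _ _ (by rw [(ce _).choose_spec.1, C.src₂_id₂, D.src₂_id₂])
    (by rw [(ce _).choose_spec.2, C.tgt₂_id₂, D.tgt₂_id₂])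
  ce_hcomp β α h h₁ h₂ h₃ h₄ := hD _ _
    (by rw [D.src₂_vcomp, D.src₂_vcomp, (ce _).choose_spec.1, (con _ _ _).choose_spec.1,
      C.src₂_hcomp])
    (by rw [D.tgt₂_vcomp, D.tgt₂_vcomp, (con _ _ _).choose_spec.2, ← TwoCat.hc_eq h₃,
      TwoCat.tgt₂_hc h₃, (ce _).choose_spec.2, (ce _).choose_spec.2])

/-- The sources and targets of the remaining data are prescribed by the values on 1-cells, and
thinness leaves no further choice. -/
theorem ext_of_isThin (hD : D.IsThin) {F G : OplaxTwoFunctor C D} (hob : F.ob = G.ob)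
    (har : F.ar = G.ar) : F = G := by
  refine OplaxTwoFunctor.ext hob har (funext fun α => hD _ _ ?_ ?_)
    (funext fun g => funext fun f => funext fun h => hD _ _ ?_ ?_)
  · rw [F.src₂_ce, G.src₂_ce, har]
  · rw [F.tgt₂_ce, G.tgt₂_ce, har]
  · rw [F.src₂_con, G.src₂_con, har]
  · rw [F.tgt₂_con g f h (by rw [F.src_ar, F.tgt_ar, h]),
      G.tgt₂_con g f h (by rw [G.src_ar, G.tgt_ar, h])]
    simp only [har]

end OplaxTwoFunctor

/-! ## Sieves of posets -/

/-- The data of a sieve of posets `i`, seen as a lower set, with a retraction `r` which is right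
adjoint to `i`. -/
structure IsRetractSieve {E' E : Type u} [PartialOrder E'] [PartialOrder E] (i : E' →o E)
    (r : E →o E') : Prop where
  ri : ∀ y, r (i y) = y
  ir_le : ∀ x, i (r x) ≤ x
  lower : ∀ x y, x ≤ i y → i (r x) = x

/-- The counit of the adjunction gives `ir ≤ 1`. If `x ≤ i y`, then `χ x ≤ χ (i y) = 0`, so the
point `x` lifts to the pullback `E'`, and `ir` fixes the image of `i`. -/
theorem IsPosetSieve.isRetractSieve {E' E : PartOrd.{u}} {i : E' ⟶ E} (hi : IsPosetSieve i)
    {r : E ⟶ E'} (hr : i ≫ r = 𝟙 E') (hadj : GaloisConnection i r) :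
    IsRetractSieve i.hom r.hom := by
  obtain ⟨t, χ, h⟩ := hi
  have ri (y) : r (i y) = y := ConcreteCategory.congr_hom hr y
  have hw (y) : χ (i y) = ULift.up 0 := ConcreteCategory.congr_hom h.w y
  refine ⟨ri, hadj.l_u_le, fun x y hxy => ?_⟩
  have hx : χ x = ULift.up 0 := by
    have h₁ : χ x ≤ χ (i y) := χ.hom.monotone hxy
    rw [hw] at h₁
    exact le_antisymm h₁ (Fin.zero_le (χ x).down)
  let k : posetPt.{u} ⟶ E := PartOrd.ofHom ⟨fun _ => x, fun _ _ _ => le_rfl⟩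
  have hk : k ≫ χ = 𝟙 _ ≫ posetEnd 0 := by
    exact PartOrd.hom_ext (OrderHom.ext _ _ (funext fun _ => hx))
  have e : i (h.lift k (𝟙 _) hk (ULift.up 0)) = x :=
    ConcreteCategory.congr_hom (h.lift_fst k (𝟙 _) hk) (ULift.up 0)
  rw [← e]
  exact congrArg i (ri _)

namespace IsRetractSieve

variable {E' E : Type u} [PartialOrder E'] [PartialOrder E] {i : E' →o E} {r : E →o E'}

/-- Every element of the chain lies below its maximum, which `ir` fixes; so it belongs to `E'` and
is fixed as well. -/
theorem map_eq (h : IsRetractSieve i r) (a : OrientalArrow E) (ha : i (r a.max) = a.max) :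
    (a.map r).map i = a := by
  refine OrientalArrow.ext ?_
  rw [OrientalArrow.map_S, OrientalArrow.map_S, Set.image_image]
  refine (Set.image_congr fun x hx => ?_).trans (Set.image_id _)
  exact h.lower x (r a.max) (by rw [ha]; exact a.isGreatest.2 hx)

theorem i_r_of_mem (h : IsRetractSieve i r) {x : E} (hx : x ∈ Set.range i) : i (r x) = x := by
  obtain ⟨y, rfl⟩ := hx
  rw [h.ri]

/-- The chain `{i(r(min S)), max S} ∪ (S ∩ E')`. -/
@[simps]
def homotopyArrow (h : IsRetractSieve i r) (a : OrientalArrow E) : OrientalArrow E where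
  S := {i (r a.min), a.max} ∪ (a.S ∩ Set.range i)
  finite := ((Set.finite_singleton _).insert _).union (a.finite.subset Set.inter_subset_left)
  chain := by
    -- Since `i (r a.min) ≤ a.min`, adding this point to the chain keeps it a chain, and everything
    -- takes place inside it.
    have hl : IsChain (· ≤ ·) (insert (i (r a.min)) a.S) :=
      a.chain.insert fun x hx _ => Or.inl ((h.ir_le _).trans (a.isLeast.2 hx))
    refine hl.mono (Set.union_subset ?_ ?_)
    · rintro x (rfl | rfl)
      exacts [Or.inl rfl, Or.inr a.isGreatest.1]
    · exact fun x hx => Or.inr hx.1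
  min := i (r a.min)
  max := a.max
  isLeast := ⟨Or.inl (Or.inl rfl), by
    rintro x ((rfl | rfl) | hx)
    exacts [le_rfl, (h.ir_le _).trans a.min_le_max, (h.ir_le _).trans (a.isLeast.2 hx.1)]⟩
  isGreatest := ⟨Or.inl (Or.inr rfl), by
    rintro x ((rfl | rfl) | hx)
    exacts [(h.ir_le _).trans a.min_le_max, le_rfl, a.isGreatest.2 hx.1]⟩

/-- The chain `i(r(S))`. -/
@[simps!]
def retractArrow (_ : IsRetractSieve i r) (a : OrientalArrow E) : OrientalArrow E := a.map (i.comp r)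

theorem homotopyArrow_mono (h : IsRetractSieve i r) {a b : OrientalArrow E} (hab : a.S ⊆ b.S)
    (hmin : a.min = b.min) (hmax : a.max = b.max) :
    (h.homotopyArrow a).S ⊆ (h.homotopyArrow b).S := by
  rw [homotopyArrow_S, homotopyArrow_S, hmin, hmax]
  exact Set.union_subset_union_right _ (Set.inter_subset_inter_left _ hab)

/-- The constraint of the homotopy for the factorisation of `(0 → 1, gf)` as `(0 → 1, g)(0, f)`,
with `g = b` and `f = a`. -/
theorem homotopyArrow_union_subset (h : IsRetractSieve i r) (b a : OrientalArrow E)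
    (hba : b.min = a.max) :
    (h.homotopyArrow (b.union a hba)).S ⊆ (h.homotopyArrow b).S ∪ (h.retractArrow a).S := by
  rintro x ((rfl | rfl) | ⟨hx | hx, hx'⟩)
  · exact Or.inr ⟨a.min, a.isLeast.1, rfl⟩
  · exact Or.inl (Or.inl (Or.inr rfl))
  · exact Or.inl (Or.inr ⟨hx, hx'⟩)
  · exact Or.inr ⟨x, hx, h.i_r_of_mem hx'⟩

/-- The constraint for the other factorisation, `(1, g)(0 → 1, f)`. -/
theorem homotopyArrow_union_subset' (h : IsRetractSieve i r) (b a : OrientalArrow E)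
    (hba : b.min = a.max) :
    (h.homotopyArrow (b.union a hba)).S ⊆ b.S ∪ (h.homotopyArrow a).S := by
  rintro x ((rfl | rfl) | ⟨hx | hx, hx'⟩)
  · exact Or.inr (Or.inl (Or.inl rfl))
  · exact Or.inl b.isGreatest.1
  · exact Or.inl hx
  · exact Or.inr (Or.inr ⟨hx, hx'⟩)

/-- Condition 2 of a strong retract. When `a` is a chain of `E'`, so is its maximum `b.min`; hence
`ir` fixes both `a` and `b.min`, and no point is added on the right. -/
theorem homotopyArrow_union (h : IsRetractSieve i r) (b a : OrientalArrow E)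
    (hba : b.min = a.max) (ha : a.S ⊆ Set.range i) :
    (h.homotopyArrow (b.union a hba)).S = (h.homotopyArrow b).S ∪ (h.retractArrow a).S := by
  refine (h.homotopyArrow_union_subset b a hba).antisymm ?_
  rintro x (((rfl | rfl) | hx) | ⟨x, hx, rfl⟩)
  · rw [hba, h.i_r_of_mem (ha a.isGreatest.1)]
    exact Or.inr ⟨Or.inr a.isGreatest.1, ha a.isGreatest.1⟩
  · exact Or.inl (Or.inr rfl)
  · exact Or.inr ⟨Or.inl hx.1, hx.2⟩
  · change i (r x) ∈ _
    rw [h.i_r_of_mem (ha hx)]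
    exact Or.inr ⟨Or.inr hx, ha hx⟩

theorem homotopyArrow_of_subset (h : IsRetractSieve i r) (a : OrientalArrow E)
    (ha : a.S ⊆ Set.range i) : h.homotopyArrow a = a := by
  refine OrientalArrow.ext (Set.Subset.antisymm ?_ fun x hx => Or.inr ⟨hx, ha hx⟩)
  rintro x ((rfl | rfl) | hx)
  · rw [h.i_r_of_mem (ha a.isLeast.1)]
    exact a.isLeast.1
  · exact a.isGreatest.1
  · exact hx.1

theorem retractArrow_of_subset (h : IsRetractSieve i r) (a : OrientalArrow E)
    (ha : a.S ⊆ Set.range i) : h.retractArrow a = a :=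
  OrientalArrow.ext ((Set.image_congr fun _ hx => h.i_r_of_mem (ha hx)).trans (Set.image_id _))

/-- If the chain meets `E'`, its minimum lies below a point of `E'`. So `ir` fixes the minimum,
which is already counted in the intersection. If not, the intersection contributes nothing. -/
theorem homotopyArrow_S_eq {E' E : PartOrd.{u}} {i : E' ⟶ E} {r : E ⟶ E'}
    (h : IsRetractSieve i.hom r.hom) (a : OrientalArrow E) :
    (h.homotopyArrow a).S = homotopyChain i r a := by
  unfold homotopyChain
  split_ifs with ha
  · exact (congrArg _ ha).trans (Set.union_empty _)
  · obtain ⟨x, hx, y, hy⟩ := Set.nonempty_iff_ne_empty.2 ha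
    have hm : i (r a.min) = a.min :=
      h.lower _ y ((a.isLeast.2 hx).trans_eq hy.symm)
    refine Set.Subset.antisymm ?_ ?_
    · rintro x ((rfl | rfl) | hx)
      · exact Or.inl ⟨(congrArg (· ∈ a.S) hm).mpr a.isLeast.1, Set.mem_range_self _⟩
      · exact Or.inr rfl
      · exact Or.inl hx
    · rintro x (hx | rfl)
      exacts [Or.inr hx, Or.inl (Or.inr rfl)]

end IsRetractSieve

/-! ## The oplax deformation retract structure -/

namespace IsRetractSieve

section

variable {E' E : Type u} [PartialOrder E'] [PartialOrder E] {i : E' →o E} {r : E →o E'}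

/-- The value of the homotopy at an object. -/
def htpyOb (_ : IsRetractSieve i r) (ε : Fin 2) (x : E) : E := if ε = 0 then i (r x) else x

/-- The value of the homotopy at a 1-cell. -/
def htpyAr (h : IsRetractSieve i r) (ε δ : Fin 2) (a : OrientalArrow E) : OrientalArrow E :=
  if δ = 0 then h.retractArrow a else if ε = 0 then h.homotopyArrow a else a

theorem htpyAr_min (h : IsRetractSieve i r) {ε δ : Fin 2} (hε : ε ≤ δ) (a : OrientalArrow E) :
    (h.htpyAr ε δ a).min = h.htpyOb ε a.min := by
  unfold htpyAr htpyOb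
  split_ifs with h₁ h₂ h₂
  · rfl
  · subst h₁; exact absurd (Fin.le_zero_iff.1 hε) h₂
  · rfl
  · rfl

theorem htpyAr_max (h : IsRetractSieve i r) {ε δ : Fin 2} (a : OrientalArrow E) :
    (h.htpyAr ε δ a).max = h.htpyOb δ a.max := by
  unfold htpyAr htpyOb
  split_ifs <;> rfl

theorem htpyAr_single (h : IsRetractSieve i r) (ε : Fin 2) (x : E) :
    h.htpyAr ε ε (.single x) = .single (h.htpyOb ε x) := by
  unfold htpyAr htpyOb
  split_ifs
  · exact OrientalArrow.ext Set.image_singleton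
  · rfl

theorem htpyAr_mono (h : IsRetractSieve i r) (ε δ : Fin 2) (c : OrientalCell E) :
    (h.htpyAr ε δ c.dom).S ⊆ (h.htpyAr ε δ c.cod).S := by
  unfold htpyAr
  split_ifs
  · exact Set.image_mono c.le
  · exact h.homotopyArrow_mono c.le c.min_eq c.max_eq
  · exact c.le

theorem htpyAr_union (h : IsRetractSieve i r) {ε δ η : Fin 2} (h₁ : ε ≤ δ) (h₂ : δ ≤ η)
    (b a : OrientalArrow E) (hba : b.min = a.max) :
    (h.htpyAr ε η (b.union a hba)).S ⊆ (h.htpyAr δ η b).S ∪ (h.htpyAr ε δ a).S := by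
  unfold htpyAr
  split_ifs
  · exact (Set.image_union _ _ _).subset
  -- The surviving values of `(ε, δ, η)` are `(0, 0, 1)`, `(0, 1, 1)` and `(1, 1, 1)`; the others
  -- contradict `h₁` or `h₂`.
  all_goals first
    | exact h.homotopyArrow_union_subset _ _ _
    | exact h.homotopyArrow_union_subset' _ _ _
    | exact subset_rfl
    | (simp [*] at h₁; done)
    | simp [*] at h₂

/-- Condition 1 of a strong retract: the homotopy is constant on `E'`. -/
theorem htpyAr_of_subset (h : IsRetractSieve i r) (ε δ : Fin 2) (a : OrientalArrow E)
    (ha : a.S ⊆ Set.range i) : h.htpyAr ε δ a = a := by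
  unfold htpyAr
  split_ifs
  · exact h.retractArrow_of_subset a ha
  · exact h.homotopyArrow_of_subset a ha
  · rfl

end

end IsRetractSieve

/-! ### Objects and cells of `c₂N(E)` read as elements and chains of `E` -/

namespace PosetNerve

variable (E : PartOrd.{u})

/-- The element of `E` corresponding to an object of `c₂N(E)`. -/
noncomputable def elem (x : (c₂N.obj E).Ob) : E := (comparison E).ob x

/-- The chain of `E` corresponding to a 1-cell of `c₂N(E)`. -/
noncomputable def chain (f : (c₂N.obj E).Ar) : OrientalArrow E := (comparison E).ar f

/-- The inclusion of chains corresponding to a 2-cell of `c₂N(E)`. -/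
noncomputable def incl (α : (c₂N.obj E).Ce) : OrientalCell E := (comparison E).ce α

/-- The object of `c₂N(E)` corresponding to an element of `E`. -/
noncomputable def ofElem (x : E) : (c₂N.obj E).Ob := TwoFunctor.atOb (comparisonInv E) x

/-- The 1-cell of `c₂N(E)` corresponding to a chain of `E`. -/
noncomputable def ofChain (a : OrientalArrow E) : (c₂N.obj E).Ar :=
  TwoFunctor.atAr (comparisonInv E) a

/-- The 2-cell of `c₂N(E)` corresponding to an inclusion of chains. -/
noncomputable def ofIncl (c : OrientalCell E) : (c₂N.obj E).Ce :=
  TwoFunctor.atCe (comparisonInv E) c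

variable {E}

theorem ofElem_elem (x : (c₂N.obj E).Ob) : ofElem E (elem E x) = x :=
  congrFun (congrArg TwoFunctor.ob (comparison_comparisonInv E)) x

theorem ofChain_chain (f : (c₂N.obj E).Ar) : ofChain E (chain E f) = f :=
  congrFun (congrArg TwoFunctor.ar (comparison_comparisonInv E)) f

theorem ofIncl_incl (α : (c₂N.obj E).Ce) : ofIncl E (incl E α) = α :=
  congrFun (congrArg TwoFunctor.ce (comparison_comparisonInv E)) α

theorem elem_ofElem (x : E) : elem E (ofElem E x) = x :=
  congrFun (congrArg TwoFunctor.ob (comparisonInv_comparison E)) x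

theorem chain_ofChain (a : OrientalArrow E) : chain E (ofChain E a) = a :=
  congrFun (congrArg TwoFunctor.ar (comparisonInv_comparison E)) a

theorem chain_min (f : (c₂N.obj E).Ar) : (chain E f).min = elem E ((c₂N.obj E).src f) :=
  (comparison E).src_ar f

theorem chain_max (f : (c₂N.obj E).Ar) : (chain E f).max = elem E ((c₂N.obj E).tgt f) :=
  (comparison E).tgt_ar f

theorem incl_dom (α : (c₂N.obj E).Ce) : (incl E α).dom = chain E ((c₂N.obj E).src₂ α) :=
  (comparison E).src₂_ce α

theorem incl_cod (α : (c₂N.obj E).Ce) : (incl E α).cod = chain E ((c₂N.obj E).tgt₂ α) :=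
  (comparison E).tgt₂_ce α

theorem chain_id₁ (x : (c₂N.obj E).Ob) : chain E ((c₂N.obj E).id₁ x) = .single (elem E x) :=
  (comparison E).ar_id₁ x

theorem chain_composable {g f : (c₂N.obj E).Ar} (h : (c₂N.obj E).src g = (c₂N.obj E).tgt f) :
    (chain E g).min = (chain E f).max := by
  rw [chain_min, chain_max, h]

theorem chain_comp₁ {g f : (c₂N.obj E).Ar} (h : (c₂N.obj E).src g = (c₂N.obj E).tgt f) :
    chain E ((c₂N.obj E).comp₁ g f h) = (chain E g).union (chain E f) (chain_composable h) :=
  (comparison E).ar_comp₁ g f h (chain_composable h)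

theorem src_ofChain (a : OrientalArrow E) : (c₂N.obj E).src (ofChain E a) = ofElem E a.min :=
  TwoFunctor.src_atAr _ _

theorem tgt_ofChain (a : OrientalArrow E) : (c₂N.obj E).tgt (ofChain E a) = ofElem E a.max :=
  TwoFunctor.tgt_atAr _ _

theorem ofChain_single (x : E) : ofChain E (.single x) = (c₂N.obj E).id₁ (ofElem E x) :=
  TwoFunctor.atAr_single _ _

theorem ofChain_union (b a : OrientalArrow E) (h : b.min = a.max) :
    ofChain E (b.union a h) = (c₂N.obj E).cmp (ofChain E b) (ofChain E a) :=
  TwoFunctor.atAr_union _ _ _ _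

theorem src₂_ofIncl (c : OrientalCell E) : (c₂N.obj E).src₂ (ofIncl E c) = ofChain E c.dom :=
  TwoFunctor.src₂_atCe _ _

theorem tgt₂_ofIncl (c : OrientalCell E) : (c₂N.obj E).tgt₂ (ofIncl E c) = ofChain E c.cod :=
  TwoFunctor.tgt₂_atCe _ _

theorem elem_injective {x y : (c₂N.obj E).Ob} (h : elem E x = elem E y) : x = y := by
  rw [← ofElem_elem x, h, ofElem_elem]

theorem chain_injective {f g : (c₂N.obj E).Ar} (h : chain E f = chain E g) : f = g := by
  rw [← ofChain_chain f, h, ofChain_chain]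

/-- A 2-cell of `O(E)` is determined by its ends; the comparison isomorphism carries this over. -/
theorem isThin : (c₂N.obj E).IsThin := fun α β h h' => by
  rw [← ofIncl_incl α, ← ofIncl_incl β]
  exact congrArg _ (OrientalCell.ext (by rw [incl_dom, h, incl_dom])
    (by rw [incl_cod, h', incl_cod]))

variable {E' : PartOrd.{u}} (φ : E' ⟶ E)

theorem elem_map (x : (c₂N.obj E').Ob) : elem E ((c₂N.map φ).ob x) = φ (elem E' x) :=
  congrFun (congrArg TwoFunctor.ob (comparison_naturality φ)) x

theorem chain_map (f : (c₂N.obj E').Ar) :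
    chain E ((c₂N.map φ).ar f) = (chain E' f).map φ.hom :=
  congrFun (congrArg TwoFunctor.ar (comparison_naturality φ)) f

end PosetNerve

open PosetNerve

theorem PosetNerve.exists_cell {E : PartOrd.{u}} {a b : OrientalArrow E} (hab : a.S ⊆ b.S)
    (hmin : a.min = b.min) (hmax : a.max = b.max) :
    ∃ c, (c₂N.obj E).src₂ c = ofChain E a ∧ (c₂N.obj E).tgt₂ c = ofChain E b :=
  ⟨ofIncl E ⟨a, b, hab, hmin, hmax⟩, src₂_ofIncl _, tgt₂_ofIncl _⟩

/-! ### The homotopy on `c₂N(E)` and the retract structure -/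

namespace IsRetractSieve

variable {E' E : PartOrd.{u}} {i : E' ⟶ E} {r : E ⟶ E'}

theorem exists_htpyCe (h : IsRetractSieve i.hom r.hom) {ε δ : Fin 2} (hε : ε ≤ δ)
    (α : (c₂N.obj E).Ce) :
    ∃ c, (c₂N.obj E).src₂ c = ofChain E (h.htpyAr ε δ (chain E ((c₂N.obj E).src₂ α))) ∧
      (c₂N.obj E).tgt₂ c = ofChain E (h.htpyAr ε δ (chain E ((c₂N.obj E).tgt₂ α))) := by
  rw [← incl_dom, ← incl_cod]
  refine exists_cell (h.htpyAr_mono _ _ _) ?_ ?_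
  · rw [h.htpyAr_min hε, h.htpyAr_min hε, (incl E α).min_eq]
  · rw [h.htpyAr_max, h.htpyAr_max, (incl E α).max_eq]

theorem htpyAr_composable (h : IsRetractSieve i.hom r.hom) {ε δ η : Fin 2} (h₂ : δ ≤ η)
    {g f : (c₂N.obj E).Ar} (k : (c₂N.obj E).src g = (c₂N.obj E).tgt f) :
    (h.htpyAr δ η (chain E g)).min = (h.htpyAr ε δ (chain E f)).max := by
  rw [h.htpyAr_min h₂, h.htpyAr_max, chain_composable k]

/-- The indices `δ'` and `δ` are kept distinct because composability in `Δ₁ × c₂N(E)` provides their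
equality only as a hypothesis. -/
theorem exists_htpyCon (h : IsRetractSieve i.hom r.hom) {ε δ δ' η : Fin 2} (h₁ : ε ≤ δ)
    (h₂ : δ' ≤ η) (hδ : δ' = δ) (g f : (c₂N.obj E).Ar)
    (k : (c₂N.obj E).src g = (c₂N.obj E).tgt f) :
    ∃ c, (c₂N.obj E).src₂ c = ofChain E (h.htpyAr ε η (chain E ((c₂N.obj E).comp₁ g f k))) ∧
      (c₂N.obj E).tgt₂ c = (c₂N.obj E).cmp (ofChain E (h.htpyAr δ' η (chain E g)))
        (ofChain E (h.htpyAr ε δ (chain E f))) := by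
  subst hδ
  rw [chain_comp₁ k, ← ofChain_union _ _ (h.htpyAr_composable h₂ k)]
  refine exists_cell (h.htpyAr_union h₁ h₂ _ _ _) ?_ ?_
  · rw [h.htpyAr_min (h₁.trans h₂), OrientalArrow.union_min, OrientalArrow.union_min,
      h.htpyAr_min h₁]
  · rw [h.htpyAr_max, OrientalArrow.union_max, OrientalArrow.union_max, h.htpyAr_max]

/-- Condition 2 transported to `c₂N(E)`. It gives the equality of 1-cells directly, and that of the
constraint with an identity by thinness. -/
theorem ofChain_htpyAr_comp₁ (h : IsRetractSieve i.hom r.hom) (g f : (c₂N.obj E).Ar)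
    (k : (c₂N.obj E).src g = (c₂N.obj E).tgt f) (hf : (chain E f).S ⊆ Set.range i.hom) :
    ofChain E (h.htpyAr 0 1 (chain E ((c₂N.obj E).comp₁ g f k))) =
      (c₂N.obj E).cmp (ofChain E (h.htpyAr 0 1 (chain E g)))
        (ofChain E (h.htpyAr 0 0 (chain E f))) := by
  rw [chain_comp₁ k, ← ofChain_union _ _ (h.htpyAr_composable (Fin.zero_le 1) k)]
  exact congrArg _ (OrientalArrow.ext (h.homotopyArrow_union _ _ _ hf))

/-- The oplax homotopy from `c₂N(ir)` to the identity. -/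
noncomputable def oplax (h : IsRetractSieve i.hom r.hom) :
    OplaxTwoFunctor (TwoCat.prod TwoCat.I (c₂N.obj E)) (c₂N.obj E) :=
  OplaxTwoFunctor.ofThin isThin
    (fun x => ofElem E (h.htpyOb (ULift.down x.1) (elem E x.2)))
    (fun f => ofChain E (h.htpyAr f.1.1.1.down f.1.1.2.down (chain E f.2)))
    (fun f => by
      rw [src_ofChain, h.htpyAr_min f.1.2, chain_min]; rfl)
    (fun f => by
      rw [tgt_ofChain, h.htpyAr_max, chain_max]; rfl)
    (fun x => by
      rw [← ofChain_single, ← h.htpyAr_single, ← chain_id₁]; rfl)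
    (fun α => h.exists_htpyCe α.1.2 α.2)
    (fun g f k => h.exists_htpyCon f.1.2 g.1.2 (congrArg (fun p => p.1.down) k) g.2 f.2
      (congrArg Prod.snd k))

theorem chain_oplax (h : IsRetractSieve i.hom r.hom) (p : TwoCat.I.{u}.Ar) (f : (c₂N.obj E).Ar) :
    chain E (h.oplax.ar (p, f)) = h.htpyAr p.1.1.down p.1.2.down (chain E f) :=
  chain_ofChain _

theorem elem_oplax (h : IsRetractSieve i.hom r.hom) (p : TwoCat.I.{u}.Ob) (x : (c₂N.obj E).Ob) :
    elem E (h.oplax.ob (p, x)) = h.htpyOb (ULift.down p) (elem E x) :=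
  elem_ofElem _

theorem chain_subset_range {f : (c₂N.obj E).Ar} (hf : f ∈ Set.range (c₂N.map i).ar) :
    (chain E f).S ⊆ Set.range i.hom := by
  obtain ⟨f, rfl⟩ := hf
  rw [chain_map]
  exact Set.image_subset_range _ _

/-- The strong oplax deformation retract structure on `c₂N(i)`. -/
noncomputable def retractStructure (h : IsRetractSieve i.hom r.hom) :
    StrongOplaxRetractStructure (c₂N.map i) where
  r := c₂N.map r
  retraction := by
    rw [← Functor.map_comp, ← c₂N.map_id]
    exact congrArg _ (PartOrd.hom_ext (OrderHom.ext _ _ (funext h.ri)))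
  homotopy :=
    { H := h.oplax
      zero := by
        refine OplaxTwoFunctor.ext_of_isThin isThin (funext fun x => elem_injective ?_)
          (funext fun f => chain_injective ?_)
        · refine (h.elem_oplax _ _).trans ?_
          exact ((elem_map i _).trans (congrArg i (elem_map r x))).symm
        · refine (h.chain_oplax _ _).trans ?_
          refine Eq.trans ?_ ((chain_map i _).trans
            (congrArg (OrientalArrow.map i.hom) (chain_map r f))).symm
          exact OrientalArrow.ext (Set.image_comp i r _)
      one := by
        refine OplaxTwoFunctor.ext_of_isThin isThin (funext fun x => elem_injective ?_)
          (funext fun f => chain_injective ?_)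
        · exact h.elem_oplax _ _
        · exact h.chain_oplax _ _ }
  relative := by
    refine OplaxTwoFunctor.ext_of_isThin isThin (funext fun x => elem_injective ?_)
      (funext fun f => chain_injective ?_)
    · refine (h.elem_oplax x.1 _).trans ?_
      change h.htpyOb _ (elem E ((c₂N.map i).ob x.2)) = elem E ((c₂N.map i).ob x.2)
      rw [elem_map]
      unfold htpyOb
      split_ifs
      · exact congrArg i (h.ri _)
      · rfl
    · refine (h.chain_oplax f.1 _).trans ?_
      exact h.htpyAr_of_subset _ _ _ (chain_subset_range ⟨f.2, rfl⟩)
  strict_ar g f k h' hf :=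
    (h.ofChain_htpyAr_comp₁ g f k (chain_subset_range hf)).trans (TwoCat.cmp_eq h')
  strict_con g f k h' hf :=
    -- The constraint has equal source and target by condition 2 on 1-cells, so thinness makes it an
    -- identity.
    isThin _ _ ((h.oplax.src₂_con _ _ _).trans ((c₂N.obj E).src₂_id₂ _).symm)
      ((h.oplax.tgt₂_con _ _ _ ((h.oplax.src_ar _).trans
        ((congrArg h.oplax.ob h').trans (h.oplax.tgt_ar _).symm))).trans
        ((((h.ofChain_htpyAr_comp₁ g f k (chain_subset_range hf)).trans
          (TwoCat.cmp_eq _)).symm).trans ((c₂N.obj E).tgt₂_id₂ _).symm))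

end IsRetractSieve

open PosetNerve

/-! ## Sieves of 2-categories -/

/-- The 2-functor from `O(E)` to the poset `E`, seen as a 2-category. -/
def TwoCat.orientalToPoset (E : Type u) [PartialOrder E] :
    TwoCat.oriental E ⟶ TwoCat.ofPoset E where
  ob x := x
  ar a := ⟨(OrientalArrow.min a, OrientalArrow.max a), OrientalArrow.min_le_max a⟩
  ce c := ⟨((OrientalCell.dom c).min, (OrientalCell.dom c).max), OrientalArrow.min_le_max _⟩
  src_ar _ := rfl
  tgt_ar _ := rfl
  src₂_ce _ := rfl
  tgt₂_ce c := Subtype.ext (Prod.ext (OrientalCell.min_eq c) (OrientalCell.max_eq c))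
  ar_id₁ _ := rfl
  ar_comp₁ _ _ _ _ := rfl
  ce_id₂ _ := rfl
  ce_vcomp _ α h _ := Subtype.ext (Prod.ext
    ((OrientalCell.min_eq α).trans (congrArg OrientalArrow.min h.symm))
    ((OrientalCell.max_eq α).trans (congrArg OrientalArrow.max h.symm)))
  ce_hcomp _ _ _ _ := rfl

theorem TwoCat.hom_posetPt_ext {A : TwoCat.{u}} (F G : A ⟶ TwoCat.ofPoset posetPt.{u}) : F = G := by
  have h (x y : posetPt.{u}) : x = y := ULift.ext _ _ (Subsingleton.elim _ _)
  exact TwoFunctor.ext (funext fun _ => h _ _)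
    (funext fun _ => Subtype.ext (Prod.ext (h _ _) (h _ _)))
    (funext fun _ => Subtype.ext (Prod.ext (h _ _) (h _ _)))

/-- The classifying map is `O(E) ⟶ E ⟶ Δ₁`. A 2-functor lying over `0` takes its values in chains
whose maximum is in `E'`, hence in chains of `E'`. Composition with `O(r)` factors it through
`O(i)`, uniquely because `O(r)` retracts `O(i)`. -/
theorem IsPosetSieve.isSieve_oriental {E' E : PartOrd.{u}} {i : E' ⟶ E} (hi : IsPosetSieve i)
    {r : E ⟶ E'} (h : IsRetractSieve i.hom r.hom) : TwoCat.IsSieve (orientalFunctor.map i) := by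
  obtain ⟨t, χ, hp⟩ := hi
  let k : TwoCat.ofPoset E' ⟶ TwoCat.ofPoset posetPt.{u} := TwoCat.ofMonotone t.hom
  let d : TwoCat.ofPoset posetPt.{u} ⟶ TwoCat.I.{u} := TwoCat.ofMonotone (posetEnd.{u} 0).hom
  let T : orientalFunctor.obj E' ⟶ TwoCat.ofPoset posetPt.{u} :=
    (TwoCat.orientalToPoset E' : TwoCat.oriental E' ⟶ TwoCat.ofPoset E') ≫ k
  let X : orientalFunctor.obj E ⟶ TwoCat.I.{u} :=
    (TwoCat.orientalToPoset E : TwoCat.oriental E ⟶ TwoCat.ofPoset E) ≫ TwoCat.ofMonotone χ.hom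
  have hw (y) : χ (i y) = ULift.up 0 := ConcreteCategory.congr_hom hp.w y
  have hmem (x : E) (hx : χ x = ULift.up 0) : i (r x) = x := by
    let k : posetPt.{u} ⟶ E := PartOrd.ofHom ⟨fun _ => x, fun _ _ _ => le_rfl⟩
    have hk : k ≫ χ = 𝟙 _ ≫ posetEnd 0 := PartOrd.hom_ext (OrderHom.ext _ _ (funext fun _ => hx))
    have e : i (hp.lift k (𝟙 _) hk (ULift.up 0)) = x :=
      ConcreteCategory.congr_hom (hp.lift_fst k (𝟙 _) hk) (ULift.up 0)
    rw [← e]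
    exact congrArg i (h.ri _)
  have hri : orientalFunctor.map i ≫ orientalFunctor.map r = 𝟙 _ := by
    rw [← Functor.map_comp, ← orientalFunctor.map_id]
    exact congrArg _ (PartOrd.hom_ext (OrderHom.ext _ _ (funext h.ri)))
  have hlift {A : TwoCat.{u}} (F : A ⟶ orientalFunctor.obj E)
      (G : A ⟶ TwoCat.ofPoset posetPt.{u}) (hFG : F ≫ X = G ≫ d) :
      (F ≫ orientalFunctor.map r) ≫ orientalFunctor.map i = F := by
    have hob (x) : i (r (F.ob x)) = F.ob x :=
      hmem _ (congrFun (congrArg TwoFunctor.ob hFG) x)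
    have har (a : OrientalArrow E) (x) (ha : a.max = F.ob x) : (a.map r.hom).map i.hom = a := by
      refine h.map_eq a ?_
      rw [ha]
      exact hob x
    refine TwoFunctor.ext (funext hob) (funext fun f => har _ _ (F.tgt_ar f))
      (funext fun α => OrientalCell.ext (har _ (A.tgt (A.src₂ α)) ?_)
        (har _ (A.tgt (A.tgt₂ α)) ?_))
    · rw [← F.tgt_ar, ← F.src₂_ce]; rfl
    · rw [← F.tgt_ar, ← F.tgt₂_ce]; rfl
  refine ⟨T, X, ⟨?_⟩, ⟨Limits.PullbackCone.IsLimit.mk _ (fun s => s.fst ≫ orientalFunctor.map r)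
    (fun s => hlift _ _ s.condition) (fun s => TwoCat.hom_posetPt_ext _ _) fun s m hm _ => ?_⟩⟩
  · have e (y : E') : χ (i y) = (ULift.up 0 : ULift (Fin 2)) := hw y
    refine TwoFunctor.ext (funext e) (funext fun a => Subtype.ext (Prod.ext (e _) (e _)))
      (funext fun a => Subtype.ext (Prod.ext (e _) (e _)))
  · rw [← hm, Category.assoc, hri, Category.comp_id]

theorem IsPosetSieve.isSieve {E' E : PartOrd.{u}} {i : E' ⟶ E} (hi : IsPosetSieve i)
    {r : E ⟶ E'} (h : IsRetractSieve i.hom r.hom) : TwoCat.IsSieve (c₂N.map i) := by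
  obtain ⟨t, χ, hp⟩ := hi.isSieve_oriental h
  exact ⟨_, _, (IsPullback.of_vert_isIso ⟨comparison_naturality i⟩).paste_vert hp⟩

theorem IsRetractSieve.explicit {E' E : PartOrd.{u}} {i : E' ⟶ E} {r : E ⟶ E'}
    (h : IsRetractSieve i.hom r.hom) :
    ∃ s : StrongOplaxRetractStructure (c₂N.map i), s.r = c₂N.map r ∧
      (∀ x, (comparison E).ob (s.homotopy.H.ob (TwoCat.I.pt 0, x)) =
        i (r ((comparison E).ob x))) ∧
      (∀ x, (comparison E).ob (s.homotopy.H.ob (TwoCat.I.pt 1, x)) = (comparison E).ob x) ∧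
      (∀ f, ((comparison E).ar (s.homotopy.H.ar (TwoCat.I.id₁ (TwoCat.I.pt 0), f))).S =
        (fun y => i (r y)) '' ((comparison E).ar f).S) ∧
      (∀ f, ((comparison E).ar (s.homotopy.H.ar (TwoCat.I.id₁ (TwoCat.I.pt 1), f))).S =
        ((comparison E).ar f).S) ∧
      (∀ f, ((comparison E).ar (s.homotopy.H.ar (TwoCat.I.arrow, f))).S =
        homotopyChain i r ((comparison E).ar f)) :=
  ⟨h.retractStructure, rfl, fun x => h.elem_oplax _ x, fun x => h.elem_oplax _ x,
    fun f => congrArg OrientalArrow.S (h.chain_oplax _ f),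
    fun f => congrArg OrientalArrow.S (h.chain_oplax _ f),
    fun f => (congrArg OrientalArrow.S (h.chain_oplax _ f)).trans (h.homotopyArrow_S_eq _)⟩

/-! ## Weak equivalences from deformation retractions -/

namespace HomotopyClasses

theorem mk_eq_of_comp_homotopy {X Y K : SSet.{u}} {f g : X ⟶ Y} (H : SSet.Homotopy f g)
    (k : Y ⟶ K) : (Quot.mk _ (f ≫ k) : HomotopyClasses X K) = Quot.mk _ (g ≫ k) :=
  Quot.sound ⟨SSet.RelativeMorphism.Homotopy.postcomp H (SSet.RelativeMorphism.botEquiv.symm k)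
    (Subsingleton.elim _ _)⟩

end HomotopyClasses

/-- A section of a map up to homotopy is a weak equivalence, if the composite in the other order
is the identity. -/
theorem IsSimplicialWeakEquivalence.of_homotopy {X Y : SSet.{u}} (p : X ⟶ Y) (q : Y ⟶ X)
    (hpq : p ≫ q = 𝟙 X) (H : SSet.Homotopy (q ≫ p) (𝟙 Y)) : IsSimplicialWeakEquivalence p := by
  intro K _
  -- Pulling back along `p` and then `q` is precomposition with a map homotopic to the identity, so
  -- it fixes homotopy classes.
  have key : Function.LeftInverse (HomotopyClasses.precomp q K) (HomotopyClasses.precomp p K) := by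
    rintro ⟨f⟩
    refine Eq.trans ?_ ((HomotopyClasses.mk_eq_of_comp_homotopy H f).trans ?_)
    · exact congrArg (Quot.mk _) (Category.assoc _ _ _).symm
    · exact congrArg (Quot.mk _) (Category.id_comp _)
  refine ⟨key.injective, ?_⟩
  rintro ⟨f⟩
  refine ⟨Quot.mk _ (q ≫ f), congrArg (Quot.mk _) ?_⟩
  exact (Category.assoc _ _ _).symm.trans ((congrArg (· ≫ f) hpq).trans (Category.id_comp f))

/-! ## Transformations and homotopies of 2-nerves -/

/-- The data which extends two strict 2-functors `F` and `G` to a normalised oplax 2-functor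
with source `Δ₁ × C`: `ar f` is the value at `(0 → 1, f)`, and `left g f`, `right g f` are the
constraints of the decompositions `(0 → 1, gf) = (1, g)(0 → 1, f)` and `(0 → 1, g)(0, f)`. -/
structure OplaxCylinder {C : TwoCat.{u}} {D : TwoCat.{v}} (F G : TwoFunctor C D) where
  ar : C.Ar → D.Ar
  ce : C.Ce → D.Ce
  left : C.Ar → C.Ar → D.Ce
  right : C.Ar → C.Ar → D.Ce
  src_ar : ∀ f, D.src (ar f) = F.ob (C.src f)
  tgt_ar : ∀ f, D.tgt (ar f) = G.ob (C.tgt f)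
  src₂_ce : ∀ α, D.src₂ (ce α) = ar (C.src₂ α)
  tgt₂_ce : ∀ α, D.tgt₂ (ce α) = ar (C.tgt₂ α)
  src₂_left : ∀ {g f}, C.src g = C.tgt f → D.src₂ (left g f) = ar (C.cmp g f)
  tgt₂_left : ∀ {g f}, C.src g = C.tgt f → D.tgt₂ (left g f) = D.cmp (G.ar g) (ar f)
  src₂_right : ∀ {g f}, C.src g = C.tgt f → D.src₂ (right g f) = ar (C.cmp g f)
  tgt₂_right : ∀ {g f}, C.src g = C.tgt f → D.tgt₂ (right g f) = D.cmp (ar g) (F.ar f)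
  ce_id₂ : ∀ f, ce (C.id₂ f) = D.id₂ (ar f)
  ce_vc : ∀ {β α}, C.src₂ β = C.tgt₂ α → ce (C.vc β α) = D.vc (ce β) (ce α)
  left_id : ∀ f, left (C.id₁ (C.tgt f)) f = D.id₂ (ar f)
  right_id : ∀ f, right f (C.id₁ (C.src f)) = D.id₂ (ar f)
  left_naturality : ∀ {β α}, C.src (C.src₂ β) = C.tgt (C.src₂ α) →
    D.vc (left (C.tgt₂ β) (C.tgt₂ α)) (ce (C.hc β α)) =
      D.vc (D.hc (G.ce β) (ce α)) (left (C.src₂ β) (C.src₂ α))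
  right_naturality : ∀ {β α}, C.src (C.src₂ β) = C.tgt (C.src₂ α) →
    D.vc (right (C.tgt₂ β) (C.tgt₂ α)) (ce (C.hc β α)) =
      D.vc (D.hc (ce β) (F.ce α)) (right (C.src₂ β) (C.src₂ α))
  left_left : ∀ {h g f}, C.src h = C.tgt g → C.src g = C.tgt f →
    D.vc (D.hc (D.id₂ (G.ar h)) (left g f)) (left h (C.cmp g f)) = left (C.cmp h g) f
  right_right : ∀ {h g f}, C.src h = C.tgt g → C.src g = C.tgt f →
    right h (C.cmp g f) = D.vc (D.hc (right h g) (D.id₂ (F.ar f))) (right (C.cmp h g) f)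
  left_right : ∀ {h g f}, C.src h = C.tgt g → C.src g = C.tgt f →
    D.vc (D.hc (D.id₂ (G.ar h)) (right g f)) (left h (C.cmp g f)) =
      D.vc (D.hc (left h g) (D.id₂ (F.ar f))) (right (C.cmp h g) f)

namespace OplaxCylinder

attribute [grind =] src_ar tgt_ar src₂_ce tgt₂_ce ce_id₂ ce_vc src₂_left tgt₂_left src₂_right
  tgt₂_right

variable {C : TwoCat.{u}} {D : TwoCat.{v}} {F G : TwoFunctor C D} (Φ : OplaxCylinder F G)
theorem left_id' {g f : C.Ar} (h : g = C.id₁ (C.tgt f)) : Φ.left g f = D.id₂ (Φ.ar f) := by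
  rw [h, left_id]

theorem right_id' {g f : C.Ar} (h : f = C.id₁ (C.src g)) : Φ.right g f = D.id₂ (Φ.ar g) := by
  rw [h, right_id]

attribute [grind =] left_id' right_id'

section

variable {h g f p q : C.Ar} {a b c d : C.Ce}

/-- The cocycle condition for four points of which only the last lies over `1`. Naturality of
`right` carries the 2-cells `a` and `c` past the constraints, and `right_right` then applies. -/
theorem right_right_con (hh : C.src h = C.tgt g) (hg : C.src g = C.tgt f)
    (ha : C.src₂ a = q) (ha' : C.tgt₂ a = C.cmp g f)
    (hb' : C.tgt₂ b = C.cmp h q)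
    (hc : C.src₂ c = p) (hc' : C.tgt₂ c = C.cmp h g)
    (hd' : C.tgt₂ d = C.cmp p f)
    (e : C.vc (C.hc (C.id₂ h) a) b = C.vc (C.hc c (C.id₂ f)) d) :
    D.vc (D.hc (D.id₂ (Φ.ar h)) (F.ce a)) (D.vc (Φ.right h q) (Φ.ce b)) =
      D.vc (D.hc (D.vc (Φ.right h g) (Φ.ce c)) (D.id₂ (F.ar f)))
        (D.vc (Φ.right p f) (Φ.ce d)) := by
  have n₁ := Φ.right_naturality (β := C.id₂ h) (α := a) (by grind)
  have n₂ := Φ.right_naturality (β := c) (α := C.id₂ f) (by grind)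
  have r := Φ.right_right hh hg
  have e' := congrArg Φ.ce e
  rw [C.tgt₂_id₂, C.src₂_id₂, ha, ha', Φ.ce_id₂] at n₁
  rw [C.tgt₂_id₂, C.src₂_id₂, hc, hc', F.ce_id₂] at n₂
  rw [Φ.ce_vc (by grind), Φ.ce_vc (by grind)] at e'
  rw [← TwoCat.vc_assoc (by grind) (by grind), ← n₁, TwoCat.vc_assoc (by grind) (by grind), e', r,
    TwoCat.vc_assoc (by grind) (by grind), TwoCat.hc_vc_id₂ (by grind) (by grind),
    TwoCat.vc_assoc (by grind) (by grind), ← TwoCat.vc_assoc (γ := D.hc (Φ.ce c) _) (by grind)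
    (by grind), ← n₂, TwoCat.vc_assoc (by grind) (by grind)]

/-- The same for two points over `0` followed by two over `1`: the crossing takes place in the
middle 1-cell, and the mixed law `left_right` is the one required. -/
theorem left_right_con (hh : C.src h = C.tgt g) (hg : C.src g = C.tgt f)
    (ha : C.src₂ a = q) (ha' : C.tgt₂ a = C.cmp g f)
    (hb' : C.tgt₂ b = C.cmp h q)
    (hc : C.src₂ c = p) (hc' : C.tgt₂ c = C.cmp h g)
    (hd' : C.tgt₂ d = C.cmp p f)
    (e : C.vc (C.hc (C.id₂ h) a) b = C.vc (C.hc c (C.id₂ f)) d) :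
    D.vc (D.hc (D.id₂ (G.ar h)) (D.vc (Φ.right g f) (Φ.ce a))) (D.vc (Φ.left h q) (Φ.ce b)) =
      D.vc (D.hc (D.vc (Φ.left h g) (Φ.ce c)) (D.id₂ (F.ar f)))
        (D.vc (Φ.right p f) (Φ.ce d)) := by
  have n₁ := Φ.left_naturality (β := C.id₂ h) (α := a) (by grind)
  have n₂ := Φ.right_naturality (β := c) (α := C.id₂ f) (by grind)
  have r := Φ.left_right hh hg
  have e' := congrArg Φ.ce e
  rw [C.tgt₂_id₂, C.src₂_id₂, ha, ha', G.ce_id₂] at n₁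
  rw [C.tgt₂_id₂, C.src₂_id₂, hc, hc', F.ce_id₂] at n₂
  rw [Φ.ce_vc (by grind), Φ.ce_vc (by grind)] at e'
  rw [TwoCat.hc_id₂_vc (by grind) (by grind), TwoCat.vc_assoc (by grind) (by grind),
    ← TwoCat.vc_assoc (β := Φ.left h q) (by grind) (by grind), ← n₁,
    TwoCat.vc_assoc (by grind) (by grind), e', ← TwoCat.vc_assoc (by grind) (by grind), r,
    TwoCat.vc_assoc (by grind) (by grind), TwoCat.hc_vc_id₂ (by grind) (by grind),
    TwoCat.vc_assoc (by grind) (by grind), ← TwoCat.vc_assoc (γ := D.hc (Φ.ce c) _) (by grind)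
    (by grind), ← n₂, TwoCat.vc_assoc (by grind) (by grind)]

/-- The same when only the first point lies over `0`, with `left_left`. -/
theorem left_left_con (hh : C.src h = C.tgt g) (hg : C.src g = C.tgt f)
    (ha : C.src₂ a = q) (ha' : C.tgt₂ a = C.cmp g f)
    (hb' : C.tgt₂ b = C.cmp h q)
    (hc : C.src₂ c = p) (hc' : C.tgt₂ c = C.cmp h g)
    (hd' : C.tgt₂ d = C.cmp p f)
    (e : C.vc (C.hc (C.id₂ h) a) b = C.vc (C.hc c (C.id₂ f)) d) :
    D.vc (D.hc (D.id₂ (G.ar h)) (D.vc (Φ.left g f) (Φ.ce a))) (D.vc (Φ.left h q) (Φ.ce b)) =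
      D.vc (D.hc (G.ce c) (D.id₂ (Φ.ar f))) (D.vc (Φ.left p f) (Φ.ce d)) := by
  have n₁ := Φ.left_naturality (β := C.id₂ h) (α := a) (by grind)
  have n₂ := Φ.left_naturality (β := c) (α := C.id₂ f) (by grind)
  have r := Φ.left_left hh hg
  have e' := congrArg Φ.ce e
  rw [C.tgt₂_id₂, C.src₂_id₂, ha, ha', G.ce_id₂] at n₁
  rw [C.tgt₂_id₂, C.src₂_id₂, hc, hc', Φ.ce_id₂] at n₂
  rw [Φ.ce_vc (by grind), Φ.ce_vc (by grind)] at e'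
  rw [TwoCat.hc_id₂_vc (by grind) (by grind), TwoCat.vc_assoc (by grind) (by grind),
    ← TwoCat.vc_assoc (β := Φ.left h q) (by grind) (by grind), ← n₁,
    TwoCat.vc_assoc (by grind) (by grind), e', ← TwoCat.vc_assoc (by grind) (by grind), r,
    ← TwoCat.vc_assoc (by grind) (by grind), n₂, TwoCat.vc_assoc (by grind) (by grind)]

end

variable {E : Type w} [PartialOrder E] (X : OplaxDiagram E C) (θ : E →o Fin 2)

open Classical in
/-- The restriction of a cylinder along an oplax diagram and a map to `Δ₁`. -/
noncomputable def diagram : OplaxDiagram E D where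
  ob x := if θ x = 0 then F.ob (X.ob x) else G.ob (X.ob x)
  ar x y := if θ y = 0 then F.ar (X.ar x y) else if θ x = 0 then Φ.ar (X.ar x y)
    else G.ar (X.ar x y)
  -- The constraint of `X` is sent to the 1-cell crossing from `0` to `1`, which is then split by
  -- `right` or `left` according to whether the middle point lies over `0` or over `1`.
  con x y z := if θ z = 0 then F.ce (X.con x y z) else
    if θ y = 0 then D.vc (Φ.right (X.ar y z) (X.ar x y)) (Φ.ce (X.con x y z)) else
    if θ x = 0 then D.vc (Φ.left (X.ar y z) (X.ar x y)) (Φ.ce (X.con x y z)) else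
    G.ce (X.con x y z)
  src_ar {x y} h := by
    have := θ.monotone h
    split_ifs <;> grind
  tgt_ar {x y} h := by
    have := θ.monotone h
    split_ifs <;> grind
  src₂_con {x y z} h h' := by
    have := θ.monotone h
    have := θ.monotone h'
    split_ifs <;> grind
  tgt₂_con {x y z} h h' := by
    have := θ.monotone h
    have := θ.monotone h'
    split_ifs <;> grind
  ar_self x := by
    split_ifs <;> grind
  con_left {x y} h := by
    have := θ.monotone h
    split_ifs <;> grind
  con_right {x y} h := by
    have := θ.monotone h
    split_ifs <;> grind
  cocycle {x y z w} h h' h'' := by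
    have h₁ := θ.monotone h
    have h₂ := θ.monotone h'
    have h₃ := θ.monotone h''
    have e := X.cocycle h h' h''
    have t₁ : C.src (X.ar z w) = C.tgt (X.ar y z) := by grind
    have t₂ : C.src (X.ar y z) = C.tgt (X.ar x y) := by grind
    by_cases hw : θ w = 0
    · obtain ⟨hx, hy, hz⟩ : θ x = 0 ∧ θ y = 0 ∧ θ z = 0 := by grind
      simp only [if_pos hw, if_pos hx, if_pos hy, if_pos hz]
      have := congrArg F.ce e
      grind
    by_cases hz : θ z = 0
    · obtain ⟨hx, hy⟩ : θ x = 0 ∧ θ y = 0 := by grind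
      simp only [if_neg hw, if_pos hx, if_pos hy, if_pos hz]
      apply Φ.right_right_con t₁ t₂ <;> grind
    by_cases hy : θ y = 0
    · have hx : θ x = 0 := by grind
      simp only [if_neg hw, if_pos hx, if_pos hy, if_neg hz]
      apply Φ.left_right_con t₁ t₂ <;> grind
    by_cases hx : θ x = 0
    · simp only [if_neg hw, if_pos hx, if_neg hy, if_neg hz]
      apply Φ.left_left_con t₁ t₂ <;> grind
    · simp only [if_neg hw, if_neg hx, if_neg hy, if_neg hz]
      have := congrArg G.ce e
      grind

end OplaxCylinder

namespace OplaxDiagram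

variable {E E' : Type u} [PartialOrder E] [PartialOrder E'] {C : TwoCat.{v}}

theorem ofFunctor_comp_ar (φ : E' →o E) (x : TwoFunctor (TwoCat.oriental E) C) {p q : E'}
    (h : p ≤ q) : (ofFunctor (TwoFunctor.comp (TwoCat.orientalMap φ) x)).ar p q =
      (ofFunctor x).ar (φ p) (φ q) := by
  rw [ofFunctor_ar _ h, ofFunctor_ar _ (φ.monotone h), ← OrientalArrow.map_pair _ _ _ h]
  rfl

theorem ofFunctor_comp_con (φ : E' →o E) (x : TwoFunctor (TwoCat.oriental E) C) {p q s : E'}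
    (h : p ≤ q) (h' : q ≤ s) :
    (ofFunctor (TwoFunctor.comp (TwoCat.orientalMap φ) x)).con p q s =
      (ofFunctor x).con (φ p) (φ q) (φ s) := by
  rw [ofFunctor_con _ h h', ofFunctor_con _ (φ.monotone h) (φ.monotone h'),
    ← OrientalCell.map_triple _ _ _ _ h h']
  rfl

end OplaxDiagram

namespace OplaxCylinder

section

variable {C : TwoCat.{v}} {D : TwoCat.{w}} {F G : TwoFunctor C D} (Φ : OplaxCylinder F G)
variable {E E' : Type u} [PartialOrder E] [PartialOrder E']

open OplaxDiagram

/-- The action of a cylinder on a strict 2-functor with source `O(E)` and a map `E → Δ₁`. -/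
noncomputable def functor (x : TwoFunctor (TwoCat.oriental E) C) (θ : E →o Fin 2) :
    TwoFunctor (TwoCat.oriental E) D :=
  (Φ.diagram (ofFunctor x) θ).toFunctor

/-- Naturality in the simplex: this makes the action of a cylinder a simplicial map. -/
theorem functor_comp (φ : E' →o E) (x : TwoFunctor (TwoCat.oriental E) C) (θ : E →o Fin 2) :
    Φ.functor (TwoFunctor.comp (TwoCat.orientalMap φ) x) (θ.comp φ) =
      TwoFunctor.comp (TwoCat.orientalMap φ) (Φ.functor x θ) := by
  refine TwoFunctor.oriental_ext (fun p => ?_) (fun p q h => ?_) fun p q s h h' => ?_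
  · rfl
  · have e : (TwoFunctor.comp (TwoCat.orientalMap φ) (Φ.functor x θ)).atAr (.pair p q h) =
        (Φ.functor x θ).atAr (.pair (φ p) (φ q) (φ.monotone h)) := by
      rw [← OrientalArrow.map_pair _ _ _ h]; rfl
    rw [e, functor, functor, toFunctor_pair, toFunctor_pair]
    simp only [diagram, ofFunctor_comp_ar φ x h]
    rfl
  · have e : (TwoFunctor.comp (TwoCat.orientalMap φ) (Φ.functor x θ)).atCe (.triple p q s h h') =
        (Φ.functor x θ).atCe (.triple (φ p) (φ q) (φ s) (φ.monotone h) (φ.monotone h')) := by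
      rw [← OrientalCell.map_triple _ _ _ _ h h']; rfl
    rw [e, functor, functor, toFunctor_triple, toFunctor_triple]
    simp only [diagram, ofFunctor_comp_ar φ x h, ofFunctor_comp_ar φ x h',
      ofFunctor_comp_con φ x h h']
    rfl

theorem functor_zero (x : TwoFunctor (TwoCat.oriental E) C) (θ : E →o Fin 2) (hθ : ∀ p, θ p = 0) :
    Φ.functor x θ = TwoFunctor.comp x F := by
  refine TwoFunctor.oriental_ext (fun p => ?_) (fun p q h => ?_) fun p q s h h' => ?_
  · exact if_pos (hθ p)
  · rw [functor, toFunctor_pair]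
    simp only [diagram, if_pos (hθ _), ofFunctor_ar x h]
    rfl
  · rw [functor, toFunctor_triple]
    simp only [diagram, if_pos (hθ _), ofFunctor_con x h h']
    rfl

theorem functor_one (x : TwoFunctor (TwoCat.oriental E) C) (θ : E →o Fin 2) (hθ : ∀ p, θ p = 1) :
    Φ.functor x θ = TwoFunctor.comp x G := by
  have hθ' (p) : ¬ θ p = 0 := by rw [hθ]; decide
  refine TwoFunctor.oriental_ext (fun p => ?_) (fun p q h => ?_) fun p q s h h' => ?_
  · exact if_neg (hθ' p)
  · rw [functor, toFunctor_pair]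
    simp only [diagram, if_neg (hθ' _), ofFunctor_ar x h]
    rfl
  · rw [functor, toFunctor_triple]
    simp only [diagram, if_neg (hθ' _), ofFunctor_con x h h']
    rfl

end

open MonoidalCategory Simplicial

variable {C D : TwoCat.{u}} {F G : C ⟶ D} (Φ : OplaxCylinder F G)

/-- The map of posets to `Δ₁` attached to a simplex of `Δ[1]`. -/
def toFinTwo {Δ : SimplexCategoryᵒᵖ} (s : Δ[1].obj Δ) :
    ULift.{u} (Fin (Δ.unop.len + 1)) →o Fin 2 :=
  ⟨fun k => (SSet.stdSimplex.objEquiv.{u} s).toOrderHom k.down,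
    fun _ _ h => (SSet.stdSimplex.objEquiv.{u} s).toOrderHom.monotone h⟩

/-- The value of a 2-functor with source `O(Δ_m)`, seen as a simplex. -/
def ofNerve₂ {C : TwoCat.{u}} {Δ : SimplexCategoryᵒᵖ} (x : (nerve₂.{u}.obj C).obj Δ) :
    TwoFunctor (TwoCat.oriental (ULift.{u} (Fin (Δ.unop.len + 1)))) C := x

/-- The homotopy of simplicial maps attached to a cylinder. -/
noncomputable def nerveMap : nerve₂.obj C ⊗ Δ[1] ⟶ nerve₂.obj D where
  app Δ := ↾fun x => (Φ.functor (ofNerve₂ x.1) (toFinTwo x.2) : cosimplicialOriental.obj Δ.unop ⟶ D)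
  naturality Δ Δ' φ := by
    ext x
    exact Φ.functor_comp (SimplexCategory.toPartOrd.{u}.map φ.unop).hom (ofNerve₂ x.1)
      (toFinTwo x.2)

/-- The homotopy between the maps of 2-nerves attached to a cylinder. -/
noncomputable def homotopy : SSet.Homotopy (nerve₂.map F) (nerve₂.map G) where
  h := Φ.nerveMap
  h₀ := by
    ext Δ x
    exact Φ.functor_zero (ofNerve₂ x) _ fun _ => rfl
  h₁ := by
    ext Δ x
    exact Φ.functor_one (ofNerve₂ x) _ fun _ => rfl
  rel := by
    ext Δ x
    -- The homotopy is relative to the empty subcomplex, which has no simplices.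
    exact x.1.2.elim

end OplaxCylinder

/-! ## Gluing a 2-category with `O(E)` -/

/-- The default value of `cmp g f` is `g`. Hence `Span.precomp` is a span without any composability
hypothesis. -/
theorem TwoCat.tgt_cmp' {D : TwoCat.{u}} (g f : D.Ar) : D.tgt (D.cmp g f) = D.tgt g := by
  by_cases h : D.src g = D.tgt f
  · exact TwoCat.tgt_cmp h
  · rw [TwoCat.cmp, dif_neg h]

namespace OplaxDiagram

variable {A : TwoCat.{v}} {E : Type u} [PartialOrder E] (X : OplaxDiagram E A) {x y z w : E}
  {f f₁ f₂ g : A.Ar} {α β γ δ : A.Ce}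

/-- The composite of `α : X(x, y) f ⇒ f₁` and `β : X(y, z) f₁ ⇒ f₂`, as a 2-cell from
`X(x, z) f` to `f₂`. -/
noncomputable def compCe (x y z : E) (f : A.Ar) (β α : A.Ce) : A.Ce :=
  A.vc β (A.vc (A.hc (A.id₂ (X.ar y z)) α) (A.hc (X.con x y z) (A.id₂ f)))

theorem src₂_compCe (h : x ≤ y) (h' : y ≤ z) (hf : A.tgt f = X.ob x)
    (hα : A.src₂ α = A.cmp (X.ar x y) f) (hβ : A.src₂ β = A.cmp (X.ar y z) (A.tgt₂ α)) :
    A.src₂ (X.compCe x y z f β α) = A.cmp (X.ar x z) f := by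
  unfold compCe
  grind

theorem tgt₂_compCe (h : x ≤ y) (h' : y ≤ z) (hf : A.tgt f = X.ob x)
    (hα : A.src₂ α = A.cmp (X.ar x y) f) (hα' : A.tgt₂ α = f₁)
    (hβ : A.src₂ β = A.cmp (X.ar y z) f₁) :
    A.tgt₂ (X.compCe x y z f β α) = A.tgt₂ β := by
  unfold compCe
  grind

theorem compCe_id_left (h : x ≤ y) (hf : A.tgt f = X.ob x) (hα : A.src₂ α = A.cmp (X.ar x y) f)
    (hα' : A.tgt₂ α = f₁) : X.compCe x y y f (A.id₂ f₁) α = α := by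
  unfold compCe
  rw [X.con_right h, X.ar_self, TwoCat.hc_id₂ (by grind), TwoCat.vc_id, TwoCat.id_hc,
    TwoCat.id_vc] <;> grind

theorem compCe_id_right (h : x ≤ y) (hf : A.tgt f = X.ob x) (hα : A.src₂ α = A.cmp (X.ar x y) f) :
    X.compCe x x y f α (A.id₂ f) = α := by
  unfold compCe
  rw [X.con_left h, TwoCat.hc_id₂ (by grind), TwoCat.vc_id, TwoCat.vc_id] <;> grind

/-- Associativity of vertical composition in the gluing. Interchange slides `α` past the constraint
at `y ≤ z ≤ w`, and the cocycle condition of `X` does the rest. -/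
theorem compCe_assoc (h : x ≤ y) (h' : y ≤ z) (h'' : z ≤ w) (hf : A.tgt f = X.ob x)
    (hα : A.src₂ α = A.cmp (X.ar x y) f) (hα' : A.tgt₂ α = f₁)
    (hβ : A.src₂ β = A.cmp (X.ar y z) f₁) (hβ' : A.tgt₂ β = f₂)
    (hγ : A.src₂ γ = A.cmp (X.ar z w) f₂) :
    X.compCe x y w f (X.compCe y z w f₁ γ β) α = X.compCe x z w f γ (X.compCe x y z f β α) := by
  unfold compCe
  have e := X.cocycle h h' h''
  have t : A.tgt f₁ = X.ob y := by grind
  have s₁ : A.src₂ (A.vc (A.hc (A.id₂ (X.ar y z)) α) (A.hc (X.con x y z) (A.id₂ f))) =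
      A.cmp (X.ar x z) f := by grind
  rw [TwoCat.hc_vc_right (A.src₂_id₂ _) (by grind) (by grind),
    TwoCat.hc_vc_right (A.src₂_id₂ _) (by grind) (by grind),
    TwoCat.vc_assoc (by grind) (by grind), TwoCat.vc_assoc (by grind) (by grind),
    TwoCat.vc_assoc (by grind) (by grind), TwoCat.vc_assoc (by grind) (by grind)]
  refine congrArg _ (congrArg _ ?_)
  have e₁ : A.vc (A.hc (X.con y z w) (A.id₂ f₁)) (A.hc (A.id₂ (X.ar y w)) α) =
      A.vc (A.hc (A.id₂ (X.ar z w)) (A.hc (A.id₂ (X.ar y z)) α))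
        (A.hc (A.hc (X.con y z w) (A.id₂ (X.ar x y))) (A.id₂ f)) := by
    rw [← TwoCat.hc_assoc (by grind) (by grind), TwoCat.hc_id₂ (by grind),
      TwoCat.hc_assoc (by grind) (by grind), TwoCat.hc_id₂ (by grind),
      TwoCat.vc_hc (by grind) (by grind) (by grind), TwoCat.vc_hc (by grind) (by grind) (by grind),
      TwoCat.vc_id (by grind), TwoCat.id_vc (by grind), TwoCat.vc_id (by grind),
      TwoCat.id_vc (by grind)]
  rw [← TwoCat.vc_assoc (by grind) (by grind), e₁, TwoCat.vc_assoc (by grind) (by grind),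
    ← TwoCat.hc_vc_id₂ (by grind) (by grind), ← e, TwoCat.hc_vc_id₂ (by grind) (by grind),
    TwoCat.hc_assoc (by grind) (by grind)]

/-- The interchange law of the gluing for formal composites and 2-cells of `A`: `γ` and `δ` act on
the source side, away from the constraint, which is whiskered by an identity there. -/
theorem hc_compCe (h : x ≤ y) (h' : y ≤ z) (hf : A.tgt f = X.ob x)
    (hα : A.src₂ α = A.cmp (X.ar x y) f) (hα' : A.tgt₂ α = f₁)
    (hβ : A.src₂ β = A.cmp (X.ar y z) f₁) (hg : A.src₂ γ = g) (hfg : A.src f = A.tgt g)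
    (hδ : A.src₂ δ = A.tgt₂ γ) :
    X.compCe x y z (A.cmp f g) (A.hc β δ) (A.hc α γ) =
      A.hc (X.compCe x y z f β α) (A.vc δ γ) := by
  unfold compCe
  have t : A.tgt f₁ = X.ob y := by grind
  have s : A.src f₁ = A.tgt g := by grind
  rw [← TwoCat.hc_id₂ hfg, ← TwoCat.hc_assoc (by grind) (by grind),
    ← TwoCat.hc_assoc (by grind) (by grind), TwoCat.vc_hc (by grind) (by grind) (by grind),
    TwoCat.vc_hc (by grind) (by grind) (by grind), TwoCat.vc_id hg]

end OplaxDiagram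

/-- A formal composite of a 1-cell `f` of `A` and of a chain `U` of `E`, such that the target of
`f` is the value of `X` at the element `t` of `E'`, and the minimum of `U` is `i t`. -/
@[ext]
structure Span {A : TwoCat.{v}} {E' E : Type u} [PartialOrder E'] [PartialOrder E] (i : E' →o E)
    (X : OplaxDiagram E' A) where
  U : OrientalArrow E
  f : A.Ar
  t : E'
  min_eq : U.min = i t
  tgt_eq : A.tgt f = X.ob t

attribute [grind =] Span.min_eq Span.tgt_eq

/-- A morphism of formal composites with the same source and the same target. -/
@[ext]
structure SpanCell {A : TwoCat.{v}} {E' E : Type u} [PartialOrder E'] [PartialOrder E] (i : E' →o E)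
    (X : OplaxDiagram E' A) where
  dom : Span i X
  cod : Span i X
  ce : A.Ce
  le : dom.t ≤ cod.t
  subset : dom.U.S ⊆ insert (i dom.t) cod.U.S
  max_eq : dom.U.max = cod.U.max
  src₂_ce : A.src₂ ce = A.cmp (X.ar dom.t cod.t) dom.f
  tgt₂_ce : A.tgt₂ ce = cod.f

attribute [grind =] SpanCell.src₂_ce SpanCell.tgt₂_ce
attribute [grind .] SpanCell.le SpanCell.max_eq

variable {A : TwoCat.{v}} {E' E : Type u} [PartialOrder E'] [PartialOrder E] {i : E' →o E}
  {X : OplaxDiagram E' A}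

namespace Span

/-- Composition with a 1-cell of `A`. -/
@[simps]
noncomputable def precomp (s : Span i X) (f : A.Ar) : Span i X where
  U := s.U
  f := A.cmp s.f f
  t := s.t
  min_eq := s.min_eq
  tgt_eq := (TwoCat.tgt_cmp' _ _).trans s.tgt_eq

/-- Composition with a chain of `E`. -/
@[simps]
def postcomp (S : OrientalArrow E) (s : Span i X) (h : S.min = s.U.max) : Span i X where
  U := S.union s.U h
  f := s.f
  t := s.t
  min_eq := s.min_eq
  tgt_eq := s.tgt_eq

end Span

/-- The cells which are composable. -/
def SpanCell.IsProper (c : SpanCell i X) : Prop :=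
  i c.cod.t ∈ c.dom.U.S → i c.cod.t = i c.dom.t

namespace SpanCell

theorem src_cod (c : SpanCell i X) : A.src c.cod.f = A.src c.dom.f := by
  have := A.src_src₂ c.ce
  have := c.le
  grind

attribute [grind =] src_cod

/-- The identity cell. -/
@[simps]
def refl (s : Span i X) : SpanCell i X where
  dom := s
  cod := s
  ce := A.id₂ s.f
  le := le_rfl
  subset := Set.subset_insert _ _
  max_eq := rfl
  src₂_ce := by grind
  tgt₂_ce := by grind

theorem refl_isProper (s : Span i X) : (refl s).IsProper := fun _ => rfl

/-- Vertical composition. -/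
@[simps]
noncomputable def trans (d c : SpanCell i X) (h : d.dom = c.cod) (hc : c.IsProper) :
    SpanCell i X where
  dom := c.dom
  cod := d.cod
  ce := X.compCe c.dom.t c.cod.t d.cod.t c.dom.f d.ce c.ce
  le := c.le.trans (h ▸ d.le)
  subset := by
    intro x hx
    rcases c.subset hx with rfl | hx'
    · exact Or.inl rfl
    · rw [← h] at hx'
      rcases d.subset hx' with rfl | hx''
      -- The point is `i c.cod.t`, which the second cell tolerates without its lying in the last
      -- chain. Properness of `c` identifies it with `i c.dom.t`, which the composite tolerates.
      · rw [h] at hx ⊢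
        exact Or.inl (hc hx)
      · exact Or.inr hx''
  max_eq := by rw [c.max_eq, ← h, d.max_eq]
  src₂_ce := X.src₂_compCe c.le (h ▸ d.le) (by grind) (by grind) (by grind)
  tgt₂_ce := (X.tgt₂_compCe (f₁ := c.cod.f) c.le (h ▸ d.le) (by grind) (by grind) (by grind)
    (by grind)).trans d.tgt₂_ce

theorem trans_isProper {d c : SpanCell i X} (h : d.dom = c.cod) (hc : c.IsProper)
    (hd : d.IsProper) : (trans d c h hc).IsProper := by
  intro hx
  rcases c.subset hx with hx' | hx'
  · exact hx'
  · rw [← h] at hx'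
    have e := hd hx'
    simp only [trans_dom, trans_cod] at hx ⊢
    rw [e, h] at hx ⊢
    exact hc hx

/-- Composition with a 2-cell of `A`. -/
@[simps]
noncomputable def precomp (c : SpanCell i X) (α : A.Ce) (h : A.src c.dom.f = A.tgt (A.src₂ α)) :
    SpanCell i X where
  dom := c.dom.precomp (A.src₂ α)
  cod := c.cod.precomp (A.tgt₂ α)
  ce := A.hc c.ce α
  le := c.le
  subset := c.subset
  max_eq := c.max_eq
  src₂_ce := by
    have := c.le
    simp only [Span.precomp_f, Span.precomp_t]
    grind
  tgt₂_ce := by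
    have := c.le
    simp only [Span.precomp_f]
    grind

/-- Composition with an inclusion of chains of `E`. -/
@[simps]
def postcomp (d : OrientalCell E) (c : SpanCell i X) (h : d.dom.min = c.dom.U.max) :
    SpanCell i X where
  dom := c.dom.postcomp d.dom h
  cod := c.cod.postcomp d.cod (by rw [← d.min_eq, h, c.max_eq])
  ce := c.ce
  le := c.le
  subset := by
    rintro x (hx | hx)
    · exact Or.inr (Or.inl (d.le hx))
    · exact (c.subset hx).imp id Or.inr
  max_eq := d.max_eq
  src₂_ce := c.src₂_ce
  tgt₂_ce := c.tgt₂_ce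

/-- If `i c.cod.t` lies in the added chain, it is at least the minimum of that chain, which is
`c.dom.U.max`. It is also at most `c.cod.U.max`, the same element. So it was already in `c.dom.U`.
-/
theorem postcomp_isProper {d : OrientalCell E} {c : SpanCell i X} (h : d.dom.min = c.dom.U.max)
    (hc : c.IsProper) : (postcomp d c h).IsProper := by
  rintro (hx | hx)
  · have h₁ := d.dom.isLeast.2 hx
    have h₂ := c.cod.U.isLeast.2 c.cod.U.isGreatest.1
    rw [c.cod.min_eq, ← c.max_eq, ← h] at h₂
    refine hc ?_
    have e : i c.cod.t = c.dom.U.max := (le_antisymm h₁ h₂).symm.trans h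
    rw [e]
    exact c.dom.U.isGreatest.1
  · exact hc hx

end SpanCell

theorem OrientalArrow.single_union {E : Type u} [PartialOrder E] (x : E) (a : OrientalArrow E)
    (h : x = a.max) : (single x).union a h = a := by
  subst h
  exact (TwoCat.oriental E).id_comp₁ a rfl

namespace Glue

section

variable {A : TwoCat.{v}} {E' E : Type u} [PartialOrder E'] [PartialOrder E] (i : E' →o E)
  (X : OplaxDiagram E' A)

/-- The 1-cells of the gluing. -/
inductive Ar
  | base (f : A.Ar)
  | mix (s : Span i X)
  | ori (S : OrientalArrow E)

/-- The 2-cells of the gluing. -/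
inductive Ce
  | base (α : A.Ce)
  | mix (c : SpanCell i X) (h : c.IsProper)
  | ori (c : OrientalCell E)

variable {i X}

/-- The source of a 1-cell. -/
def src : Ar i X → A.Ob ⊕ E
  | .base f => .inl (A.src f)
  | .mix s => .inl (A.src s.f)
  | .ori S => .inr S.min

/-- The target of a 1-cell. -/
def tgt : Ar i X → A.Ob ⊕ E
  | .base f => .inl (A.tgt f)
  | .mix s => .inr s.U.max
  | .ori S => .inr S.max

/-- The source of a 2-cell. -/
def src₂ : Ce i X → Ar i X
  | .base α => .base (A.src₂ α)
  | .mix c _ => .mix c.dom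
  | .ori c => .ori c.dom

/-- The target of a 2-cell. -/
def tgt₂ : Ce i X → Ar i X
  | .base α => .base (A.tgt₂ α)
  | .mix c _ => .mix c.cod
  | .ori c => .ori c.cod

/-- The identity 1-cells. -/
def id₁ : A.Ob ⊕ E → Ar i X
  | .inl x => .base (A.id₁ x)
  | .inr x => .ori (.single x)

/-- The identity 2-cells. -/
def id₂ : Ar i X → Ce i X
  | .base f => .base (A.id₂ f)
  | .mix s => .mix (.refl s) (SpanCell.refl_isProper s)
  | .ori S => .ori (.refl S)

/-- The composition of 1-cells. -/
noncomputable def comp₁ : ∀ g f : Ar i X, src g = tgt f → Ar i X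
  | .base g, .base f, _ => .base (A.cmp g f)
  | .mix s, .base f, _ => .mix (s.precomp f)
  | .ori S, .mix s, h => .mix (s.postcomp S (Sum.inr.inj h))
  | .ori S, .ori T, h => .ori (S.union T (Sum.inr.inj h))

/-- The vertical composition of 2-cells. -/
noncomputable def vcomp : ∀ β α : Ce i X, src₂ β = tgt₂ α → Ce i X
  | .base β, .base α, _ => .base (A.vc β α)
  | .mix d _, .mix c hc, h => .mix (d.trans c (Ar.mix.inj h) hc) (SpanCell.trans_isProper _ _ ‹_›)
  | .ori d, .ori c, h => .ori (d.trans c (Ar.ori.inj h))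

/-- The horizontal composition of 2-cells. -/
noncomputable def hcomp : ∀ β α : Ce i X, src (src₂ β) = tgt (src₂ α) → Ce i X
  | .base β, .base α, _ => .base (A.hc β α)
  | .mix c hc, .base α, h => .mix (c.precomp α (Sum.inl.inj h)) hc
  | .ori d, .mix c hc, h => .mix (c.postcomp d (Sum.inr.inj h)) (SpanCell.postcomp_isProper _ hc)
  | .ori d, .ori c, h => .ori (d.union c (Sum.inr.inj h))

theorem Ce.mix_congr {c d : SpanCell i X} (hc : c.IsProper) (hd : d.IsProper) (h : c.dom = d.dom)
    (h' : c.cod = d.cod) (h'' : c.ce = d.ce) : Ce.mix c hc = Ce.mix d hd := by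
  obtain rfl := SpanCell.ext h h' h''
  rfl

end

end Glue

open Glue in
/-- The gluing of `A` and `O(E)`. -/
noncomputable def glue {A : TwoCat.{u}} {E' E : Type u} [PartialOrder E'] [PartialOrder E]
    (i : E' →o E) (X : OplaxDiagram E' A) : TwoCat.{u} where
  Ob := A.Ob ⊕ E
  Ar := Ar i X
  Ce := Ce i X
  src := src
  tgt := tgt
  src₂ := src₂
  tgt₂ := tgt₂
  src_src₂
    | .base α => congrArg Sum.inl (A.src_src₂ α)
    | .mix c _ => congrArg Sum.inl c.src_cod.symm
    | .ori c => congrArg Sum.inr c.min_eq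
  tgt_src₂
    | .base α => congrArg Sum.inl (A.tgt_src₂ α)
    | .mix c _ => congrArg Sum.inr c.max_eq
    | .ori c => congrArg Sum.inr c.max_eq
  id₁ := id₁
  src_id₁
    | .inl x => congrArg Sum.inl (A.src_id₁ x)
    | .inr x => rfl
  tgt_id₁
    | .inl x => congrArg Sum.inl (A.tgt_id₁ x)
    | .inr x => rfl
  comp₁ := comp₁
  src_comp₁
    | .base g, .base f, h => congrArg Sum.inl (TwoCat.src_cmp (Sum.inl.inj h))
    | .mix s, .base f, h => congrArg Sum.inl (TwoCat.src_cmp (Sum.inl.inj h))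
    | .ori S, .mix s, h => rfl
    | .ori S, .ori T, h => rfl
  tgt_comp₁
    | .base g, .base f, h => congrArg Sum.inl (TwoCat.tgt_cmp (Sum.inl.inj h))
    | .mix s, .base f, h => rfl
    | .ori S, .mix s, h => rfl
    | .ori S, .ori T, h => rfl
  id_comp₁
    | .base f, h => congrArg Ar.base (TwoCat.id_cmp rfl)
    | .mix s, h => congrArg Ar.mix (Span.ext ((TwoCat.oriental E).id_comp₁ s.U rfl) rfl rfl)
    | .ori S, h => congrArg Ar.ori ((TwoCat.oriental E).id_comp₁ S rfl)
  comp_id₁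
    | .base f, h => congrArg Ar.base (TwoCat.cmp_id rfl)
    | .mix s, h => congrArg Ar.mix (Span.ext rfl (TwoCat.cmp_id rfl) rfl)
    | .ori S, h => congrArg Ar.ori ((TwoCat.oriental E).comp_id₁ S rfl)
  assoc₁
    | .base h, .base g, .base f, e, e', _, _ =>
      congrArg Ar.base (TwoCat.cmp_assoc (Sum.inl.inj e) (Sum.inl.inj e'))
    | .mix h, .base g, .base f, e, e', _, _ => congrArg Ar.mix (Span.ext rfl
      (TwoCat.cmp_assoc (Sum.inl.inj e) (Sum.inl.inj e')) rfl)
    | .ori h, .mix g, .base f, e, e', _, _ => rfl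
    | .ori h, .ori g, .mix f, e, e', _, _ =>
      congrArg Ar.mix (Span.ext (OrientalArrow.ext (Set.union_assoc _ _ _)) rfl rfl)
    | .ori h, .ori g, .ori f, e, e', _, _ =>
      congrArg Ar.ori (OrientalArrow.ext (Set.union_assoc _ _ _))
  id₂ := id₂
  src₂_id₂
    | .base f => congrArg Ar.base (A.src₂_id₂ f)
    | .mix s => rfl
    | .ori S => rfl
  tgt₂_id₂
    | .base f => congrArg Ar.base (A.tgt₂_id₂ f)
    | .mix s => rfl
    | .ori S => rfl
  vcomp := vcomp
  src₂_vcomp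
    | .base β, .base α, h => congrArg Ar.base (TwoCat.src₂_vc (Ar.base.inj h))
    | .mix d _, .mix c _, h => rfl
    | .ori d, .ori c, h => rfl
  tgt₂_vcomp
    | .base β, .base α, h => congrArg Ar.base (TwoCat.tgt₂_vc (Ar.base.inj h))
    | .mix d _, .mix c _, h => rfl
    | .ori d, .ori c, h => rfl
  id_vcomp
    | .base α, h => congrArg Ce.base (TwoCat.id_vc rfl)
    | .mix c hc, h => by
      exact Ce.mix_congr _ _ rfl rfl
        (X.compCe_id_left c.le c.dom.tgt_eq c.src₂_ce c.tgt₂_ce)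
    | .ori c, h => rfl
  vcomp_id
    | .base α, h => congrArg Ce.base (TwoCat.vc_id rfl)
    | .mix c hc, h => by
      exact Ce.mix_congr _ _ rfl rfl (X.compCe_id_right c.le c.dom.tgt_eq c.src₂_ce)
    | .ori c, h => rfl
  vassoc
    | .base γ, .base β, .base α, e, e', _, _ =>
      congrArg Ce.base (TwoCat.vc_assoc (Ar.base.inj e) (Ar.base.inj e'))
    | .mix c₃ h₃, .mix c₂ h₂, .mix c₁ h₁, e, e', _, _ => by
      have e := Ar.mix.inj e
      have e' := Ar.mix.inj e'
      have l₂ := c₂.le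
      have l₃ := c₃.le
      have s₂ := c₂.src₂_ce
      have s₃ := c₃.src₂_ce
      rw [e] at l₃ s₃
      rw [e'] at l₂ s₂
      refine Ce.mix_congr _ _ rfl rfl (Eq.trans ?_ ((X.compCe_assoc c₁.le l₂ l₃ c₁.dom.tgt_eq
        c₁.src₂_ce c₁.tgt₂_ce s₂ c₂.tgt₂_ce s₃).trans ?_))
      · simp only [SpanCell.trans_ce, SpanCell.trans_cod, e']
      · rfl
    | .ori h, .ori g, .ori f, e, e', _, _ => rfl
  hcomp := hcomp
  src₂_hcomp
    | .base β, .base α, h => congrArg Ar.base (TwoCat.src₂_hc (Sum.inl.inj h))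
    | .mix c hc, .base α, h => rfl
    | .ori S, .mix s _, h => rfl
    | .ori S, .ori T, h => rfl
  tgt₂_hcomp
    | .base β, .base α, h, h' => congrArg Ar.base (TwoCat.tgt₂_hc (Sum.inl.inj h))
    | .mix c hc, .base α, h, h' => rfl
    | .ori S, .mix s _, h, h' => rfl
    | .ori S, .ori T, h, h' => rfl
  id_hcomp
    | .base f, h => congrArg Ce.base (TwoCat.id_hc rfl)
    | .mix c _, h => Ce.mix_congr _ _
        (Span.ext ((TwoCat.oriental E).id_comp₁ c.dom.U rfl) rfl rfl)
        (Span.ext (OrientalArrow.single_union _ _ c.max_eq) rfl rfl) rfl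
    | .ori S, h => congrArg Ce.ori ((TwoCat.oriental E).id_hcomp S rfl)
  hcomp_id
    | .base f, h => congrArg Ce.base (TwoCat.hc_id rfl)
    | .mix c _, h => Ce.mix_congr _ _
        (Span.ext rfl ((congrArg _ (A.src₂_id₂ _)).trans (TwoCat.cmp_id rfl)) rfl)
        (Span.ext rfl ((congrArg _ (A.tgt₂_id₂ _)).trans (TwoCat.cmp_id c.src_cod)) rfl)
        (TwoCat.hc_id (by have := c.le; have := c.src₂_ce; grind))
    | .ori S, h => congrArg Ce.ori ((TwoCat.oriental E).hcomp_id S rfl)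
  hassoc
    | .base h, .base g, .base f, e, e', _, _ =>
      congrArg Ce.base (TwoCat.hc_assoc (Sum.inl.inj e) (Sum.inl.inj e'))
    | .mix c _, .base g, .base f, e, e', _, _ => by
      have e := Sum.inl.inj e
      have e' := Sum.inl.inj e'
      have h₁ : A.src c.cod.f = A.tgt (A.tgt₂ g) := by grind
      have h₂ : A.src (A.tgt₂ g) = A.tgt (A.tgt₂ f) := by grind
      have h₃ : A.src (A.src₂ c.ce) = A.tgt (A.src₂ g) := by have := c.le; grind
      refine Ce.mix_congr _ _ (Span.ext rfl ?_ rfl) (Span.ext rfl ?_ rfl) (TwoCat.hc_assoc h₃ e')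
      · exact (TwoCat.cmp_assoc e e').trans (congrArg _ (TwoCat.src₂_hc e').symm)
      · exact (TwoCat.cmp_assoc h₁ h₂).trans (congrArg _ (TwoCat.tgt₂_hc e').symm)
    | .ori h, .mix g _, .base f, e, e', _, _ => rfl
    | .ori h, .ori g, .mix f _, e, e', _, _ =>
      Ce.mix_congr _ _ (Span.ext (OrientalArrow.ext (Set.union_assoc _ _ _)) rfl rfl)
        (Span.ext (OrientalArrow.ext (Set.union_assoc _ _ _)) rfl rfl) rfl
    | .ori h, .ori g, .ori f, e, e', _, _ =>
      congrArg Ce.ori (OrientalCell.ext (OrientalArrow.ext (Set.union_assoc _ _ _))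
        (OrientalArrow.ext (Set.union_assoc _ _ _)))
  hcomp_id₂
    | .base g, .base f, h, _ => congrArg Ce.base (TwoCat.hc_id₂ (Sum.inl.inj h))
    | .mix s, .base f, h, _ => Ce.mix_congr _ _
        (congrArg s.precomp (A.src₂_id₂ f)) (congrArg s.precomp (A.tgt₂_id₂ f))
        (TwoCat.hc_id₂ (Sum.inl.inj h))
    | .ori S, .mix s, h, _ => rfl
    | .ori S, .ori T, h, _ => rfl
  interchange δ γ β α e₁ e₂ e₃ e₄ _ _ := by
    -- Vertical composition preserves the kind of a cell, and the horizontally composable pairs of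
    -- kinds are base–base, mix–base, ori–mix and ori–ori; four cases remain.
    rcases δ with δ | ⟨d, _⟩ | δ <;> rcases β with β | ⟨c, _⟩ | β <;> try cases e₃
    all_goals rcases γ with γ | ⟨γ, _⟩ | γ <;> try cases e₁
    all_goals rcases α with α | ⟨α, _⟩ | α <;> try cases e₂
    all_goals try cases e₄
    · exact congrArg Ce.base
        (TwoCat.vc_hc (Sum.inl.inj e₁) (Ar.base.inj e₃) (Ar.base.inj e₄))
    · have e₂ := Sum.inl.inj e₂
      have e₃ := Ar.mix.inj e₃
      have e₄ := Ar.base.inj e₄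
      have l := d.le
      have s := d.src₂_ce
      rw [e₃] at l s
      refine Ce.mix_congr _ _ (congrArg c.dom.precomp (TwoCat.src₂_vc e₄).symm)
        (congrArg d.cod.precomp (TwoCat.tgt₂_vc e₄).symm) ?_
      exact X.hc_compCe c.le l c.dom.tgt_eq c.src₂_ce c.tgt₂_ce s rfl e₂ e₄
    · exact Ce.mix_congr _ _ rfl rfl rfl
    · rfl

/-- The pasting behind `valCe_trans`. Here `c`, `d`, `e` are values of chain inclusions, `κ` is a
constraint, and `α`, `β` come from `A`. The hypothesis `key` compares two composites of chain
inclusions, and interchange slides `α` past `d`. -/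
theorem TwoCat.vc_span {B : TwoCat.{w}} {p₁ p₂ x₀₁ x₁₂ f₀ f₁ : B.Ar} {c d e κ α β : B.Ce}
    (hx : B.src p₂ = B.tgt x₁₂) (hx' : B.src x₁₂ = B.tgt x₀₁) (hf : B.src x₀₁ = B.tgt f₀)
    (hκ : B.tgt₂ κ = B.cmp x₁₂ x₀₁) (hc : B.tgt₂ c = B.cmp p₁ x₀₁)
    (hd : B.src₂ d = p₁) (hd' : B.tgt₂ d = B.cmp p₂ x₁₂) (he : B.tgt₂ e = B.cmp p₂ (B.src₂ κ))
    (hα : B.src₂ α = B.cmp x₀₁ f₀) (hα' : B.tgt₂ α = f₁) (hβ : B.src₂ β = B.cmp x₁₂ f₁)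
    (key : B.vc (B.hc d (B.id₂ x₀₁)) c = B.vc (B.hc (B.id₂ p₂) κ) e) :
    B.vc (B.hc (B.id₂ p₂) (B.vc β (B.vc (B.hc (B.id₂ x₁₂) α) (B.hc κ (B.id₂ f₀)))))
      (B.hc e (B.id₂ f₀)) =
    B.vc (B.vc (B.hc (B.id₂ p₂) β) (B.hc d (B.id₂ f₁)))
      (B.vc (B.hc (B.id₂ p₁) α) (B.hc c (B.id₂ f₀))) := by
  have hp : B.src p₁ = B.tgt x₀₁ := by grind
  have hf₁ : B.src x₁₂ = B.tgt f₁ := by grind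
  have hκ' : B.src (B.src₂ κ) = B.tgt f₀ := by grind
  have hκ₂ : B.src p₂ = B.tgt (B.src₂ κ) := by grind
  have e₁ : B.vc (B.hc (B.id₂ p₂) (B.hc κ (B.id₂ f₀))) (B.hc e (B.id₂ f₀)) =
      B.vc (B.hc d (B.id₂ (B.cmp x₀₁ f₀))) (B.hc c (B.id₂ f₀)) := by
    rw [← TwoCat.hc_assoc (by grind) (by grind), ← TwoCat.hc_vc_id₂ (by grind) (by grind), ← key,
      TwoCat.hc_vc_id₂ (by grind) (by grind), TwoCat.hc_assoc (by grind) (by grind),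
      TwoCat.hc_id₂ hf]
  have e₂ : B.vc (B.hc d (B.id₂ f₁)) (B.hc (B.id₂ p₁) α) =
      B.vc (B.hc (B.id₂ p₂) (B.hc (B.id₂ x₁₂) α)) (B.hc d (B.id₂ (B.cmp x₀₁ f₀))) := by
    rw [← TwoCat.hc_assoc (by grind) (by grind), TwoCat.hc_id₂ hx,
      TwoCat.vc_hc (by grind) (by grind) (by grind), TwoCat.vc_hc (by grind) (by grind) (by grind),
      TwoCat.vc_id hd, TwoCat.id_vc hα', TwoCat.vc_id hα, TwoCat.id_vc hd']
  rw [TwoCat.hc_vc_right (B.src₂_id₂ _) (by grind) (by grind),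
    TwoCat.hc_vc_right (B.src₂_id₂ _) (by grind) (by grind),
    TwoCat.vc_assoc (by grind) (by grind), TwoCat.vc_assoc (by grind) (by grind),
    TwoCat.vc_assoc (by grind) (by grind), e₁,
    ← TwoCat.vc_assoc (γ := B.hc d _) (by grind) (by grind), e₂,
    TwoCat.vc_assoc (by grind) (by grind)]

/-! ## The 2-functors defined on the gluing -/

/-- The 2-functors `j` and `b` agree on `E'`. -/
structure GlueCompat {A : TwoCat.{v}} {B : TwoCat.{w}} {E' E : Type u} [PartialOrder E']
    [PartialOrder E] (i : E' →o E) (X : OplaxDiagram E' A) (j : TwoFunctor A B)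
    (b : TwoFunctor (TwoCat.oriental E) B) : Prop where
  ob : ∀ t, b.atOb (i t) = j.ob (X.ob t)
  ar : ∀ {t t'} (h : t ≤ t'), b.atAr (.pair (i t) (i t') (i.monotone h)) = j.ar (X.ar t t')
  con : ∀ {t t' t''} (h : t ≤ t') (h' : t' ≤ t''),
    b.atCe (.triple (i t) (i t') (i t'') (i.monotone h) (i.monotone h')) = j.ce (X.con t t' t'')

/-- The inclusion of chains underlying a cell. -/
@[simps]
def SpanCell.incl {A : TwoCat.{v}} {E' E : Type u} [PartialOrder E']
    [PartialOrder E] {i : E' →o E} {X : OplaxDiagram E' A} (c : SpanCell i X) : OrientalCell E where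
  dom := c.dom.U
  cod := c.cod.U.union (.pair (i c.dom.t) (i c.cod.t) (i.monotone c.le))
    (c.cod.min_eq.trans (OrientalArrow.pair_max _ _ _).symm)
  le := by
    intro x hx
    exact (c.subset hx).elim (fun h => Or.inr (Or.inl h)) Or.inl
  min_eq := c.dom.min_eq
  max_eq := c.max_eq

namespace GlueCompat

variable {A : TwoCat.{v}} {B : TwoCat.{w}} {E' E : Type u} [PartialOrder E']
    [PartialOrder E] {i : E' →o E} {X : OplaxDiagram E' A} {j : TwoFunctor A B}
    {b : TwoFunctor (TwoCat.oriental E) B}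

/-- The value of a formal composite. -/
noncomputable def val (_ : GlueCompat i X j b) (s : Span i X) : B.Ar :=
  B.cmp (b.atAr s.U) (j.ar s.f)

/-- The value of a cell. -/
noncomputable def valCe (_ : GlueCompat i X j b) (c : SpanCell i X) : B.Ce :=
  B.vc (B.hc (B.id₂ (b.atAr c.cod.U)) (j.ce c.ce)) (B.hc (b.atCe c.incl) (B.id₂ (j.ar c.dom.f)))

theorem atAr_U_src (k : GlueCompat i X j b) (s : Span i X) :
    B.src (b.atAr s.U) = j.ob (X.ob s.t) := by
  rw [b.src_atAr, s.min_eq, k.ob]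

theorem ar_f_tgt (_ : GlueCompat i X j b) (s : Span i X) : B.tgt (j.ar s.f) = j.ob (X.ob s.t) := by
  rw [j.tgt_ar, s.tgt_eq]

theorem src_val (k : GlueCompat i X j b) (s : Span i X) : B.src (k.val s) = j.ob (A.src s.f) := by
  have := k.ob
  unfold val
  grind

theorem tgt_val (k : GlueCompat i X j b) (s : Span i X) : B.tgt (k.val s) = b.atOb s.U.max := by
  have := k.ob
  unfold val
  grind

theorem atAr_incl_cod (k : GlueCompat i X j b) (c : SpanCell i X) :
    b.atAr c.incl.cod = B.cmp (b.atAr c.cod.U) (j.ar (X.ar c.dom.t c.cod.t)) := by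
  rw [SpanCell.incl_cod, b.atAr_union, k.ar c.le]

/-- Both sides are the composite of the final chain, of the 1-cell of `X` from `c.dom.t` to
`c.cod.t`, and of `c.dom.f`, bracketed in two ways. A cell is evaluated through this intermediate
1-cell. -/
theorem valCe_aux (k : GlueCompat i X j b) (c : SpanCell i X) :
    B.src₂ (B.hc (B.id₂ (b.atAr c.cod.U)) (j.ce c.ce)) =
      B.tgt₂ (B.hc (b.atCe c.incl) (B.id₂ (j.ar c.dom.f))) := by
  have h₁ := k.atAr_incl_cod c
  have := c.le
  have h₂ := c.dom.min_eq
  have := k.ob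
  have s : B.src₂ (B.hc (B.id₂ (b.atAr c.cod.U)) (j.ce c.ce)) =
    B.cmp (b.atAr c.cod.U) (B.cmp (j.ar (X.ar c.dom.t c.cod.t)) (j.ar c.dom.f)) := by
    grind
  have t : B.tgt₂ (B.hc (b.atCe c.incl) (B.id₂ (j.ar c.dom.f))) =
      B.cmp (b.atAr c.incl.cod) (j.ar c.dom.f) := by
    rw [TwoCat.tgt₂_hc, b.tgt₂_atCe, B.tgt₂_id₂]
    grind [SpanCell.incl_dom]
  rw [s, t, h₁, TwoCat.cmp_assoc]
  · grind
  · grind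

theorem src₂_valCe (k : GlueCompat i X j b) (c : SpanCell i X) :
    B.src₂ (k.valCe c) = k.val c.dom := by
  have := k.ob
  unfold valCe val
  rw [TwoCat.src₂_vc (k.valCe_aux c), TwoCat.src₂_hc, b.src₂_atCe, B.src₂_id₂]
  · rfl
  · grind [SpanCell.incl_dom]

theorem tgt₂_valCe (k : GlueCompat i X j b) (c : SpanCell i X) :
    B.tgt₂ (k.valCe c) = k.val c.cod := by
  have := k.ob
  have := c.le
  unfold valCe val
  rw [TwoCat.tgt₂_vc (k.valCe_aux c), TwoCat.tgt₂_hc, B.tgt₂_id₂, j.tgt₂_ce, c.tgt₂_ce]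
  grind

/-- When the point of `E'` does not move, the pair added in `incl` is a single point already present
in the final chain. -/
theorem valCe_eq_of_id (k : GlueCompat i X j b) (c : SpanCell i X) (d : OrientalCell E)
    (hd : d.dom = c.dom.U) (hd' : d.cod = c.cod.U)
    (ht : c.dom.t = c.cod.t) (hc : c.ce = A.id₂ c.dom.f) :
    k.valCe c = B.hc (b.atCe d) (B.id₂ (j.ar c.dom.f)) := by
  have := k.ob
  have e : c.incl = d := OrientalCell.ext hd.symm (OrientalArrow.ext (by
    rw [hd', SpanCell.incl_cod, OrientalArrow.union_S]
    refine Set.union_eq_self_of_subset_right ?_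
    have h₁ : i c.cod.t ∈ c.cod.U.S := c.cod.min_eq ▸ c.cod.U.isLeast.1
    rw [OrientalArrow.pair_S, ht]
    rintro x (rfl | rfl) <;> exact h₁))
  unfold valCe
  rw [e, hc, j.ce_id₂, TwoCat.hc_id₂, TwoCat.id_vc]
  · grind
  · grind

theorem valCe_refl (k : GlueCompat i X j b) (s : Span i X) :
    k.valCe (.refl s) = B.id₂ (k.val s) := by
  rw [k.valCe_eq_of_id (.refl s) (.refl s.U) rfl rfl rfl rfl, ← b.id₂_atAr]
  exact TwoCat.hc_id₂ ((k.atAr_U_src s).trans (k.ar_f_tgt s).symm)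

/-- Stated for any cell `e` with the ends and the 2-cell of the composite: properness serves only to
form the composite, and plays no part in its value. -/
theorem valCe_trans (k : GlueCompat i X j b) (d c e : SpanCell i X) (h : d.dom = c.cod)
    (hdom : e.dom = c.dom) (hcod : e.cod = d.cod)
    (he : e.ce = X.compCe c.dom.t c.cod.t d.cod.t c.dom.f d.ce c.ce) :
    k.valCe e = B.vc (k.valCe d) (k.valCe c) := by
  have ho := k.ob
  have l₁ := c.le
  have l₂ : c.cod.t ≤ d.cod.t := h ▸ d.le
  have s₂ : A.src₂ d.ce = A.cmp (X.ar c.cod.t d.cod.t) c.cod.f := h ▸ d.src₂_ce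
  have i₁ : d.incl.dom = c.cod.U := congrArg Span.U h
  have i₂ : d.incl.cod = d.cod.U.union (.pair (i c.cod.t) (i d.cod.t) (i.monotone l₂))
      (d.cod.min_eq.trans (OrientalArrow.pair_max _ _ _).symm) :=
    OrientalArrow.ext (by
      rw [SpanCell.incl_cod, OrientalArrow.union_S, OrientalArrow.union_S, OrientalArrow.pair_S,
        OrientalArrow.pair_S, h])
  have i₃ : e.incl.cod = d.cod.U.union (.pair (i c.dom.t) (i d.cod.t) (i.monotone (l₁.trans l₂)))
      (d.cod.min_eq.trans (OrientalArrow.pair_max _ _ _).symm) :=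
    OrientalArrow.ext (by
      rw [SpanCell.incl_cod, OrientalArrow.union_S, OrientalArrow.union_S, OrientalArrow.pair_S,
        OrientalArrow.pair_S, hdom, hcod])
  have i₄ : e.incl.dom = c.dom.U := congrArg Span.U hdom
  unfold valCe
  rw [hcod, hdom, he, h]
  unfold OplaxDiagram.compCe
  have a₁ : A.src (X.ar c.cod.t d.cod.t) = A.tgt (X.ar c.dom.t c.cod.t) := by grind
  have a₂ : A.src (X.ar c.dom.t c.cod.t) = A.tgt c.dom.f := by grind
  have a₃ : A.src (X.ar c.cod.t d.cod.t) = A.tgt c.cod.f := by grind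
  rw [j.ce_vc (by grind), j.ce_vc (by grind), j.ce_hc (by grind), j.ce_hc (by grind), j.ce_id₂,
    j.ce_id₂]
  apply TwoCat.vc_span (x₀₁ := j.ar (X.ar c.dom.t c.cod.t))
  · rw [b.src_atAr, d.cod.min_eq, k.ob]; grind
  · grind
  · grind
  · grind
  · rw [b.tgt₂_atCe, k.atAr_incl_cod]
  · rw [b.src₂_atCe, i₁]
  · rw [b.tgt₂_atCe, i₂, b.atAr_union, k.ar l₂]
  · rw [b.tgt₂_atCe, i₃, b.atAr_union, k.ar (l₁.trans l₂)]; grind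
  · grind
  · grind
  · grind
  -- The hypothesis `key`: both composites are the value of `b` at one inclusion, from `c.dom.U`
  -- into `d.cod.U` enlarged by the images of the three points of `E'`.
  · have hA : (OrientalCell.refl d.cod.U).dom.min = (OrientalCell.triple (i c.dom.t) (i c.cod.t)
        (i d.cod.t) (i.monotone l₁) (i.monotone l₂)).dom.max := d.cod.min_eq
    have hB : d.incl.dom.min = (OrientalCell.refl (.pair (i c.dom.t) (i c.cod.t)
        (i.monotone l₁))).dom.max := by
      rw [i₁]
      exact c.cod.min_eq
    rw [← k.ar l₁, ← k.con l₁ l₂, b.id₂_atAr, b.id₂_atAr, b.hc_atCe _ _ hA, b.hc_atCe _ _ hB,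
      b.vc_atCe _ _ (OrientalArrow.ext (congrArg (fun a => OrientalArrow.S a ∪ _) i₁)),
      b.vc_atCe _ _ i₃.symm]
    exact congrArg b.atCe (OrientalCell.ext i₄.symm (OrientalArrow.ext
      ((congrArg (fun a => OrientalArrow.S a ∪ _) i₂).trans (Set.union_assoc _ _ _))))

/-- By interchange, `d` is whiskered onto the chain part of the cell, while only the identity of its
target meets the part coming from `A`. -/
theorem valCe_postcomp (k : GlueCompat i X j b) (d : OrientalCell E) (c : SpanCell i X)
    (h : d.dom.min = c.dom.U.max) :
    k.valCe (c.postcomp d h) = B.hc (b.atCe d) (k.valCe c) := by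
  have ho := k.ob
  have l := c.le
  have aux := k.valCe_aux c
  have h' : d.cod.min = c.cod.U.max := by rw [← d.min_eq, h, c.max_eq]
  have e₁ : B.src₂ (B.hc (B.id₂ (b.atAr c.cod.U)) (j.ce c.ce)) =
      B.cmp (b.atAr c.cod.U) (j.ar (A.src₂ c.ce)) := by grind
  have e₂ : B.src₂ (B.hc (b.atCe c.incl) (B.id₂ (j.ar c.dom.f))) =
      B.cmp (b.atAr c.dom.U) (j.ar c.dom.f) := by grind [SpanCell.incl_dom]
  have e₃ : b.atAr (d.cod.union c.cod.U h') = B.cmp (b.atAr d.cod) (b.atAr c.cod.U) :=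
    b.atAr_union _ _ _
  have e₄ : b.atCe (c.postcomp d h).incl = B.hc (b.atCe d) (b.atCe c.incl) := by
    rw [b.hc_atCe _ _ h]
    exact congrArg b.atCe (OrientalCell.ext rfl (OrientalArrow.ext (Set.union_assoc _ _ _)))
  have e₅ : B.hc (b.atCe d) (k.valCe c) =
      B.vc (B.hc (B.id₂ (b.atAr d.cod)) (B.hc (B.id₂ (b.atAr c.cod.U)) (j.ce c.ce)))
        (B.hc (b.atCe d) (B.hc (b.atCe c.incl) (B.id₂ (j.ar c.dom.f)))) := by
    unfold valCe
    rw [TwoCat.vc_hc (by grind) (by grind) aux, TwoCat.id_vc (b.tgt₂_atCe d)]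
  rw [e₅, ← TwoCat.hc_assoc (by grind) (by grind),
    ← TwoCat.hc_assoc (by grind [SpanCell.incl_dom]) (by grind [SpanCell.incl_dom]),
    TwoCat.hc_id₂ (by grind), ← e₃, ← e₄]
  rfl

theorem valCe_precomp (k : GlueCompat i X j b) (c : SpanCell i X) (α : A.Ce)
    (h : A.src c.dom.f = A.tgt (A.src₂ α)) :
    k.valCe (c.precomp α h) = B.hc (k.valCe c) (j.ce α) := by
  have ho := k.ob
  have l := c.le
  have aux := k.valCe_aux c
  have e₂ : B.src₂ (B.hc (b.atCe c.incl) (B.id₂ (j.ar c.dom.f))) =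
      B.cmp (b.atAr c.dom.U) (j.ar c.dom.f) := by grind [SpanCell.incl_dom]
  have e₅ : B.hc (k.valCe c) (j.ce α) =
      B.vc (B.hc (B.hc (B.id₂ (b.atAr c.cod.U)) (j.ce c.ce)) (j.ce α))
        (B.hc (B.hc (b.atCe c.incl) (B.id₂ (j.ar c.dom.f))) (B.id₂ (j.ar (A.src₂ α)))) := by
    unfold valCe
    rw [TwoCat.hc_vc_left (j.src₂_ce α) aux (by grind)]
  rw [e₅, TwoCat.hc_assoc (by grind) (by grind),
    TwoCat.hc_assoc (by grind [SpanCell.incl_dom]) (by grind),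
    TwoCat.hc_id₂ (by grind), ← j.ce_hc (by grind), ← j.ar_cmp h]
  rfl

end GlueCompat

open Glue in
/-- The 2-functor from the gluing to `B`. -/
noncomputable def GlueCompat.desc {A B : TwoCat.{u}} {E' E : Type u} [PartialOrder E']
    [PartialOrder E] {i : E' →o E} {X : OplaxDiagram E' A} {j : TwoFunctor A B}
    {b : TwoFunctor (TwoCat.oriental E) B} (k : GlueCompat i X j b) : TwoFunctor (glue i X) B :=
  TwoFunctor.ofTotal (C := glue i X) (Sum.elim j.ob b.atOb)
    (fun | .base f => j.ar f | .mix s => k.val s | .ori S => b.atAr S)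
    (fun | .base α => j.ce α | .mix c _ => k.valCe c | .ori c => b.atCe c)
    (fun | .base f => j.src_ar f | .mix s => k.src_val s | .ori S => b.src_atAr S)
    (fun | .base f => j.tgt_ar f | .mix s => k.tgt_val s | .ori S => b.tgt_atAr S)
    (fun | .base f => j.src₂_ce f | .mix s _ => k.src₂_valCe s | .ori S => b.src₂_atCe S)
    (fun | .base f => j.tgt₂_ce f | .mix s _ => k.tgt₂_valCe s | .ori S => b.tgt₂_atCe S)
    (fun | .inl x => j.ar_id₁ x | .inr x => b.atAr_single x)
    (fun g f h => by
      rw [TwoCat.cmp_eq h]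
      rcases f with f | s | T <;> rcases g with g | s' | S <;> try cases h
      · exact j.ar_cmp (Sum.inl.inj h)
      · have := k.ob
        have h : A.src s'.f = A.tgt f := Sum.inl.inj h
        exact (congrArg (B.cmp _) (j.ar_cmp h)).trans
          (TwoCat.cmp_assoc ((k.atAr_U_src s').trans (k.ar_f_tgt s').symm) (by grind)).symm
      · have := k.ob
        have h : S.min = s.U.max := Sum.inr.inj h
        exact (congrArg (B.cmp · (j.ar s.f)) (b.atAr_union S s.U h)).trans
          (TwoCat.cmp_assoc (by grind) ((k.atAr_U_src s).trans (k.ar_f_tgt s).symm))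
      · exact b.atAr_union _ _ _)
    (fun | .base f => j.ce_id₂ f | .mix s => k.valCe_refl s | .ori S => (b.id₂_atAr S).symm)
    (fun g f h => by
      rw [TwoCat.vc_eq h]
      rcases f with f | ⟨c, hc⟩ | T <;> rcases g with g | ⟨c', hc'⟩ | S <;> try cases h
      · exact j.ce_vc (Ar.base.inj h)
      · exact k.valCe_trans c' c _ (Ar.mix.inj h) rfl rfl rfl
      · exact (b.vc_atCe _ _ _).symm)
    (fun g f h => by
      rw [TwoCat.hc_eq h]
      rcases f with f | ⟨c, hc⟩ | T <;> rcases g with g | ⟨c', hc'⟩ | S <;> try cases h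
      · exact j.ce_hc (Sum.inl.inj h)
      · exact k.valCe_precomp _ _ _
      · exact k.valCe_postcomp _ _ _
      · exact (b.hc_atCe _ _ _).symm)

/-! ## The cylinder of a gluing -/

open Classical in
/-- Construction of a cylinder from constraints which are only defined for composable 1-cells. -/
noncomputable def OplaxCylinder.ofPartial {C : TwoCat.{u}} {D : TwoCat.{v}} {F G : TwoFunctor C D}
    (ar : C.Ar → D.Ar) (ce : C.Ce → D.Ce)
    (left right : ∀ g f : C.Ar, C.src g = C.tgt f → D.Ce)
    (src_ar : ∀ f, D.src (ar f) = F.ob (C.src f))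
    (tgt_ar : ∀ f, D.tgt (ar f) = G.ob (C.tgt f))
    (src₂_ce : ∀ α, D.src₂ (ce α) = ar (C.src₂ α))
    (tgt₂_ce : ∀ α, D.tgt₂ (ce α) = ar (C.tgt₂ α))
    (src₂_left : ∀ g f h, D.src₂ (left g f h) = ar (C.comp₁ g f h))
    (tgt₂_left : ∀ g f h, D.tgt₂ (left g f h) = D.cmp (G.ar g) (ar f))
    (src₂_right : ∀ g f h, D.src₂ (right g f h) = ar (C.comp₁ g f h))
    (tgt₂_right : ∀ g f h, D.tgt₂ (right g f h) = D.cmp (ar g) (F.ar f))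
    (ce_id₂ : ∀ f, ce (C.id₂ f) = D.id₂ (ar f))
    (ce_vc : ∀ β α h, ce (C.vcomp β α h) = D.vc (ce β) (ce α))
    (left_id : ∀ f h, left (C.id₁ (C.tgt f)) f h = D.id₂ (ar f))
    (right_id : ∀ f h, right f (C.id₁ (C.src f)) h = D.id₂ (ar f))
    (left_naturality : ∀ β α h h',
      D.vc (left (C.tgt₂ β) (C.tgt₂ α) h') (ce (C.hcomp β α h)) =
        D.vc (D.hc (G.ce β) (ce α)) (left (C.src₂ β) (C.src₂ α) h))
    (right_naturality : ∀ β α h h',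
      D.vc (right (C.tgt₂ β) (C.tgt₂ α) h') (ce (C.hcomp β α h)) =
        D.vc (D.hc (ce β) (F.ce α)) (right (C.src₂ β) (C.src₂ α) h))
    (left_left : ∀ h g f e e' e₁ e₂,
      D.vc (D.hc (D.id₂ (G.ar h)) (left g f e')) (left h (C.comp₁ g f e') e₁) =
        left (C.comp₁ h g e) f e₂)
    (right_right : ∀ h g f e e' e₁ e₂, right h (C.comp₁ g f e') e₁ =
      D.vc (D.hc (right h g e) (D.id₂ (F.ar f))) (right (C.comp₁ h g e) f e₂))
    (left_right : ∀ h g f e e' e₁ e₂,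
      D.vc (D.hc (D.id₂ (G.ar h)) (right g f e')) (left h (C.comp₁ g f e') e₁) =
        D.vc (D.hc (left h g e) (D.id₂ (F.ar f))) (right (C.comp₁ h g e) f e₂)) :
    OplaxCylinder F G := by
  have comp₁_left {h g f : C.Ar} (e : C.src h = C.tgt g) (e' : C.src g = C.tgt f) :
      C.src (C.comp₁ h g e) = C.tgt f := by rw [C.src_comp₁, e']
  have comp₁_right {h g f : C.Ar} (e : C.src h = C.tgt g) (e' : C.src g = C.tgt f) :
      C.src h = C.tgt (C.comp₁ g f e') := by rw [C.tgt_comp₁, e]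
  have tgt₂ {β α : C.Ce} (h : C.src (C.src₂ β) = C.tgt (C.src₂ α)) :
      C.src (C.tgt₂ β) = C.tgt (C.tgt₂ α) := by rw [← C.src_src₂, h, C.tgt_src₂]
  exact {
    ar := ar
    ce := ce
    left g f := if h : C.src g = C.tgt f then left g f h else D.id₂ (ar f)
    right g f := if h : C.src g = C.tgt f then right g f h else D.id₂ (ar f)
    src_ar := src_ar
    tgt_ar := tgt_ar
    src₂_ce := src₂_ce
    tgt₂_ce := tgt₂_ce
    src₂_left := fun h => by rw [dif_pos h, src₂_left, TwoCat.cmp_eq h]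
    tgt₂_left := fun h => by rw [dif_pos h, tgt₂_left]
    src₂_right := fun h => by rw [dif_pos h, src₂_right, TwoCat.cmp_eq h]
    tgt₂_right := fun h => by rw [dif_pos h, tgt₂_right]
    ce_id₂ := ce_id₂
    ce_vc := fun h => by rw [TwoCat.vc_eq h, ce_vc]
    left_id := fun f => by rw [dif_pos (C.src_id₁ _), left_id]
    right_id := fun f => by rw [dif_pos (C.tgt_id₁ _).symm, right_id]
    left_naturality := fun h => by
      rw [dif_pos h, dif_pos (tgt₂ h), TwoCat.hc_eq h, left_naturality]
    right_naturality := fun h => by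
      rw [dif_pos h, dif_pos (tgt₂ h), TwoCat.hc_eq h, right_naturality]
    left_left := fun e e' => by
      rw [dif_pos e', TwoCat.cmp_eq e', TwoCat.cmp_eq e, dif_pos (comp₁_right e e'),
        dif_pos (comp₁_left e e'), left_left]
    right_right := fun e e' => by
      rw [dif_pos e, TwoCat.cmp_eq e', TwoCat.cmp_eq e, dif_pos (comp₁_right e e'),
        dif_pos (comp₁_left e e'), ← right_right]
    left_right := fun e e' => by
      rw [dif_pos e, dif_pos e', TwoCat.cmp_eq e', TwoCat.cmp_eq e, dif_pos (comp₁_right e e'),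
        dif_pos (comp₁_left e e'), left_right] }

/-! ### End points, retractions and enlargements of formal composites -/

section

variable {A : TwoCat.{v}} {E' E : Type u} [PartialOrder E'] [PartialOrder E] {i : E' →o E}
  {r : E →o E'} {X : OplaxDiagram E' A}

/-- The formal composite with the same 1-cell, and with chain reduced to its end points. -/
def Span.ends (s : Span i X) : Span i X where
  U := .pair (i s.t) s.U.max (s.min_eq ▸ s.U.min_le_max)
  f := s.f
  t := s.t
  min_eq := rfl
  tgt_eq := s.tgt_eq

/-- The formal composite obtained by retracting the chain onto `E'`. -/
def Span.retract (h : IsRetractSieve i r) (s : Span i X) : Span i X where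
  U := s.U.map (i.comp r)
  f := s.f
  t := s.t
  min_eq := show i (r s.U.min) = i s.t by rw [s.min_eq, h.ri]
  tgt_eq := s.tgt_eq

namespace SpanCell

/-- The functoriality of `Span.ends`. -/
def ends (c : SpanCell i X) : SpanCell i X where
  dom := c.dom.ends
  cod := c.cod.ends
  ce := c.ce
  le := c.le
  subset := by
    rintro x (rfl | rfl)
    · exact Or.inl rfl
    · exact Or.inr (Or.inr c.max_eq)
  max_eq := c.max_eq
  src₂_ce := c.src₂_ce
  tgt₂_ce := c.tgt₂_ce

/-- The functoriality of `Span.retract`. -/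
def retract (h : IsRetractSieve i r) (c : SpanCell i X) : SpanCell i X where
  dom := c.dom.retract h
  cod := c.cod.retract h
  ce := c.ce
  le := c.le
  subset := by
    rintro _ ⟨x, hx, rfl⟩
    rcases c.subset hx with rfl | hx
    · exact Or.inl (congrArg i (h.ri _))
    · exact Or.inr ⟨x, hx, rfl⟩
  max_eq := congrArg (i.comp r) c.max_eq
  src₂_ce := c.src₂_ce
  tgt₂_ce := c.tgt₂_ce

/-- The cell which enlarges the chain of a formal composite. -/
def enlarge (s : Span i X) (U : OrientalArrow E) (hmin : U.min = i s.t) (h : s.U.S ⊆ U.S)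
    (hmax : s.U.max = U.max) : SpanCell i X where
  dom := s
  cod := ⟨U, s.f, s.t, hmin, s.tgt_eq⟩
  ce := A.id₂ s.f
  le := le_rfl
  subset := h.trans (Set.subset_insert _ _)
  max_eq := hmax
  src₂_ce := by grind
  tgt₂_ce := by grind

/-- The property of only enlarging the chain. -/
def IsEnlargement (c : SpanCell i X) : Prop := c.dom.t = c.cod.t ∧ c.ce = A.id₂ c.dom.f

end SpanCell

end

namespace GlueCompat

variable {A : TwoCat.{v}} {B : TwoCat.{w}} {E' E : Type u} [PartialOrder E'] [PartialOrder E]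
  {i : E' →o E} {r : E →o E'} {X : OplaxDiagram E' A} {j : TwoFunctor A B}
  {b : TwoFunctor (TwoCat.oriental E) B} (k : GlueCompat i X j b)

/-- An enlargement carries an identity 2-cell of `A` and leaves the point of `E'` in place, so
composing with it changes only the chain. -/
theorem valCe_enlarge_vc {d c e : SpanCell i X} (hd : d.IsEnlargement) (h : d.dom = c.cod)
    (hdom : e.dom = c.dom) (hcod : e.cod = d.cod) (he : e.ce = c.ce) :
    B.vc (k.valCe d) (k.valCe c) = k.valCe e := by
  refine (k.valCe_trans d c e h hdom hcod ?_).symm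
  have := c.src₂_ce
  rw [he, hd.2, ← hd.1, h]
  exact (X.compCe_id_left c.le c.dom.tgt_eq c.src₂_ce c.tgt₂_ce).symm

theorem valCe_vc_enlarge {d c e : SpanCell i X} (hc : c.IsEnlargement) (h : d.dom = c.cod)
    (hdom : e.dom = c.dom) (hcod : e.cod = d.cod) (he : e.ce = d.ce) :
    B.vc (k.valCe d) (k.valCe c) = k.valCe e := by
  refine (k.valCe_trans d c e h hdom hcod ?_).symm
  have l : c.dom.t ≤ d.cod.t := hc.1 ▸ h ▸ d.le
  have s : A.src₂ d.ce = A.cmp (X.ar c.dom.t d.cod.t) c.dom.f := by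
    have := c.tgt₂_ce
    rw [hc.2, A.tgt₂_id₂] at this
    rw [d.src₂_ce, h, hc.1, this]
  rw [he, hc.2, ← hc.1]
  exact (X.compCe_id_right l c.dom.tgt_eq s).symm

/-- Both composites are the value of the same diagonal cell `e`. Most commutations required of the
cylinder are squares of this form. -/
theorem valCe_square {d c d' c' : SpanCell i X} (hd : d.IsEnlargement) (hc' : c'.IsEnlargement)
    (h : d.dom = c.cod) (h' : d'.dom = c'.cod) (hdom : c.dom = c'.dom) (hcod : d.cod = d'.cod)
    (he : c.ce = d'.ce) :
    B.vc (k.valCe d) (k.valCe c) = B.vc (k.valCe d') (k.valCe c') := by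
  let e : SpanCell i X :=
    { dom := c.dom
      cod := d.cod
      ce := c.ce
      le := by rw [← hd.1, h]; exact c.le
      subset := by
        intro x hx
        rw [hdom] at hx ⊢
        rw [hcod]
        rcases c'.subset hx with hx | hx
        · exact Or.inl hx
        · rw [← h'] at hx
          rcases d'.subset hx with hx | hx
          · exact Or.inl (hx.trans (by rw [h', hc'.1]))
          · exact Or.inr hx
      max_eq := by rw [c.max_eq, ← h, d.max_eq]
      src₂_ce := by rw [← hd.1, h]; exact c.src₂_ce
      tgt₂_ce := by
        have := d.tgt₂_ce
        rw [hd.2, A.tgt₂_id₂] at this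
        rw [c.tgt₂_ce, ← h, this] }
  rw [k.valCe_enlarge_vc (e := e) hd h rfl rfl rfl, k.valCe_vc_enlarge (e := e) hc' h' hdom hcod he]

/-- The compatibility obtained by retracting onto `E'`. -/
theorem retract (k : GlueCompat i X j b) (h : IsRetractSieve i r) :
    GlueCompat i X j (TwoFunctor.comp (TwoCat.orientalMap (i.comp r)) b) where
  ob t := (congrArg (fun y => b.atOb (i y)) (h.ri t)).trans (k.ob t)
  ar {t t'} hle := by
    refine Eq.trans ?_ (k.ar hle)
    refine congrArg b.atAr ((OrientalArrow.map_pair _ _ _ _).trans (OrientalArrow.ext ?_))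
    exact congrArg₂ (fun y y' => {i y, i y'}) (h.ri t) (h.ri t')
  con {t t' t''} hle hle' := by
    refine Eq.trans ?_ (k.con hle hle')
    refine congrArg b.atCe ((OrientalCell.map_triple _ _ _ _ _ _).trans ?_)
    have hir (y : E') : (i.comp r) (i y) = i y := congrArg i (h.ri y)
    congr 1 <;> exact hir _

/-- Since `ir` fixes the image of `i`, the pair added in `incl` is unchanged, and retracting before
or after adding it gives the same chain. -/
theorem valCe_retract (h : IsRetractSieve i r) (c : SpanCell i X) :
    (k.retract h).valCe c = k.valCe (c.retract h) := by
  refine congrArg (fun d => B.vc _ (B.hc (b.atCe d) _)) (OrientalCell.ext rfl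
    (OrientalArrow.ext ?_))
  have hir (y : E') : (i.comp r) (i y) = i y := congrArg i (h.ri y)
  refine (Set.image_union _ _ _).trans (congrArg _ ((Set.image_pair _ _ _).trans ?_))
  rw [hir, hir]
  rfl

end GlueCompat

namespace GlueCompat

section

variable {A : TwoCat.{v}} {E' E : Type u} [PartialOrder E'] [PartialOrder E] {i : E' →o E}
  {r : E →o E'} {X : OplaxDiagram E' A} (h : IsRetractSieve i r)

/-- The chain `{i(r(min S)), max S}`. -/
def spread (S : OrientalArrow E) : OrientalArrow E where
  __ := OrientalArrow.pair (i (r S.min)) S.max ((h.ir_le _).trans S.min_le_max)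
  min := i (r S.min)
  max := S.max

/-- The functoriality of `spread`. -/
def spreadCell (c : OrientalCell E) : OrientalCell E where
  dom := spread h c.dom
  cod := spread h c.cod
  le := by
    rintro x (rfl | rfl)
    · exact Or.inl (congrArg (fun x => i (r x)) c.min_eq)
    · exact Or.inr c.max_eq
  min_eq := congrArg (fun x => i (r x)) c.min_eq
  max_eq := c.max_eq

/-- The left constraint, for chains. -/
def leftCell (S T : OrientalArrow E) (e : S.min = T.max) : OrientalCell E where
  dom := spread h (S.union T e)
  cod := S.union (spread h T) e
  le := by
    rintro x (rfl | rfl)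
    · exact Or.inr (Or.inl rfl)
    · exact Or.inl S.isGreatest.1
  min_eq := rfl
  max_eq := rfl

/-- The right constraint, for chains. -/
def rightCell (S T : OrientalArrow E) (e : S.min = T.max) : OrientalCell E where
  dom := spread h (S.union T e)
  cod := (spread h S).union (T.map (i.comp r)) (congrArg (fun x => i (r x)) e)
  le := by
    rintro x (rfl | rfl)
    · exact Or.inr ⟨_, T.isLeast.1, rfl⟩
    · exact Or.inl (Or.inr rfl)
  min_eq := rfl
  max_eq := rfl

/-- The left constraint, for a formal composite and a 1-cell. -/
def leftBase (s : Span i X) : SpanCell i X :=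
  .enlarge s.ends s.U s.min_eq (by
    rintro x (rfl | rfl)
    · exact s.min_eq ▸ s.U.isLeast.1
    · exact s.U.isGreatest.1) rfl

/-- The left constraint, for a chain and a formal composite. -/
def leftMix (S : OrientalArrow E) (s : Span i X) (e : S.min = s.U.max) : SpanCell i X :=
  .enlarge (s.postcomp S e).ends (S.union s.ends.U e) rfl (by
    rintro x (rfl | rfl)
    · exact Or.inr (Or.inl rfl)
    · exact Or.inl S.isGreatest.1) rfl

/-- The right constraint, for a chain and a formal composite. -/
def rightMix (S : OrientalArrow E) (s : Span i X) (e : S.min = s.U.max) : SpanCell i X :=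
  .enlarge (s.postcomp S e).ends
    ((spread h S).union (s.retract h).U (congrArg (fun x => i (r x)) e)) (s.retract h).min_eq (by
    rintro x (rfl | rfl)
    · exact Or.inr ((s.retract h).min_eq ▸ (s.retract h).U.isLeast.1)
    · exact Or.inl (Or.inr rfl)) rfl

theorem leftBase_isEnlargement (s : Span i X) : (leftBase s).IsEnlargement := ⟨rfl, rfl⟩

theorem leftMix_isEnlargement (S : OrientalArrow E) (s : Span i X) (e : S.min = s.U.max) :
    (leftMix S s e).IsEnlargement := ⟨rfl, rfl⟩

theorem rightMix_isEnlargement (S : OrientalArrow E) (s : Span i X) (e : S.min = s.U.max) :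
    (rightMix h S s e).IsEnlargement := ⟨rfl, rfl⟩

end

section

variable {A B : TwoCat.{u}} {E' E : Type u} [PartialOrder E'] [PartialOrder E]
  {i : E' →o E} {r : E →o E'} {X : OplaxDiagram E' A} {j : TwoFunctor A B}
  {b : TwoFunctor (TwoCat.oriental E) B} (k : GlueCompat i X j b) (h : IsRetractSieve i r)

open Glue

/-- The value of the cylinder on 1-cells. -/
noncomputable def cylinderAr : Ar i X → B.Ar
  | .base f => j.ar f
  | .mix s => k.val s.ends
  | .ori S => b.atAr (spread h S)

/-- The value of the cylinder on 2-cells. -/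
noncomputable def cylinderCe : Ce i X → B.Ce
  | .base α => j.ce α
  | .mix c _ => k.valCe c.ends
  | .ori c => b.atCe (spreadCell h c)

/-- The left constraints of the cylinder. -/
noncomputable def cylinderLeft : ∀ g f : Ar i X, src g = tgt f → B.Ce
  | .base g, .base f, _ => B.id₂ (j.ar (A.cmp g f))
  | .mix s, .base f, _ => k.valCe (leftBase (s.precomp f))
  | .ori S, .mix s, e => k.valCe (leftMix S s (Sum.inr.inj e))
  | .ori S, .ori T, e => b.atCe (leftCell h S T (Sum.inr.inj e))

/-- The right constraints of the cylinder. -/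
noncomputable def cylinderRight : ∀ g f : Ar i X, src g = tgt f → B.Ce
  | .base g, .base f, _ => B.id₂ (j.ar (A.cmp g f))
  | .mix s, .base f, _ => k.valCe (.refl (s.ends.precomp f))
  | .ori S, .mix s, e => k.valCe (rightMix h S s (Sum.inr.inj e))
  | .ori S, .ori T, e => b.atCe (rightCell h S T (Sum.inr.inj e))

theorem val_precomp (s : Span i X) (f : A.Ar) (e : A.src s.f = A.tgt f) :
    k.val (s.precomp f) = B.cmp (k.val s) (j.ar f) :=
  (congrArg (B.cmp _) (j.ar_cmp e)).trans
    (TwoCat.cmp_assoc ((k.atAr_U_src s).trans (k.ar_f_tgt s).symm)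
      (by rw [j.src_ar, j.tgt_ar, e])).symm

theorem val_postcomp (S : OrientalArrow E) (s : Span i X) (e : S.min = s.U.max) :
    k.val (s.postcomp S e) = B.cmp (b.atAr S) (k.val s) :=
  (congrArg (B.cmp · (j.ar s.f)) (b.atAr_union S s.U e)).trans
    (TwoCat.cmp_assoc (by rw [b.src_atAr, b.tgt_atAr, e])
      ((k.atAr_U_src s).trans (k.ar_f_tgt s).symm))

theorem atCe_square {d c d' c' : OrientalCell E} (hd : d.dom = c.cod) (hd' : d'.dom = c'.cod)
    (hdom : c.dom = c'.dom) (hcod : d.cod = d'.cod) :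
    B.vc (b.atCe d) (b.atCe c) = B.vc (b.atCe d') (b.atCe c') := by
  rw [b.vc_atCe _ _ hd, b.vc_atCe _ _ hd']
  exact congrArg b.atCe (OrientalCell.ext hdom hcod)

theorem atCe_comp {d c e : OrientalCell E} (hd : d.dom = c.cod)
    (hdom : c.dom = e.dom) (hcod : d.cod = e.cod) :
    B.vc (b.atCe d) (b.atCe c) = b.atCe e := by
  rw [b.vc_atCe _ _ hd]
  exact congrArg b.atCe (OrientalCell.ext hdom hcod)

theorem base_naturality {β α : A.Ce} (e : A.src (A.src₂ β) = A.tgt (A.src₂ α)) :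
    B.vc (B.id₂ (j.ar (A.cmp (A.tgt₂ β) (A.tgt₂ α)))) (j.ce (A.hc β α)) =
      B.vc (B.hc (j.ce β) (j.ce α)) (B.id₂ (j.ar (A.cmp (A.src₂ β) (A.src₂ α)))) := by
  rw [← j.ce_hc e, TwoCat.id_vc, TwoCat.vc_id]
  · rw [j.src₂_ce, TwoCat.src₂_hc e]
  · rw [j.tgt₂_ce, TwoCat.tgt₂_hc e]

theorem base_comp_left {h g f : A.Ar} (e : A.src h = A.tgt g) (e' : A.src g = A.tgt f) :
    B.vc (B.hc (B.id₂ (j.ar h)) (B.id₂ (j.ar (A.cmp g f)))) (B.id₂ (j.ar (A.cmp h (A.cmp g f)))) =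
      B.id₂ (j.ar (A.cmp (A.cmp h g) f)) := by
  grind

theorem base_comp_right {h g f : A.Ar} (e : A.src h = A.tgt g) (e' : A.src g = A.tgt f) :
    B.vc (B.hc (B.id₂ (j.ar (A.cmp h g))) (B.id₂ (j.ar f))) (B.id₂ (j.ar (A.cmp (A.cmp h g) f))) =
      B.id₂ (j.ar (A.cmp (A.cmp h g) f)) := by
  grind

theorem valCe_enlarge_precomp {c e : SpanCell i X} {f : A.Ar} (hc : c.IsEnlargement)
    (he : e.IsEnlargement) (hf : A.src c.dom.f = A.tgt f) (hdom : e.dom = c.dom.precomp f)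
    (hcod : e.cod = c.cod.precomp f) :
    B.hc (k.valCe c) (B.id₂ (j.ar f)) = k.valCe e := by
  have hf' : A.src c.dom.f = A.tgt (A.src₂ (A.id₂ f)) := hf.trans (by rw [A.src₂_id₂])
  rw [← j.ce_id₂, ← k.valCe_precomp c (A.id₂ f) hf']
  refine congrArg k.valCe (SpanCell.ext ?_ ?_ ?_)
  · rw [hdom, SpanCell.precomp_dom, A.src₂_id₂]
  · rw [hcod, SpanCell.precomp_cod, A.tgt₂_id₂]
  · rw [SpanCell.precomp_ce, hc.2, he.2, hdom, TwoCat.hc_id₂ hf]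
    rfl

theorem id₂_val_precomp (s : Span i X) (f : A.Ar) (e : A.src s.f = A.tgt f) :
    B.hc (B.id₂ (k.val s)) (B.id₂ (j.ar f)) = B.id₂ (k.val (s.precomp f)) := by
  rw [k.val_precomp s f e, TwoCat.hc_id₂ ((k.src_val s).trans
    ((congrArg j.ob e).trans (j.tgt_ar _).symm))]

theorem vc_valCe_refl {c : SpanCell i X} {s : Span i X} (hs : s = c.dom) :
    B.vc (k.valCe c) (k.valCe (.refl s)) = k.valCe c := by
  rw [k.valCe_refl, hs, TwoCat.vc_id (k.src₂_valCe c)]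

/-- On `A` the constraints are identities. With a formal composite, they are enlargements on two
opposite sides of a square, and `valCe_square` applies. For two chains, both sides are inclusions
with the same ends. -/
theorem cylinder_left_naturality (β α : Ce i X) (e : src (src₂ β) = tgt (src₂ α))
    (e' : src (tgt₂ β) = tgt (tgt₂ α)) :
    B.vc (k.cylinderLeft h (tgt₂ β) (tgt₂ α) e') (k.cylinderCe h (hcomp β α e)) =
      B.vc (B.hc (k.desc.ce β) (k.cylinderCe h α)) (k.cylinderLeft h (src₂ β) (src₂ α) e) := by
  rcases α with f | ⟨s, hs⟩ | T <;> rcases β with g | ⟨s', hs'⟩ | S <;> try cases e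
  · exact base_naturality (Sum.inl.inj e)
  · refine Eq.trans ?_ (congrArg (B.vc · _) (k.valCe_precomp s' f (Sum.inl.inj e)))
    exact k.valCe_square (leftBase_isEnlargement _) (leftBase_isEnlargement _) rfl rfl rfl rfl rfl
  · refine Eq.trans ?_ (congrArg (B.vc · _) (k.valCe_postcomp S s.ends (Sum.inr.inj e)))
    exact k.valCe_square (leftMix_isEnlargement _ _ _) (leftMix_isEnlargement _ _ _) rfl rfl rfl
      rfl rfl
  · have e := Sum.inr.inj e
    refine Eq.trans ?_ (congrArg (B.vc · _) (b.hc_atCe S (spreadCell h T) e)).symm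
    exact atCe_square rfl rfl rfl rfl

theorem cylinder_right_naturality (β α : Ce i X) (e : src (src₂ β) = tgt (src₂ α))
    (e' : src (tgt₂ β) = tgt (tgt₂ α)) :
    B.vc (k.cylinderRight h (tgt₂ β) (tgt₂ α) e') (k.cylinderCe h (hcomp β α e)) =
      B.vc (B.hc (k.cylinderCe h β) ((k.retract h).desc.ce α))
        (k.cylinderRight h (src₂ β) (src₂ α) e) := by
  rcases α with f | ⟨s, hs⟩ | T <;> rcases β with g | ⟨s', hs'⟩ | S <;> try cases e
  · exact base_naturality (Sum.inl.inj e)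
  · refine Eq.trans ?_ (congrArg (B.vc · _) (k.valCe_precomp s'.ends f (Sum.inl.inj e)))
    exact k.valCe_square ⟨rfl, rfl⟩ ⟨rfl, rfl⟩ rfl rfl rfl rfl rfl
  · refine Eq.trans ?_ (congrArg (B.vc · _) ((k.valCe_postcomp (spreadCell h S) (s.retract h)
      (congrArg (fun x => i (r x)) (Sum.inr.inj e))).trans
        (congrArg (B.hc _) (k.valCe_retract h s).symm)))
    exact k.valCe_square (rightMix_isEnlargement _ _ _ _) (rightMix_isEnlargement _ _ _ _)
      rfl rfl rfl rfl rfl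
  · have e := Sum.inr.inj e
    refine Eq.trans ?_ (congrArg (B.vc · _) (b.hc_atCe (spreadCell h S)
      ((TwoCat.orientalMap (i.comp r)).atCe T) (congrArg (fun x => i (r x)) e))).symm
    exact atCe_square rfl rfl rfl rfl

/-- Enlarging in two steps is enlarging once; the two final chains differ only by the associativity
of unions. -/
theorem cylinder_left_left (t g f : Ar i X) (e : src t = tgt g) (e' : src g = tgt f)
    (e₁ : src t = tgt (comp₁ g f e')) (e₂ : src (comp₁ t g e) = tgt f) :
    B.vc (B.hc (B.id₂ (k.desc.ar t)) (k.cylinderLeft h g f e'))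
      (k.cylinderLeft h t (comp₁ g f e') e₁) = k.cylinderLeft h (comp₁ t g e) f e₂ := by
  rcases f with f | s | T <;> rcases g with g | s' | S <;> try cases e'
  all_goals rcases t with t | s'' | U <;> try cases e
  · exact base_comp_left (Sum.inl.inj e) (Sum.inl.inj e')
  · have e := Sum.inl.inj e
    have e' := Sum.inl.inj e'
    have h₁ : A.src s''.f = A.tgt (A.cmp g f) := e.trans (TwoCat.tgt_cmp e').symm
    refine (congrArg (B.vc · _) (k.id₂_val_precomp s'' _ h₁)).trans
      ((TwoCat.id_vc (k.tgt₂_valCe (leftBase (s''.precomp (A.cmp g f))))).trans ?_)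
    exact congrArg (fun s => k.valCe (leftBase s))
      (Span.ext rfl (TwoCat.cmp_assoc e e').symm rfl)
  · refine (congrArg (B.vc · _) ((congrArg (B.hc · _) (b.id₂_atAr U)).trans
      (k.valCe_postcomp (.refl U) (leftBase (s'.precomp f)) (Sum.inr.inj e)).symm)).trans ?_
    exact k.valCe_enlarge_vc ⟨rfl, rfl⟩ rfl rfl rfl rfl
  · refine (congrArg (B.vc · _) ((congrArg (B.hc · _) (b.id₂_atAr U)).trans
      (k.valCe_postcomp (.refl U) (leftMix S s _) (Sum.inr.inj e)).symm)).trans ?_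
    exact k.valCe_enlarge_vc ⟨rfl, rfl⟩ rfl
      (Span.ext (OrientalArrow.ext rfl) rfl rfl)
      (Span.ext (OrientalArrow.ext (Set.union_assoc _ _ _)) rfl rfl) rfl
  · refine (congrArg (B.vc · _) ((congrArg (B.hc · _) (b.id₂_atAr U)).trans
      (b.hc_atCe (.refl U) (leftCell h S T _) (Sum.inr.inj e)))).trans ?_
    exact atCe_comp rfl rfl (OrientalArrow.ext (Set.union_assoc _ _ _).symm)

/-- As for the left constraints, using that the image by `ir` of a union is the union of the images.
-/
theorem cylinder_right_right (t g f : Ar i X) (e : src t = tgt g) (e' : src g = tgt f)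
    (e₁ : src t = tgt (comp₁ g f e')) (e₂ : src (comp₁ t g e) = tgt f) :
    k.cylinderRight h t (comp₁ g f e') e₁ =
      B.vc (B.hc (k.cylinderRight h t g e) (B.id₂ ((k.retract h).desc.ar f)))
        (k.cylinderRight h (comp₁ t g e) f e₂) := by
  rcases f with f | s | T <;> rcases g with g | s' | S <;> try cases e'
  all_goals rcases t with t | s'' | U <;> try cases e
  · exact ((base_comp_right (Sum.inl.inj e) (Sum.inl.inj e')).trans (congrArg (B.id₂ <| j.ar ·)
      (TwoCat.cmp_assoc (Sum.inl.inj e) (Sum.inl.inj e')))).symm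
  · have e := Sum.inl.inj e
    have e' := Sum.inl.inj e'
    have h₂ : A.src (s''.ends.precomp g).f = A.tgt f := (TwoCat.src_cmp e).trans e'
    have e₃ : (s''.ends.precomp (A.cmp g f)) = (s''.ends.precomp g).precomp f :=
      Span.ext rfl (TwoCat.cmp_assoc e e').symm rfl
    exact ((congrArg (B.vc · _) (k.valCe_enlarge_precomp (c := .refl (s''.ends.precomp g))
      (e := .refl (s''.ends.precomp (A.cmp g f))) ⟨rfl, rfl⟩ ⟨rfl, rfl⟩ h₂ e₃ e₃)).trans
        (k.vc_valCe_refl (s := (s''.ends.precomp g).precomp f) e₃.symm)).symm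
  · have e := Sum.inr.inj e
    exact ((congrArg (B.vc · _) (k.valCe_enlarge_precomp (c := rightMix h U s' e)
      (e := rightMix h U (s'.precomp f) e) ⟨rfl, rfl⟩ ⟨rfl, rfl⟩ (Sum.inl.inj e') rfl rfl)).trans
        (k.vc_valCe_refl (s := (s'.postcomp U e).ends.precomp f) rfl)).symm
  · have e := Sum.inr.inj e
    have e' := Sum.inr.inj e'
    refine Eq.symm ((congrArg (B.vc · _) ((congrArg (B.hc _)
      (k.valCe_refl (s.retract h)).symm).trans (k.valCe_postcomp (rightCell h U S e)
        (.refl (s.retract h)) (congrArg (fun x => i (r x)) e')).symm)).trans ?_)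
    exact k.valCe_enlarge_vc ⟨rfl, rfl⟩ rfl rfl
      (Span.ext (OrientalArrow.ext ((congrArg _ (Set.image_union _ _ _)).trans
        (Set.union_assoc _ _ _).symm)) rfl rfl) rfl
  · have e := Sum.inr.inj e
    have e' := Sum.inr.inj e'
    refine Eq.symm ((congrArg (B.vc · _) ((congrArg (B.hc _) (b.id₂_atAr _)).trans
      (b.hc_atCe (rightCell h U S e) (.refl (T.map (i.comp r)))
        (congrArg (fun x => i (r x)) e')))).trans ?_)
    exact atCe_comp rfl rfl (OrientalArrow.ext ((Set.union_assoc _ _ _).trans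
      (congrArg _ (Set.image_union _ _ _).symm)))

/-- For three chains, both ways end at `U` followed by the end points of `S` and by `ir(T)`, so all
the 2-cells are inclusions into the same chain. With formal composites, the cells are enlargements.
-/
theorem cylinder_left_right (t g f : Ar i X) (e : src t = tgt g) (e' : src g = tgt f)
    (e₁ : src t = tgt (comp₁ g f e')) (e₂ : src (comp₁ t g e) = tgt f) :
    B.vc (B.hc (B.id₂ (k.desc.ar t)) (k.cylinderRight h g f e'))
      (k.cylinderLeft h t (comp₁ g f e') e₁) =
      B.vc (B.hc (k.cylinderLeft h t g e) (B.id₂ ((k.retract h).desc.ar f)))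
        (k.cylinderRight h (comp₁ t g e) f e₂) := by
  rcases f with f | s | T <;> rcases g with g | s' | S <;> try cases e'
  all_goals rcases t with t | s'' | U <;> try cases e
  · exact (base_comp_left (Sum.inl.inj e) (Sum.inl.inj e')).trans
      (base_comp_right (Sum.inl.inj e) (Sum.inl.inj e')).symm
  · have e := Sum.inl.inj e
    have e' := Sum.inl.inj e'
    have h₁ : A.src s''.f = A.tgt (A.cmp g f) := e.trans (TwoCat.tgt_cmp e').symm
    have h₂ : A.src (s''.ends.precomp g).f = A.tgt f := (TwoCat.src_cmp e).trans e'
    have e₃ : A.cmp s''.f (A.cmp g f) = A.cmp (A.cmp s''.f g) f := (TwoCat.cmp_assoc e e').symm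
    refine (congrArg (B.vc · _) (k.id₂_val_precomp s'' _ h₁)).trans
      ((TwoCat.id_vc (k.tgt₂_valCe (leftBase (s''.precomp (A.cmp g f))))).trans ?_)
    exact ((congrArg (B.vc · _) (k.valCe_enlarge_precomp (c := leftBase (s''.precomp g))
      (e := leftBase (s''.precomp (A.cmp g f))) ⟨rfl, rfl⟩ ⟨rfl, rfl⟩ h₂ (Span.ext rfl e₃ rfl)
        (Span.ext rfl e₃ rfl))).trans
        (k.vc_valCe_refl (s := (s''.precomp g).ends.precomp f) (Span.ext rfl e₃.symm rfl))).symm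
  · have e := Sum.inr.inj e
    have e₁ : k.valCe (leftMix U (s'.precomp f) e) =
        B.hc (k.valCe (leftMix U s' e)) (B.id₂ (j.ar f)) :=
      (k.valCe_enlarge_precomp (c := leftMix U s' e) (e := leftMix U (s'.precomp f) e) ⟨rfl, rfl⟩
        ⟨rfl, rfl⟩ (Sum.inl.inj e') rfl rfl).symm
    refine Eq.trans (b := k.valCe (leftMix U (s'.precomp f) e)) ?_ (Eq.symm ?_)
    · refine (congrArg (B.vc · _) ((congrArg (B.hc · _) (b.id₂_atAr U)).trans
        (k.valCe_postcomp (.refl U) (.refl (s'.ends.precomp f)) e).symm)).trans ?_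
      exact k.valCe_enlarge_vc ⟨rfl, rfl⟩ rfl rfl rfl rfl
    · exact (congrArg (B.vc · _) e₁.symm).trans
        (k.vc_valCe_refl (s := (s'.postcomp U e).ends.precomp f) rfl)
  · have e := Sum.inr.inj e
    have e' := Sum.inr.inj e'
    refine ((congrArg (B.vc · _) ((congrArg (B.hc · _) (b.id₂_atAr U)).trans
      (k.valCe_postcomp (.refl U) (rightMix h S s _) e).symm))).trans (Eq.symm
        ((congrArg (B.vc · _) ((congrArg (B.hc _) (k.valCe_refl (s.retract h)).symm).trans
      (k.valCe_postcomp (leftCell h U S e) (.refl (s.retract h))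
        (congrArg (fun x => i (r x)) e')).symm)).trans ?_))
    exact k.valCe_square ⟨rfl, rfl⟩ ⟨rfl, rfl⟩ rfl rfl rfl
      (Span.ext (OrientalArrow.ext (Set.union_assoc _ _ _)) rfl rfl) rfl
  · have e := Sum.inr.inj e
    have e' := Sum.inr.inj e'
    refine ((congrArg (B.vc · _) ((congrArg (B.hc · _) (b.id₂_atAr U)).trans
      (b.hc_atCe (.refl U) (rightCell h S T _) e)))).trans (Eq.symm
        ((congrArg (B.vc · _) ((congrArg (B.hc _) (b.id₂_atAr _)).trans
      (b.hc_atCe (leftCell h U S e) (.refl (T.map (i.comp r)))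
        (congrArg (fun x => i (r x)) e')))).trans ?_))
    exact atCe_square rfl rfl rfl (OrientalArrow.ext (Set.union_assoc _ _ _))

/-- The cylinder between the 2-functors attached to a 2-functor with source `O(E)` and to its
composite with the retraction onto `E'`. -/
noncomputable def cylinder : OplaxCylinder (k.retract h).desc k.desc :=
  .ofPartial (C := glue i X) (k.cylinderAr h) (k.cylinderCe h) (k.cylinderLeft h)
    (k.cylinderRight h)
    (fun | .base f => j.src_ar f | .mix s => k.src_val _ | .ori S => b.src_atAr _)
    (fun | .base f => j.tgt_ar f | .mix s => k.tgt_val _ | .ori S => b.tgt_atAr _)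
    (fun | .base α => j.src₂_ce α | .mix c _ => k.src₂_valCe _ | .ori c => b.src₂_atCe _)
    (fun | .base α => j.tgt₂_ce α | .mix c _ => k.tgt₂_valCe _ | .ori c => b.tgt₂_atCe _)
    (by
      rintro (g | s' | S) (f | s | T) e <;> try cases e
      · exact B.src₂_id₂ _
      · exact k.src₂_valCe _
      · exact k.src₂_valCe _
      · exact b.src₂_atCe _)
    (by
      rintro (g | s' | S) (f | s | T) e <;> try cases e
      · exact (B.tgt₂_id₂ _).trans (j.ar_cmp (Sum.inl.inj e))
      · exact (k.tgt₂_valCe _).trans (k.val_precomp s' f (Sum.inl.inj e))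
      · exact (k.tgt₂_valCe _).trans (k.val_postcomp S s.ends (Sum.inr.inj e))
      · exact (b.tgt₂_atCe _).trans (b.atAr_union S (spread h T) (Sum.inr.inj e)))
    (by
      rintro (g | s' | S) (f | s | T) e <;> try cases e
      · exact B.src₂_id₂ _
      · exact k.src₂_valCe _
      · exact k.src₂_valCe _
      · exact b.src₂_atCe _)
    (by
      rintro (g | s' | S) (f | s | T) e <;> try cases e
      · exact (B.tgt₂_id₂ _).trans (j.ar_cmp (Sum.inl.inj e))
      · exact (k.tgt₂_valCe _).trans (k.val_precomp s'.ends f (Sum.inl.inj e))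
      · exact (k.tgt₂_valCe _).trans (k.val_postcomp (spread h S) (s.retract h)
          (congrArg (fun x => i (r x)) (Sum.inr.inj e)))
      · exact (b.tgt₂_atCe _).trans (b.atAr_union (spread h S) (T.map (i.comp r))
          (congrArg (fun x => i (r x)) (Sum.inr.inj e))))
    (fun | .base f => j.ce_id₂ f | .mix s => k.valCe_refl _ | .ori S => (b.id₂_atAr _).symm)
    (by
      rintro (g | ⟨d, hd⟩ | S) (f | ⟨c, hc⟩ | T) e <;> try cases e
      · exact j.ce_vc (Ar.base.inj e)
      · exact k.valCe_trans d.ends c.ends _ (congrArg Span.ends (Ar.mix.inj e)) rfl rfl rfl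
      · exact (b.vc_atCe (spreadCell h S) (spreadCell h T)
          (congrArg (spread h) (Ar.ori.inj e))).symm)
    (by
      rintro (f | s | S) e
      · exact congrArg (B.id₂ <| j.ar ·) (TwoCat.id_cmp rfl)
      · refine Eq.trans (b := k.valCe (.refl s.ends))
          (congrArg k.valCe (SpanCell.ext ?_ ?_ rfl)) (k.valCe_refl s.ends)
        · rfl
        · exact Span.ext (OrientalArrow.single_union _ s.ends.U rfl) rfl rfl
      · refine Eq.trans (congrArg b.atCe (OrientalCell.ext ?_ ?_)) (b.id₂_atAr (spread h S)).symm
        · rfl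
        · exact OrientalArrow.single_union _ (spread h S) rfl)
    (by
      rintro (f | s | S) e
      · exact congrArg (B.id₂ <| j.ar ·) (TwoCat.cmp_id rfl)
      · refine (k.valCe_refl _).trans (congrArg (B.id₂ <| k.val ·) ?_)
        exact Span.ext rfl (TwoCat.cmp_id rfl) rfl
      · refine Eq.trans (congrArg b.atCe (OrientalCell.ext ?_ ?_)) (b.id₂_atAr (spread h S)).symm
        · rfl
        · exact OrientalArrow.ext ((congrArg ((spread h S).S ∪ ·) Set.image_singleton).trans
            (Set.union_eq_self_of_subset_right
              (Set.singleton_subset_iff.2 (spread h S).isLeast.1))))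
    (k.cylinder_left_naturality h) (k.cylinder_right_naturality h) (k.cylinder_left_left h)
    (k.cylinder_right_right h) (k.cylinder_left_right h)

end

end GlueCompat

namespace OplaxDiagram

variable {A : TwoCat.{v}} {E : Type u} [PartialOrder E] (X : OplaxDiagram E A) {x y z : E}

/-- The cocycle condition of the section when three points lie in `E'` and the fourth does not: both
sides reduce to the constraint of `X`. -/
theorem compCe_con (h : x ≤ y) (h' : y ≤ z) :
    X.compCe x z z (A.id₁ (X.ob x)) (A.hc (A.id₂ (A.id₁ (X.ob z))) (X.con x y z))
        (A.id₂ (X.ar x z)) =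
      X.compCe x y z (A.id₁ (X.ob x)) (A.hc (A.id₂ (X.ar y z)) (A.id₂ (X.ar x y)))
        (A.id₂ (X.ar x y)) := by
  unfold compCe
  have := X.con_right (h.trans h')
  have := X.ar_self z
  have e₁ : A.hc (A.id₂ (A.id₁ (X.ob z))) (X.con x y z) = X.con x y z := TwoCat.id_hc (by grind)
  have e₂ : A.hc (X.con x y z) (A.id₂ (A.id₁ (X.ob x))) = X.con x y z := TwoCat.hc_id (by grind)
  rw [e₁, e₂]
  grind

/-- The case of exactly two points in `E'`: both sides reduce to the identity of `X.ar x y`. -/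
theorem compCe_id (h : x ≤ y) :
    X.compCe x x y (A.id₁ (X.ob x)) (A.id₂ (X.ar x y)) (A.id₂ (A.id₁ (X.ob x))) =
      X.compCe x y y (A.id₁ (X.ob x)) (A.hc (A.id₂ (A.id₁ (X.ob y))) (A.id₂ (X.ar x y)))
        (A.id₂ (X.ar x y)) := by
  unfold compCe
  have := X.con_right h
  have := X.con_left h
  have := X.ar_self x
  have := X.ar_self y
  grind

end OplaxDiagram

/-! ## The section of the gluing -/

namespace Glue

variable {A : TwoCat.{u}} {E' E : Type u} [PartialOrder E'] [PartialOrder E] {i : E' →o E}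
  {r : E →o E'} {X : OplaxDiagram E' A}

theorem cmp_base {g f : A.Ar} (h : A.src g = A.tgt f) :
    (glue i X).cmp (Ar.base g : Ar i X) (Ar.base f : Ar i X) = (Ar.base (A.cmp g f) : Ar i X) :=
  TwoCat.cmp_eq (D := glue i X) (g := Ar.base g) (f := Ar.base f)
    (congrArg Sum.inl h)

theorem cmp_mix_base {s : Span i X} {f : A.Ar} (h : A.src s.f = A.tgt f) :
    (glue i X).cmp (Ar.mix s) (Ar.base f : Ar i X) = Ar.mix (s.precomp f) :=
  TwoCat.cmp_eq (D := glue i X) (g := Ar.mix s) (f := Ar.base f)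
    (congrArg Sum.inl h)

theorem cmp_ori_mix {S : OrientalArrow E} {s : Span i X} (h : S.min = s.U.max) :
    (glue i X).cmp (Ar.ori S : Ar i X) (Ar.mix s) = Ar.mix (s.postcomp S h) :=
  TwoCat.cmp_eq (D := glue i X) (g := Ar.ori S) (f := Ar.mix s)
    (congrArg Sum.inr h)

theorem cmp_ori {S T : OrientalArrow E} (h : S.min = T.max) :
    (glue i X).cmp (Ar.ori S : Ar i X) (Ar.ori T : Ar i X) = (Ar.ori (S.union T h) : Ar i X) :=
  TwoCat.cmp_eq (D := glue i X) (g := Ar.ori S) (f := Ar.ori T)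
    (congrArg Sum.inr h)

theorem vc_congr {β β' α : (glue i X).Ce} (h : β = β') :
    (glue i X).vc β α = (glue i X).vc β' α := h ▸ rfl

theorem vc_base {β α : A.Ce} (h : A.src₂ β = A.tgt₂ α) :
    (glue i X).vc (Ce.base β : Ce i X) (Ce.base α : Ce i X) = (Ce.base (A.vc β α) : Ce i X) :=
  TwoCat.vc_eq (D := glue i X) (β := Ce.base β) (α := Ce.base α)
    (congrArg Ar.base h)

theorem vc_mix {d c : SpanCell i X} (hd : d.IsProper) (hc : c.IsProper) (h : d.dom = c.cod) :
    (glue i X).vc (Ce.mix d hd) (Ce.mix c hc) =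
      Ce.mix (d.trans c h hc) (SpanCell.trans_isProper _ _ hd) :=
  TwoCat.vc_eq (D := glue i X) (β := Ce.mix d hd) (α := Ce.mix c hc)
    (congrArg Ar.mix h)

theorem vc_mix_congr {d c d' c' : SpanCell i X} (hd : d.IsProper) (hc : c.IsProper)
    (hd' : d'.IsProper) (hc' : c'.IsProper) (h : d.dom = c.cod) (h' : d'.dom = c'.cod)
    (hdom : c.dom = c'.dom) (hcod : d.cod = d'.cod)
    (hce : X.compCe c.dom.t c.cod.t d.cod.t c.dom.f d.ce c.ce =
      X.compCe c'.dom.t c'.cod.t d'.cod.t c'.dom.f d'.ce c'.ce) :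
    (glue i X).vc (Ce.mix d hd) (Ce.mix c hc) = (glue i X).vc (Ce.mix d' hd') (Ce.mix c' hc') :=
  (vc_mix hd hc h).trans ((Ce.mix_congr (c := d.trans c h hc) (d := d'.trans c' h' hc') _ _
    hdom hcod hce).trans (vc_mix hd' hc' h').symm)

theorem vc_ori {d c : OrientalCell E} (h : d.dom = c.cod) :
    (glue i X).vc (Ce.ori d : Ce i X) (Ce.ori c : Ce i X) = (Ce.ori (d.trans c h) : Ce i X) :=
  TwoCat.vc_eq (D := glue i X) (β := Ce.ori d) (α := Ce.ori c)
    (congrArg Ar.ori h)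

theorem hc_base {β α : A.Ce} (h : A.src (A.src₂ β) = A.tgt (A.src₂ α)) :
    (glue i X).hc (Ce.base β : Ce i X) (Ce.base α : Ce i X) = (Ce.base (A.hc β α) : Ce i X) :=
  TwoCat.hc_eq (D := glue i X) (β := Ce.base β) (α := Ce.base α)
    (congrArg Sum.inl h)

theorem hc_mix_base {c : SpanCell i X} (hc : c.IsProper) {α : A.Ce}
    (h : A.src c.dom.f = A.tgt (A.src₂ α)) :
    (glue i X).hc (Ce.mix c hc) (Ce.base α : Ce i X) = Ce.mix (c.precomp α h) hc :=
  TwoCat.hc_eq (D := glue i X) (β := Ce.mix c hc) (α := Ce.base α)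
    (congrArg Sum.inl h)

theorem hc_ori_mix {d : OrientalCell E} {c : SpanCell i X} (hc : c.IsProper)
    (h : d.dom.min = c.dom.U.max) :
    (glue i X).hc (Ce.ori d : Ce i X) (Ce.mix c hc) =
      Ce.mix (c.postcomp d h) (SpanCell.postcomp_isProper _ hc) :=
  TwoCat.hc_eq (D := glue i X) (β := Ce.ori d) (α := Ce.mix c hc)
    (congrArg Sum.inr h)

theorem hc_ori {d c : OrientalCell E} (h : d.dom.min = c.dom.max) :
    (glue i X).hc (Ce.ori d : Ce i X) (Ce.ori c : Ce i X) = (Ce.ori (d.union c h) : Ce i X) :=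
  TwoCat.hc_eq (D := glue i X) (β := Ce.ori d) (α := Ce.ori c)
    (congrArg Sum.inr h)

variable (i X) in
/-- The inclusion of `A` into the gluing. -/
noncomputable def inclusion : TwoFunctor A (glue i X) :=
  .ofTotal (D := glue i X) Sum.inl Ar.base Ce.base (fun _ => rfl) (fun _ => rfl) (fun _ => rfl)
    (fun _ => rfl) (fun _ => rfl) (fun _ _ h => (cmp_base h).symm) (fun _ => rfl)
    (fun _ _ h => (vc_base h).symm) (fun _ _ h => (hc_base h).symm)

/-- The formal composite of the chain `{x, y}` and of an identity. -/
@[simps]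
def edge (x y : E) (h : x ≤ y) (hx : i (r x) = x) : Span i X where
  U := .pair x y h
  f := A.id₁ (X.ob (r x))
  t := r x
  min_eq := hx.symm
  tgt_eq := A.tgt_id₁ _

/-- The constraint for `x ≤ y ≤ z` with `y` in `E'`. -/
@[simps]
noncomputable def baseCell (x y z : E) (h : x ≤ y) (h' : y ≤ z) (hx : i (r x) = x)
    (hy : i (r y) = y) : SpanCell i X where
  dom := edge x z (h.trans h') hx
  cod := (edge y z h' hy).precomp (X.ar (r x) (r y))
  ce := A.id₂ (X.ar (r x) (r y))
  le := r.monotone h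
  subset := by
    rintro a (rfl | rfl)
    · exact Or.inl hx.symm
    · exact Or.inr (Or.inr rfl)
  max_eq := rfl
  src₂_ce := by
    have := X.src_ar (r.monotone h)
    simp only [edge_f, edge_t, Span.precomp_t]
    grind
  tgt₂_ce := by
    have := X.tgt_ar (r.monotone h)
    simp only [edge_f, Span.precomp_f]
    grind

/-- The point `y` is in `E'` and `z` is not, so if `y` belongs to `{x, z}` it is `x`. -/
theorem baseCell_isProper {x y z : E} (h : x ≤ y) (h' : y ≤ z) (hx : i (r x) = x)
    (hy : i (r y) = y) (hz : i (r z) ≠ z) :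
    (baseCell (X := X) x y z h h' hx hy).IsProper := by
  intro e
  simp only [baseCell_cod, baseCell_dom, Span.precomp_t, edge_t, edge_U, OrientalArrow.pair_S,
    hx, hy] at e ⊢
  rcases e with e | rfl
  · exact e
  · exact absurd hy hz

/-- The constraint for `x ≤ y ≤ z` with `x` in `E'`. -/
def edgeCell (x y z : E) (h : x ≤ y) (h' : y ≤ z) (hx : i (r x) = x) : SpanCell i X :=
  .enlarge (edge x z (h.trans h') hx) ((OrientalArrow.pair y z h').union (.pair x y h) rfl) hx.symm
    (OrientalCell.triple x y z h h').le rfl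

theorem edgeCell_isProper {x y z : E} (h : x ≤ y) (h' : y ≤ z) (hx : i (r x) = x) :
    (edgeCell (X := X) x y z h h' hx).IsProper := fun _ => rfl

variable (i r X)

open Classical in
/-- The values at pairs of the section of the gluing. -/
noncomputable def sectionAr (x y : E) : Ar i X :=
  if h : x ≤ y then
    if i (r y) = y then .base (X.ar (r x) (r y))
    else if hx : i (r x) = x then .mix (edge x y h hx) else .ori (.pair x y h)
  else .ori (.single x)

open Classical in
/-- The values at triples of the section of the gluing. -/
noncomputable def sectionCon (x y z : E) : Ce i X :=
  if h : x ≤ y ∧ y ≤ z then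
    if hz : i (r z) = z then .base (X.con (r x) (r y) (r z))
    else if hx : i (r x) = x then
      if hy : i (r y) = y then
        .mix (baseCell x y z h.1 h.2 hx hy) (baseCell_isProper h.1 h.2 hx hy hz)
      else .mix (edgeCell x y z h.1 h.2 hx) (edgeCell_isProper h.1 h.2 hx)
    else .ori (.triple x y z h.1 h.2)
  else .ori (.refl (.single x))

variable {i r X} {x y z t : E}

theorem sectionAr_base (h : x ≤ y) (hy : i (r y) = y) :
    sectionAr i r X x y = .base (X.ar (r x) (r y)) := by
  rw [sectionAr, dif_pos h, if_pos hy]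

theorem sectionAr_mix (h : x ≤ y) (hy : ¬ i (r y) = y) (hx : i (r x) = x) :
    sectionAr i r X x y = .mix (edge x y h hx) := by
  rw [sectionAr, dif_pos h, if_neg hy, dif_pos hx]

theorem sectionAr_ori (h : x ≤ y) (hy : ¬ i (r y) = y) (hx : ¬ i (r x) = x) :
    sectionAr i r X x y = .ori (.pair x y h) := by
  rw [sectionAr, dif_pos h, if_neg hy, dif_neg hx]

theorem sectionCon_base (h : x ≤ y) (h' : y ≤ z) (hz : i (r z) = z) :
    sectionCon i r X x y z = .base (X.con (r x) (r y) (r z)) := by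
  rw [sectionCon, dif_pos ⟨h, h'⟩, dif_pos hz]

theorem sectionCon_baseCell (h : x ≤ y) (h' : y ≤ z) (hz : ¬ i (r z) = z) (hx : i (r x) = x)
    (hy : i (r y) = y) : sectionCon i r X x y z =
      .mix (baseCell x y z h h' hx hy) (baseCell_isProper h h' hx hy hz) := by
  rw [sectionCon, dif_pos ⟨h, h'⟩, dif_neg hz, dif_pos hx, dif_pos hy]

theorem sectionCon_edgeCell (h : x ≤ y) (h' : y ≤ z) (hz : ¬ i (r z) = z) (hx : i (r x) = x)
    (hy : ¬ i (r y) = y) : sectionCon i r X x y z =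
      .mix (edgeCell x y z h h' hx) (edgeCell_isProper h h' hx) := by
  rw [sectionCon, dif_pos ⟨h, h'⟩, dif_neg hz, dif_pos hx, dif_neg hy]

theorem sectionCon_ori (h : x ≤ y) (h' : y ≤ z) (hz : ¬ i (r z) = z) (hx : ¬ i (r x) = x) :
    sectionCon i r X x y z = .ori (.triple x y z h h') := by
  rw [sectionCon, dif_pos ⟨h, h'⟩, dif_neg hz, dif_neg hx]

theorem _root_.IsRetractSieve.of_le (h : IsRetractSieve i r) (hxy : x ≤ y) (hy : i (r y) = y) :
    i (r x) = x := h.lower x (r y) (hxy.trans hy.ge)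

/-- As `E'` is a lower set, the points of `x ≤ y ≤ z ≤ t` in `E'` form an initial segment, which
leaves five cases. If all four are in `E'`, this is the cocycle condition of `X`. If none is, it is
an equality of inclusions of chains. The mixed cases compare cells of formal composites. -/
theorem section_cocycle (H : IsRetractSieve i r) (h : x ≤ y) (h' : y ≤ z) (h'' : z ≤ t) :
    (glue i X).vc ((glue i X).hc ((glue i X).id₂ (sectionAr i r X z t)) (sectionCon i r X x y z))
        (sectionCon i r X x z t) =
      (glue i X).vc ((glue i X).hc (sectionCon i r X y z t) ((glue i X).id₂ (sectionAr i r X x y)))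
        (sectionCon i r X x y t) := by
  by_cases ht : i (r t) = t
  · have hz := H.of_le h'' ht
    have hy := H.of_le h' hz
    have l := r.monotone h
    have l' := r.monotone h'
    have l'' := r.monotone h''
    rw [sectionAr_base h'' ht, sectionAr_base h hy, sectionCon_base h h' hz,
      sectionCon_base (h.trans h') h'' ht, sectionCon_base h' h'' ht,
      sectionCon_base h (h'.trans h'') ht]
    refine (vc_congr (hc_base (by grind))).trans ((vc_base (by grind)).trans
      (Eq.symm ((vc_congr (hc_base (by grind))).trans
        ((vc_base (by grind)).trans ?_))))
    exact congrArg Ce.base (X.cocycle l l' l'').symm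
  by_cases hz : i (r z) = z
  · have hy := H.of_le h' hz
    have hx := H.of_le h hy
    have l := r.monotone h
    have l' := r.monotone h'
    rw [sectionAr_mix h'' ht hz, sectionAr_base h hy, sectionCon_base h h' hz,
      sectionCon_baseCell (h.trans h') h'' ht hx hz, sectionCon_baseCell h' h'' ht hy hz,
      sectionCon_baseCell h (h'.trans h'') ht hx hy]
    have e₁ : A.src (A.id₁ (X.ob (r z))) = A.tgt (A.src₂ (X.con (r x) (r y) (r z))) := by grind
    have e₂ : A.src (A.id₁ (X.ob (r y))) = A.tgt (A.src₂ (A.id₂ (X.ar (r x) (r y)))) := by grind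
    refine (vc_congr
      (hc_mix_base (c := .refl (edge z t h'' hz)) (SpanCell.refl_isProper _) e₁)).trans
      (Eq.trans (vc_mix_congr _ _ _ _ ?_ ?_ ?_ ?_ ?_) (Eq.symm (vc_congr
        (hc_mix_base (c := baseCell y z t h' h'' hy hz) (α := A.id₂ (X.ar (r x) (r y))) _ e₂))))
    · exact congrArg (edge z t h'' hz).precomp (X.src₂_con l l')
    · exact congrArg (edge y t (h'.trans h'') hy).precomp (A.src₂_id₂ _)
    · rfl
    · have e : A.cmp (A.id₁ (X.ob (r z))) (A.tgt₂ (X.con (r x) (r y) (r z))) =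
          A.cmp (A.cmp (A.id₁ (X.ob (r z))) (X.ar (r y) (r z)))
            (A.tgt₂ (A.id₂ (X.ar (r x) (r y)))) := by grind
      exact Span.ext rfl e rfl
    · exact X.compCe_con l l'
  by_cases hy : i (r y) = y
  · have hx := H.of_le h hy
    have l := r.monotone h
    rw [sectionAr_ori h'' ht hz, sectionAr_base h hy, sectionCon_baseCell h h' hz hx hy,
      sectionCon_edgeCell (h.trans h') h'' ht hx hz, sectionCon_edgeCell h' h'' ht hy hz,
      sectionCon_baseCell h (h'.trans h'') ht hx hy]
    have e₂ : A.src (A.id₁ (X.ob (r y))) = A.tgt (A.src₂ (A.id₂ (X.ar (r x) (r y)))) := by grind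
    refine (vc_congr
      (hc_ori_mix (d := .refl (.pair z t h'')) (c := baseCell x y z h h' hx hy) _ rfl)).trans
      (Eq.trans (vc_mix_congr _ _ _ _ ?_ ?_ ?_ ?_ ?_) (Eq.symm (vc_congr
        (hc_mix_base (c := edgeCell y z t h' h'' hy) (α := A.id₂ (X.ar (r x) (r y))) _ e₂))))
    · rfl
    · exact congrArg (edge y t (h'.trans h'') hy).precomp (A.src₂_id₂ _)
    · rfl
    · exact Span.ext rfl (congrArg (A.cmp _) (A.tgt₂_id₂ _).symm) rfl
    · exact X.compCe_id l
  by_cases hx : i (r x) = x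
  · rw [sectionAr_ori h'' ht hz, sectionAr_mix h hy hx, sectionCon_edgeCell h h' hz hx hy,
      sectionCon_edgeCell (h.trans h') h'' ht hx hz, sectionCon_ori h' h'' ht hy,
      sectionCon_edgeCell h (h'.trans h'') ht hx hy]
    refine (vc_congr
      (hc_ori_mix (d := .refl (.pair z t h'')) (c := edgeCell x y z h h' hx) _ rfl)).trans
      (Eq.trans (vc_mix_congr _ _ _ _ ?_ ?_ ?_ ?_ ?_) (Eq.symm (vc_congr
        (hc_ori_mix (d := .triple y z t h' h'') (c := .refl (edge x y h hx))
          (SpanCell.refl_isProper _) rfl))))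
    · rfl
    · rfl
    · rfl
    · exact Span.ext (OrientalArrow.ext (Set.union_assoc _ _ _).symm) rfl rfl
    · rfl
  · rw [sectionAr_ori h'' ht hz, sectionAr_ori h hy hx, sectionCon_ori h h' hz hx,
      sectionCon_ori (h.trans h') h'' ht hx, sectionCon_ori h' h'' ht hy,
      sectionCon_ori h (h'.trans h'') ht hx]
    refine (vc_congr (hc_ori rfl)).trans ((vc_ori rfl).trans
      (Eq.symm ((vc_congr (hc_ori rfl)).trans ((vc_ori rfl).trans ?_))))
    exact congrArg Ce.ori (OrientalCell.ext rfl (OrientalArrow.ext (Set.union_assoc _ _ _)))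

theorem cmp_sectionAr (H : IsRetractSieve i r) (h : x ≤ y) (h' : y ≤ z) :
    (glue i X).tgt₂ (sectionCon i r X x y z) =
      (glue i X).cmp (sectionAr i r X y z) (sectionAr i r X x y) := by
  by_cases hz : i (r z) = z
  · have hy := H.of_le h' hz
    have l := r.monotone h
    have l' := r.monotone h'
    rw [sectionCon_base h h' hz, sectionAr_base h' hz, sectionAr_base h hy]
    exact (congrArg Ar.base (X.tgt₂_con l l')).trans (cmp_base (by grind)).symm
  by_cases hy : i (r y) = y
  · have hx := H.of_le h hy
    have l := r.monotone h
    rw [sectionCon_baseCell h h' hz hx hy, sectionAr_mix h' hz hy, sectionAr_base h hy]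
    exact (cmp_mix_base (s := edge y z h' hy) ((A.src_id₁ _).trans (X.tgt_ar l).symm)).symm
  by_cases hx : i (r x) = x
  · rw [sectionCon_edgeCell h h' hz hx hy, sectionAr_ori h' hz hy, sectionAr_mix h hy hx]
    exact (cmp_ori_mix (s := edge x y h hx) rfl).symm
  · rw [sectionCon_ori h h' hz hx, sectionAr_ori h' hz hy, sectionAr_ori h hy hx]
    exact (cmp_ori rfl).symm

variable (i r X) in
open Classical in
/-- The values at objects of the section of the gluing. -/
noncomputable def sectionOb (x : E) : A.Ob ⊕ E :=
  if i (r x) = x then .inl (X.ob (r x)) else .inr x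

theorem sectionOb_pos (hx : i (r x) = x) : sectionOb i r X x = .inl (X.ob (r x)) := if_pos hx

theorem sectionOb_neg (hx : ¬ i (r x) = x) : sectionOb i r X x = .inr x := if_neg hx

/-- The section of the gluing, on `O(E)`. -/
noncomputable def sectionDiagram (H : IsRetractSieve i r) (X : OplaxDiagram E' A) :
    OplaxDiagram E (glue i X) where
  ob := sectionOb i r X
  ar := sectionAr i r X
  con := sectionCon i r X
  src_ar {x y} h := by
    by_cases hy : i (r y) = y
    · rw [sectionAr_base h hy]
      exact (congrArg Sum.inl (X.src_ar (r.monotone h))).trans (sectionOb_pos (H.of_le h hy)).symm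
    by_cases hx : i (r x) = x
    · rw [sectionAr_mix h hy hx]
      exact (congrArg Sum.inl (A.src_id₁ _)).trans (sectionOb_pos hx).symm
    · rw [sectionAr_ori h hy hx]
      exact (sectionOb_neg hx).symm
  tgt_ar {x y} h := by
    by_cases hy : i (r y) = y
    · rw [sectionAr_base h hy]
      exact (congrArg Sum.inl (X.tgt_ar (r.monotone h))).trans (sectionOb_pos hy).symm
    by_cases hx : i (r x) = x
    · rw [sectionAr_mix h hy hx]
      exact (sectionOb_neg hy).symm
    · rw [sectionAr_ori h hy hx]
      exact (sectionOb_neg hy).symm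
  src₂_con {x y z} h h' := by
    by_cases hz : i (r z) = z
    · rw [sectionCon_base h h' hz, sectionAr_base (h.trans h') hz]
      exact congrArg Ar.base (X.src₂_con (r.monotone h) (r.monotone h'))
    by_cases hx : i (r x) = x
    · rw [sectionAr_mix (h.trans h') hz hx]
      by_cases hy : i (r y) = y
      · rw [sectionCon_baseCell h h' hz hx hy]
        rfl
      · rw [sectionCon_edgeCell h h' hz hx hy]
        rfl
    · rw [sectionCon_ori h h' hz hx, sectionAr_ori (h.trans h') hz hx]
      rfl
  tgt₂_con h h' := cmp_sectionAr H h h'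
  ar_self x := by
    by_cases hx : i (r x) = x
    · rw [sectionAr_base le_rfl hx]
      exact (congrArg Ar.base (X.ar_self _)).trans
        (congrArg (glue i X).id₁ (sectionOb_pos hx)).symm
    · rw [sectionAr_ori le_rfl hx hx]
      exact (congrArg Ar.ori (OrientalArrow.ext (Set.pair_eq_singleton x))).trans
        (congrArg (glue i X).id₁ (sectionOb_neg hx)).symm
  con_left {x y} h := by
    by_cases hy : i (r y) = y
    · rw [sectionCon_base le_rfl h hy, sectionAr_base h hy]
      exact congrArg Ce.base (X.con_left (r.monotone h))
    by_cases hx : i (r x) = x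
    · rw [sectionCon_baseCell le_rfl h hy hx hx, sectionAr_mix h hy hx]
      refine Ce.mix_congr _ _ rfl (Span.ext rfl ?_ rfl) ?_
      · exact (congrArg (A.cmp _) (X.ar_self _)).trans (TwoCat.id_cmp (A.tgt_id₁ _))
      · exact congrArg A.id₂ (X.ar_self _)
    · rw [sectionCon_ori le_rfl h hy hx, sectionAr_ori h hy hx]
      refine congrArg Ce.ori (OrientalCell.ext rfl (OrientalArrow.ext ?_))
      exact Set.union_eq_self_of_subset_right (by rintro a (rfl | rfl) <;> exact Or.inl rfl)
  con_right {x y} h := by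
    by_cases hy : i (r y) = y
    · rw [sectionCon_base h le_rfl hy, sectionAr_base h hy]
      exact congrArg Ce.base (X.con_right (r.monotone h))
    have e : (OrientalArrow.pair y y le_rfl).S ∪ (OrientalArrow.pair x y h).S =
        (OrientalArrow.pair x y h).S :=
      Set.union_eq_self_of_subset_left (by rintro a (rfl | rfl) <;> exact Or.inr rfl)
    by_cases hx : i (r x) = x
    · rw [sectionCon_edgeCell h le_rfl hy hx hy, sectionAr_mix h hy hx]
      exact Ce.mix_congr _ _ rfl (Span.ext (OrientalArrow.ext e) rfl rfl) rfl
    · rw [sectionCon_ori h le_rfl hy hx, sectionAr_ori h hy hx]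
      exact congrArg Ce.ori (OrientalCell.ext rfl (OrientalArrow.ext e))
  cocycle h h' h'' := section_cocycle H h h' h''

end Glue

/-! ## Cobase changes of a sieve -/

namespace GlueCompat

open Glue

variable {A B : TwoCat.{u}} {E' E : Type u} [PartialOrder E'] [PartialOrder E]
  {i : E' →o E} {r : E →o E'} {X : OplaxDiagram E' A} {j : TwoFunctor A B}
  {b : TwoFunctor (TwoCat.oriental E) B} (k : GlueCompat i X j b)

/-- Evaluation is built from compositions only, so it is preserved by a 2-functor `θ` out of `B`.
Applied to `ρ` followed by `j`, this identifies the source of the cylinder. -/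
theorem desc_comp {C : TwoCat.{u}} {j' : TwoFunctor A C} {b' : TwoFunctor (TwoCat.oriental E) C}
    (θ : TwoFunctor B C) (hj : TwoFunctor.comp j θ = j') (hb : TwoFunctor.comp b θ = b')
    (k' : GlueCompat i X j' b') : TwoFunctor.comp k.desc θ = k'.desc := by
  subst hj hb
  refine TwoFunctor.ext (funext ?_) (funext ?_) (funext ?_)
  · rintro (x | x) <;> rfl
  · rintro (f | s | S)
    · rfl
    · exact θ.ar_cmp ((k.atAr_U_src s).trans (k.ar_f_tgt s).symm)
    · rfl
  · rintro (f | ⟨c, hc⟩ | S)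
    · rfl
    · have h₁ : B.src (B.src₂ (B.id₂ (b.atAr c.cod.U))) = B.tgt (B.src₂ (j.ce c.ce)) := by
        have := c.le
        have := k.ob
        grind
      have h₂ : B.src (B.src₂ (b.atCe c.incl)) = B.tgt (B.src₂ (B.id₂ (j.ar c.dom.f))) := by
        have := k.ob
        grind [SpanCell.incl_dom]
      have e₁ := (θ.ce_hc h₁).trans (congrArg (C.hc · _) (θ.ce_id₂ _))
      have e₂ := (θ.ce_hc h₂).trans (congrArg (C.hc _) (θ.ce_id₂ _))
      exact (θ.ce_vc (k.valCe_aux c)).trans (congrArg₂ C.vc e₁ e₂)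
    · rfl

theorem desc_sectionOb (x : E) : k.desc.ob (sectionOb i r X x) = b.atOb x := by
  by_cases hx : i (r x) = x
  · exact (congrArg k.desc.ob (sectionOb_pos hx)).trans
      ((k.ob (r x)).symm.trans (congrArg b.atOb hx))
  · exact congrArg k.desc.ob (sectionOb_neg hx)

theorem hc_ar_id {β : B.Ce} {x : A.Ob} (h : B.src (B.src₂ β) = j.ob x) :
    B.hc β (B.id₂ (j.ar (A.id₁ x))) = β := by
  rw [j.ar_id₁, TwoCat.hc_id h]

theorem desc_sectionAr (H : IsRetractSieve i r) {x y : E} (h : x ≤ y) :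
    k.desc.ar (sectionAr i r X x y) = b.atAr (.pair x y h) := by
  by_cases hy : i (r y) = y
  · have hx := H.of_le h hy
    refine (congrArg k.desc.ar (sectionAr_base h hy)).trans ((k.ar (r.monotone h)).symm.trans
      (congrArg b.atAr (OrientalArrow.ext ?_)))
    exact congrArg₂ (fun a a' => ({a, a'} : Set E)) hx hy
  by_cases hx : i (r x) = x
  · refine (congrArg k.desc.ar (sectionAr_mix h hy hx)).trans
      ((congrArg (B.cmp _) (j.ar_id₁ _)).trans (TwoCat.cmp_id ?_))
    exact k.atAr_U_src (edge x y h hx)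
  · exact congrArg k.desc.ar (sectionAr_ori h hy hx)

/-- If `x` is in `E'` and `z` is not, the formal composites involve an identity of `A` and evaluate
to chains. For `y` in `E'`, the part coming from `A` is an identity 2-cell, and the inclusion of
chains alone remains. -/
theorem desc_sectionCon (H : IsRetractSieve i r) {x y z : E} (h : x ≤ y) (h' : y ≤ z) :
    k.desc.ce (sectionCon i r X x y z) = b.atCe (.triple x y z h h') := by
  by_cases hz : i (r z) = z
  · have hy := H.of_le h' hz
    have hx := H.of_le h hy
    refine (congrArg k.desc.ce (sectionCon_base h h' hz)).trans
      ((k.con (r.monotone h) (r.monotone h')).symm.trans (congrArg b.atCe ?_))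
    congr 1
  by_cases hx : i (r x) = x
  · have hs : B.src (b.atAr (.pair x z (h.trans h'))) = j.ob (X.ob (r x)) :=
      k.atAr_U_src (edge x z (h.trans h') hx)
    by_cases hy : i (r y) = y
    · refine (congrArg k.desc.ce (sectionCon_baseCell h h' hz hx hy)).trans ?_
      have e : (baseCell (X := X) x y z h h' hx hy).incl = .triple x y z h h' :=
        OrientalCell.ext rfl (OrientalArrow.ext
          (congrArg₂ (fun a a' => ({y, z} ∪ {a, a'} : Set E)) hx hy))
      have l := r.monotone h
      have hs' : B.src (b.atAr (.pair y z h')) = j.ob (X.ob (r y)) :=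
        k.atAr_U_src (edge y z h' hy)
      have e₁ : B.hc (B.id₂ (b.atAr (.pair y z h'))) (j.ce (A.id₂ (X.ar (r x) (r y)))) =
          B.id₂ (b.atAr (OrientalCell.triple x y z h h').cod) := by
        have e₂ : b.atAr (OrientalCell.triple x y z h h').cod =
            B.cmp (b.atAr (.pair y z h')) (b.atAr (.pair x y h)) :=
          b.atAr_union (.pair y z h') (.pair x y h) rfl
        have e₃ : b.atAr (.pair x y h) = j.ar (X.ar (r x) (r y)) :=
          (k.desc_sectionAr H h).symm.trans (congrArg k.desc.ar (sectionAr_base h hy))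
        rw [j.ce_id₂, TwoCat.hc_id₂, e₂, e₃]
        grind
      have e₂ : B.hc (b.atCe (.triple x y z h h')) (B.id₂ (j.ar (A.id₁ (X.ob (r x))))) =
          b.atCe (.triple x y z h h') := hc_ar_id ((congrArg B.src (b.src₂_atCe _)).trans hs)
      exact (congrArg₂ B.vc e₁ ((congrArg (fun d => B.hc (b.atCe d) _) e).trans e₂)).trans
        (TwoCat.id_vc (b.tgt₂_atCe _))
    · refine (congrArg k.desc.ce (sectionCon_edgeCell h h' hz hx hy)).trans
        ((k.valCe_eq_of_id (edgeCell x y z h h' hx) (.triple x y z h h') rfl rfl rfl rfl).trans ?_)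
      exact hc_ar_id ((congrArg B.src (b.src₂_atCe _)).trans hs)
  · exact congrArg k.desc.ce (sectionCon_ori h h' hz hx)

theorem section_desc (H : IsRetractSieve i r) :
    TwoFunctor.comp (sectionDiagram H X).toFunctor k.desc = b := by
  refine TwoFunctor.oriental_ext (fun x => k.desc_sectionOb x) (fun x y h => ?_)
    fun x y z h h' => ?_
  · exact (congrArg k.desc.ar ((sectionDiagram H X).toFunctor_pair x y h)).trans
      (k.desc_sectionAr H h)
  · exact (congrArg k.desc.ce ((sectionDiagram H X).toFunctor_triple x y z h h')).trans
      (k.desc_sectionCon H h h')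

end GlueCompat

section

open Glue

variable {A B : TwoCat.{u}} {E' E : Type u} [PartialOrder E'] [PartialOrder E]
  {i : E' →o E} {r : E →o E'}

/-- The compatibility needed to define a 2-functor from the pushout to the gluing: over `E'`, the
section takes its values on the `A` side and is given by `F`. -/
theorem comp_inclusion (H : IsRetractSieve i r) (F : TwoFunctor (TwoCat.oriental E') A) :
    TwoFunctor.comp F (inclusion i (.ofFunctor F)) =
      TwoFunctor.comp (TwoCat.orientalMap i) (sectionDiagram H (.ofFunctor F)).toFunctor := by
  have hi (x : E') : i (r (i x)) = i x := congrArg i (H.ri x)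
  refine TwoFunctor.oriental_ext (fun x => ?_) (fun x y h => ?_) fun x y z h h' => ?_
  · refine Eq.trans ?_ (sectionOb_pos (X := .ofFunctor F) (hi x)).symm
    exact congrArg (fun y => Sum.inl (F.atOb y)) (H.ri x).symm
  · refine Eq.trans ?_ ((congrArg (sectionDiagram H (.ofFunctor F)).toFunctor.atAr
      (OrientalArrow.map_pair i x y h)).trans
      (((sectionDiagram H (.ofFunctor F)).toFunctor_pair _ _ (i.monotone h)).trans
        (sectionAr_base (X := .ofFunctor F) (i.monotone h) (hi y)))).symm
    refine congrArg Ar.base ((OplaxDiagram.ofFunctor_ar F h).symm.trans ?_)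
    rw [H.ri, H.ri]
  · refine Eq.trans ?_ ((congrArg (sectionDiagram H (.ofFunctor F)).toFunctor.atCe
      (OrientalCell.map_triple i x y z h h')).trans
      (((sectionDiagram H (.ofFunctor F)).toFunctor_triple _ _ _ (i.monotone h)
        (i.monotone h')).trans (sectionCon_base (X := .ofFunctor F) (i.monotone h)
          (i.monotone h') (hi z)))).symm
    refine congrArg Ce.base ((OplaxDiagram.ofFunctor_con F h h').symm.trans ?_)
    rw [H.ri, H.ri, H.ri]

theorem GlueCompat.ofFunctor {F : TwoFunctor (TwoCat.oriental E') A} {j : TwoFunctor A B}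
    {b : TwoFunctor (TwoCat.oriental E) B}
    (w : TwoFunctor.comp F j = TwoFunctor.comp (TwoCat.orientalMap i) b) :
    GlueCompat i (.ofFunctor F) j b where
  ob t := (congrArg (fun G => TwoFunctor.atOb G t) w).symm
  ar {t t'} h := by
    rw [OplaxDiagram.ofFunctor_ar F h]
    exact (congrArg b.atAr (OrientalArrow.map_pair i t t' h)).symm.trans
      (congrArg (fun G => TwoFunctor.atAr G (.pair t t' h)) w).symm
  con {t t' t''} h h' := by
    rw [OplaxDiagram.ofFunctor_con F h h']
    exact (congrArg b.atCe (OrientalCell.map_triple i t t' t'' h h')).symm.trans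
      (congrArg (fun G => TwoFunctor.atCe G (.triple t t' t'' h h')) w).symm

end

/-- A pushout of the inclusion of a sieve with a retraction is a Thomason weak equivalence. -/
theorem IsRetractSieve.isThomasonWeakEquivalence {E' E : PartOrd.{u}} {i : E' ⟶ E} {r : E ⟶ E'}
    (H : IsRetractSieve i.hom r.hom) {A B : TwoCat.{u}} {F : orientalFunctor.obj E' ⟶ A}
    {j : A ⟶ B} {b : orientalFunctor.obj E ⟶ B}
    (hp : IsPushout F (orientalFunctor.map i) j b) : IsThomasonWeakEquivalence j := by
  have hir : i ≫ r = 𝟙 E' := by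
    ext x
    exact H.ri x
  let X : OplaxDiagram E' A := .ofFunctor F
  have k : GlueCompat i.hom X j b := .ofFunctor hp.w
  -- Retracting `O(E)` onto `O(E')` brings it to where `F` is defined; this agrees with the identity
  -- of `A` because `r` retracts `i`.
  let ρ : B ⟶ A := hp.desc (𝟙 A) (orientalFunctor.map r ≫ F) (by
    rw [← Category.assoc, ← Functor.map_comp, hir, CategoryTheory.Functor.map_id, Category.id_comp,
      Category.comp_id])
  have hjρ : j ≫ ρ = 𝟙 A := hp.inl_desc _ _ _
  have hbρ : b ≫ ρ = orientalFunctor.map r ≫ F := hp.inr_desc _ _ _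
  -- The pushout is a retract of the gluing, by `hsq` below, so a homotopy constructed on the gluing
  -- can be restricted to it.
  let s : B ⟶ glue i.hom X := hp.desc (Glue.inclusion i.hom X)
    (Glue.sectionDiagram H X).toFunctor (comp_inclusion H F)
  let q : glue i.hom X ⟶ B := k.desc
  have hsq : s ≫ q = 𝟙 B := by
    refine hp.hom_ext ?_ ?_
    · exact (Category.assoc _ _ _).symm.trans
        ((congrArg (· ≫ q) (hp.inl_desc _ _ _)).trans (Category.comp_id j).symm)
    · exact (Category.assoc _ _ _).symm.trans
        ((congrArg (· ≫ q) (hp.inr_desc _ _ _)).trans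
          ((k.section_desc H).trans (Category.comp_id b).symm))
  -- The source of the cylinder is thus `jρ` restricted along `q`: both are evaluations with
  -- component `j` on `A` and component `b` after `O(ir)` on `O(E)`.
  have hq : q ≫ ρ ≫ j = (k.retract H).desc := by
    have e₁ : TwoFunctor.comp j (ρ ≫ j) = j :=
      (Category.assoc _ _ _).symm.trans ((congrArg (· ≫ j) hjρ).trans (Category.id_comp j))
    have e₂ : TwoFunctor.comp b (ρ ≫ j) =
        TwoFunctor.comp (TwoCat.orientalMap (i.hom.comp r.hom)) b := by
      refine (Category.assoc _ _ _).symm.trans ((congrArg (· ≫ j) hbρ).trans ?_)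
      refine (Category.assoc _ _ _).trans ((congrArg (_ ≫ ·) hp.w).trans ?_)
      refine (Category.assoc _ _ _).symm.trans (congrArg (· ≫ b) ?_)
      exact (orientalFunctor.map_comp r i).symm
    exact k.desc_comp (ρ ≫ j) e₁ e₂ (k.retract H)
  have hρj : nerve₂.map s ≫ nerve₂.map (q ≫ ρ ≫ j) = nerve₂.map ρ ≫ nerve₂.map j := by
    rw [← Functor.map_comp, ← Functor.map_comp, ← Category.assoc, hsq, Category.id_comp]
  have hq' : nerve₂.map s ≫ nerve₂.map q = 𝟙 _ := by
    rw [← Functor.map_comp, hsq, CategoryTheory.Functor.map_id]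
  rw [hq] at hρj
  refine IsSimplicialWeakEquivalence.of_homotopy _ (nerve₂.map ρ)
    (by rw [← Functor.map_comp, hjρ, CategoryTheory.Functor.map_id]) ?_
  -- Both ends of the desired homotopy are now precomposed with `N₂(s)`, and the homotopy of the
  -- cylinder joins what follows.
  rw [← hρj, ← hq']
  exact SSet.RelativeMorphism.Homotopy.precomp ((k.cylinder H).homotopy)
    (SSet.RelativeMorphism.botEquiv.symm (nerve₂.map s)) (Subsingleton.elim _ _)

theorem IsRetractSieve.isThomasonWeakEquivalence_of_isPushout {E' E : PartOrd.{u}} {i : E' ⟶ E}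
    {r : E ⟶ E'} (H : IsRetractSieve i.hom r.hom) {A B : TwoCat.{u}} {a : c₂N.obj E' ⟶ A}
    {j : A ⟶ B} {b : c₂N.obj E ⟶ B} (hp : IsPushout a (c₂N.map i) j b) :
    IsThomasonWeakEquivalence j := by
  refine H.isThomasonWeakEquivalence (F := inv (comparison E') ≫ a)
    (b := inv (comparison E) ≫ b) (hp.of_iso (asIso (comparison E')) (Iso.refl _)
      (asIso (comparison E)) (Iso.refl _) ?_ (comparison_naturality i) ?_ ?_)
  · simp
  · simp
  · simp

theorem mainTheorem7 {E' E : PartOrd.{u}} (i : E' ⟶ E) (hi : IsPosetSieve i)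
    (r : E ⟶ E') (hr : i ≫ r = 𝟙 E') (hadj : GaloisConnection i r) :
    -- `c₂N(i)` is a strong oplax deformation retract 2-sieve,
    IsStrongOplaxRetractSieve (c₂N.map i) ∧
    -- more precisely, the retraction `c₂N(r)` and the oplax homotopy given by the explicit
    -- formulas, read through the canonical isomorphism `c₂N(E) ≅ O(E)`, form such a structure,
    IsIso (comparison E) ∧
    (∃ s : StrongOplaxRetractStructure (c₂N.map i), s.r = c₂N.map r ∧
      (∀ x, (comparison E).ob (s.homotopy.H.ob (TwoCat.I.pt 0, x)) =
        i (r ((comparison E).ob x))) ∧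
      (∀ x, (comparison E).ob (s.homotopy.H.ob (TwoCat.I.pt 1, x)) = (comparison E).ob x) ∧
      (∀ f, ((comparison E).ar (s.homotopy.H.ar (TwoCat.I.id₁ (TwoCat.I.pt 0), f))).S =
        (fun y => i (r y)) '' ((comparison E).ar f).S) ∧
      (∀ f, ((comparison E).ar (s.homotopy.H.ar (TwoCat.I.id₁ (TwoCat.I.pt 1), f))).S =
        ((comparison E).ar f).S) ∧
      (∀ f, ((comparison E).ar (s.homotopy.H.ar (TwoCat.I.arrow, f))).S =
        homotopyChain i r ((comparison E).ar f))) ∧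
    -- `c₂N(i)` is a Thomason weak equivalence, and so is each of its cobase changes.
    IsThomasonWeakEquivalence (c₂N.map i) ∧
    (∀ {A' B' : TwoCat.{u}} (a : c₂N.obj E' ⟶ A') (i' : A' ⟶ B') (b : c₂N.obj E ⟶ B'),
      IsPushout a (c₂N.map i) i' b → IsThomasonWeakEquivalence i') := by
  have h := hi.isRetractSieve hr hadj
  exact ⟨⟨hi.isSieve h, ⟨h.retractStructure⟩⟩, inferInstance, h.explicit,
    -- The 2-functor `c₂N(i)` is its own cobase change along an identity.
    h.isThomasonWeakEquivalence_of_isPushout (.of_horiz_isIso ⟨by simp⟩ : IsPushout (𝟙 _) _ _ (𝟙 _)),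
    fun a i' b hp => h.isThomasonWeakEquivalence_of_isPushout hp⟩
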